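/- Let $R=(\mathbb Z/3\mathbb Z)[X_0,\dots,X_4]$ and consider the cubic forms \[ \begin{aligned} f ={}& X_0^3-X_0^2X_2+X_0X_1X_2+X_0X_2^2+X_1X_2^2-X_0^2X_3-X_1X_2X_3-X_2^2X_3-X_1X_3^2-X_2X_3^2-X_3^3\\ &+X_0^2X_4-X_0X_1X_4-X_1^2X_4-X_1X_2X_4-X_0X_3X_4+X_1X_3X_4+X_2X_3X_4-X_3^2X_4+X_2X_4^2+X_3X_4^2+X_4^3,\\ g ={}& X_0X_1^2-X_1^3+X_0^2X_2-X_0X_1X_2-X_0X_2^2-X_1X_2^2+X_0^2X_3-X_0X_1X_3-X_1X_2X_3+X_2^2X_3+X_0X_3^2\\ &-X_3^3-X_0X_1X_4-X_1^2X_4+X_0X_2X_4+X_1X_2X_4+X_0X_3X_4+X_2X_3X_4+X_3^2X_4,\\ h ={}& X_0^2X_1-X_1^3-X_0^2X_2+X_0X_1X_2-X_1^2X_2-X_0^2X_3-X_1X_2X_3+X_1X_3^2\\ &+X_0X_1X_4+X_1^2X_4+X_0X_2X_4-X_1X_2X_4+X_0X_3X_4+X_1X_3X_4+X_1X_4^2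 . \end{aligned} \] Let $J=(f,g,h)$. Then: 1. The graded $R$-module $R/J$ has the minimal graded free resolution \[ 0\to R(-9)\to R(-8)^5\to R(-7)^{10}\to R(-6)^8\to R(-3)^3\to R\to R/J\to 0 ; \] that is, its nonzero graded Betti numbers are $\beta_{0,0}=1$, $\beta_{1,3}=3$, $\beta_{2,6}=8$, $\beta_{3,7}=10$, $\beta_{4,8}=5$, $\beta_{5,9}=1$. 2. $\operatorname{pd}_R(R/J)=5$. In particular, an ideal generated by three cubic forms can have projective dimension (of the quotient) greater than $4$. 3. The unmixed part $J^{\mathrm{unm}}$ of $J$ (the intersection of those primary components $Q$ of $J$ with $\operatorname{height} Q=\operatorname{height} J$) is linked to a generic projection of the Veronese surface: there are an ideal $I'\subset R$ and cubic forms $p_1,p_2$ forming a regular sequence such that $I'$ is the defining ideal of the image of the Veronese surface $V\subset\mathbb P^5$ under a linear projection $\mathbb P^5\dashrightarrow\mathbb P^4$ from a point (i.e. $I'$ is the kernel of a map $R\to (\mathbb Z/3\mathbb Z)[Y_0,\dots,Y_5]/I(V)$, $X_i\mapsto \ell_i$, with linearly independent linear forms $\ell_0,\dots,\ell_4$), $I'$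 is minimally generated by seven cubic forms, $J^{\mathrm{unm}}=(p_1,p_2):I'$ and $I'=(p_1,p_2):J^{\mathrm{unm}}$, and $J^{\mathrm{unm}}$ is minimally generated by five cubic forms. -/

import Mathlib

namespace ThreeCubics

open MvPolynomial

/-- A minimal graded free resolution
`⋯ → ⨁ₜ R(-deg 1 t) → ⨁ₛ R(-deg 0 s) → R ⧸ J → 0` of `R ⧸ J` over the standard graded
polynomial ring `R = k[X₀, …, Xₙ₋₁]`. The `i`-th free module has the basis `Fin (rank i)`, whose
element `s` has degree `deg i s`; the augmentation sends the basis element `s` of the `0`-th module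
to the class of the form `gen s`, and the differentials are matrices of forms. The resolution may
be finite: the ranks are then `0` from some point on. -/
structure MinimalGradedFreeResolution {k : Type*} [Field k] {n : ℕ}
    (J : Ideal (MvPolynomial (Fin n) k)) where
  rank : ℕ → ℕ
  deg : (i : ℕ) → Fin (rank i) → ℕ
  gen : Fin (rank 0) → MvPolynomial (Fin n) k
  d : (i : ℕ) → Matrix (Fin (rank i)) (Fin (rank (i + 1))) (MvPolynomial (Fin n) k)
  /-- the augmentation is homogeneous of degree `0` -/
  gen_homogeneous : ∀ s, (gen s).IsHomogeneous (deg 0 s)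
  /-- the differentials are homogeneous of degree `0` -/
  d_homogeneous : ∀ i s t, d i s t ≠ 0 →
    ∃ m, deg i s + m = deg (i + 1) t ∧ (d i s t).IsHomogeneous m
  /-- minimality: the entries of the differentials lie in the ideal `(X₀, …, Xₙ₋₁)` -/
  d_minimal : ∀ i s t, constantCoeff (d i s t) = 0
  augmentation_surjective : Function.Surjective
    (Fintype.linearCombination (MvPolynomial (Fin n) k) (fun s => Ideal.Quotient.mk J (gen s)))
  exact_zero : Function.Exact (d 0).mulVecLin
    (Fintype.linearCombination (MvPolynomial (Fin n) k) (fun s => Ideal.Quotient.mk J (gen s)))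
  exact_succ : ∀ i, Function.Exact (d (i + 1)).mulVecLin (d i).mulVecLin

/-- The graded Betti number `β i j`: the number of summands `R(-j)` in homological degree `i`. -/
def MinimalGradedFreeResolution.betti {k : Type*} [Field k] {n : ℕ}
    {J : Ideal (MvPolynomial (Fin n) k)} (F : MinimalGradedFreeResolution J) (i j : ℕ) : ℕ :=
  (Finset.univ.filter (fun s => F.deg i s = j)).card

/-- `R ⧸ J` has the graded Betti numbers `β i j`. -/
def HasGradedBettiNumbers {k : Type*} [Field k] {n : ℕ}
    (J : Ideal (MvPolynomial (Fin n) k)) (β : ℕ → ℕ → ℕ) : Prop :=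
  ∃ F : MinimalGradedFreeResolution J, ∀ i j, F.betti i j = β i j

/-- The ideal `J` is minimally generated by `m` forms of degree `d`. (Forms of the same degree
form a minimal system of generators iff they are linearly independent over `k`.) -/
def IsMinimallyGeneratedByForms {k : Type*} [Field k] {n : ℕ}
    (J : Ideal (MvPolynomial (Fin n) k)) (m d : ℕ) : Prop :=
  ∃ v : Fin m → MvPolynomial (Fin n) k,
    (∀ i, (v i).IsHomogeneous d) ∧ LinearIndependent k v ∧ J = Ideal.span (Set.range v)

/-- The unmixed part of `J`: the intersection of the primary components `Q` of `J` with
`height Q = height J`. (These components do not depend on the decomposition, so that it is harmless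
to let all minimal primary decompositions contribute.) -/
noncomputable def unmixedPart {R : Type*} [CommRing R] (J : Ideal R) : Ideal R :=
  sInf {Q | ∃ t : Finset (Ideal R),
    Submodule.IsMinimalPrimaryDecomposition J t ∧ Q ∈ t ∧ Q.height = J.height}

/-- `I` and `I'` are linked via the regular sequence `p, q`:
`I = (p, q) : I'` and `I' = (p, q) : I`. -/
def AreLinkedVia {R : Type*} [CommRing R] (p q : R) (I I' : Ideal R) : Prop :=
  RingTheory.Sequence.IsRegular R [p, q] ∧
    I = (Ideal.span {p, q}).colon (I' : Set R) ∧ I' = (Ideal.span {p, q}).colon (I : Set R)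

/-- The defining ideal, in `k[Y₀, …, Y₅]`, of the Veronese surface in `ℙ⁵`, the image of
`(z₀ : z₁ : z₂) ↦ (z₀² : z₀z₁ : z₀z₂ : z₁² : z₁z₂ : z₂²)`. -/
noncomputable def veroneseIdeal (k : Type*) [Field k] : Ideal (MvPolynomial (Fin 6) k) :=
  RingHom.ker (aeval (R := k) (![X 0 ^ 2, X 0 * X 1, X 0 * X 2, X 1 ^ 2, X 1 * X 2, X 2 ^ 2] :
    Fin 6 → MvPolynomial (Fin 3) k))

/-- `I'` is the defining ideal of (the closure of) the image of the Veronese surface under the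
projection `ℙ⁵ ⇢ ℙ⁴` from a point that is given by five independent linear forms `ℓ₀, …, ℓ₄`:
the kernel of `k[X₀, …, X₄] → k[Y₀, …, Y₅] ⧸ veroneseIdeal k`, `Xᵢ ↦ ℓᵢ`. -/
def IsProjectedVeroneseIdeal {k : Type*} [Field k] (I' : Ideal (MvPolynomial (Fin 5) k)) : Prop :=
  ∃ ℓ : Fin 5 → MvPolynomial (Fin 6) k,
    (∀ i, (ℓ i).IsHomogeneous 1) ∧ LinearIndependent k ℓ ∧
      I' = (veroneseIdeal k).comap (aeval (R := k) ℓ)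

/-- The polynomial ring `(ℤ/3ℤ)[X₀, …, X₄]`. -/
abbrev R : Type := MvPolynomial (Fin 5) (ZMod 3)

noncomputable def f : R :=
  X 0 ^ 3 - X 0 ^ 2 * X 2 + X 0 * X 1 * X 2 + X 0 * X 2 ^ 2 + X 1 * X 2 ^ 2 - X 0 ^ 2 * X 3 -
    X 1 * X 2 * X 3 - X 2 ^ 2 * X 3 - X 1 * X 3 ^ 2 - X 2 * X 3 ^ 2 - X 3 ^ 3 + X 0 ^ 2 * X 4 -
    X 0 * X 1 * X 4 - X 1 ^ 2 * X 4 - X 1 * X 2 * X 4 - X 0 * X 3 * X 4 + X 1 * X 3 * X 4 +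
    X 2 * X 3 * X 4 - X 3 ^ 2 * X 4 + X 2 * X 4 ^ 2 + X 3 * X 4 ^ 2 + X 4 ^ 3

noncomputable def g : R :=
  X 0 * X 1 ^ 2 - X 1 ^ 3 + X 0 ^ 2 * X 2 - X 0 * X 1 * X 2 - X 0 * X 2 ^ 2 - X 1 * X 2 ^ 2 +
    X 0 ^ 2 * X 3 - X 0 * X 1 * X 3 - X 1 * X 2 * X 3 + X 2 ^ 2 * X 3 + X 0 * X 3 ^ 2 - X 3 ^ 3 -
    X 0 * X 1 * X 4 - X 1 ^ 2 * X 4 + X 0 * X 2 * X 4 + X 1 * X 2 * X 4 + X 0 * X 3 * X 4 +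
    X 2 * X 3 * X 4 + X 3 ^ 2 * X 4

noncomputable def h : R :=
  X 0 ^ 2 * X 1 - X 1 ^ 3 - X 0 ^ 2 * X 2 + X 0 * X 1 * X 2 - X 1 ^ 2 * X 2 - X 0 ^ 2 * X 3 -
    X 1 * X 2 * X 3 + X 1 * X 3 ^ 2 + X 0 * X 1 * X 4 + X 1 ^ 2 * X 4 + X 0 * X 2 * X 4 -
    X 1 * X 2 * X 4 + X 0 * X 3 * X 4 + X 1 * X 3 * X 4 + X 1 * X 4 ^ 2

/-- The ideal `(f, g, h)`. -/
noncomputable def J : Ideal R := Ideal.span {f, g, h}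

/-- The Betti diagram
```
         0  1  2  3  4  5
  total: 1  3  8 10  5  1
      0: 1  .  .  .  .  .
      1: .  .  .  .  .  .
      2: .  3  .  .  .  .
      3: .  .  .  .  .  .
      4: .  .  8 10  5  1
```
whose entry in row `r` and column `i` is the graded Betti number `β i (i + r)`. -/
def bettiTable : ℕ → ℕ → ℕ
  | 0, 0 => 1
  | 1, 3 => 3
  | 2, 6 => 8
  | 3, 7 => 10
  | 4, 8 => 5
  | 5, 9 => 1
  | _, _ => 0

end ThreeCubics

/-! ### Forms coded by numbers, and Kronecker substitution as a test for polynomial identities -/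

namespace ThreeCubics

open MvPolynomial

/-! Let Q be `quinticIdeal y` and V be `projectedVeroneseIdeal y`, where y is a linear change of
coordinates, and let A be the polynomial ring in `y 0`, `y 1`, `y 2`. Q has five cubic generators
with a 5×5 matrix M (`quinticSyz`) of linear syzygies, and the kernel of M is spanned by the vector
y. After a constant change of basis, f, g, h are three of the five generators.

Resolution. A relation among f, g, h is a vector M w whose last two coordinates in the new basis
vanish, so that r₁·w = r₂·w = 0 for two rows of linear forms. Both rows are orthogonal to y and come
from constant trivectors under the Koszul map. If u is any trivector and ρ its Koszul image, then
r₁, r₂, ρ are all orthogonal to y, so r₁ ∧ r₂ ∧ ρ, read as a bivector, has the form w ∧ y. This w,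
unique up to multiples of y, is `liftMat` applied to u, and it is orthogonal to r₁ and r₂. The
crucial point is `exists_of_pencilRows`: these lifts and y give all solutions. The lift kills the
two trivectors of the pencil, which leaves 10 - 2 = 8 syzygies of degree 3 (linear times quadratic).
Behind them the resolution continues with the tail 10, 5, 1 of the Koszul complex. Its last map is
multiplication by y, which does not split, whence projective dimension 5.

Structure of Q. Write R = A[s][t] with s = `y 3`, t = `y 4`. Four generators of Q have the leading
terms t³, st², s²t, s³, and the fifth has degree at most two in s, t. Reducing coefficient vectors
by syzygies to a normal form, and comparing degrees, shows that M generates all syzygies and that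
R/Q is A⁶ modulo one vector (`exists_of_sum_eq_low`). Two entries of this vector are coprime, so R/Q
is finite and torsion-free over A.

Linkage. V is the kernel of a quadratic parametrization, hence prime. It contains f and g but not h,
and QV ⊆ (f, g) by explicit identities. By incomparability over A, the ideal V + Q contains a
nonzero element of A, and torsion-freeness then gives (f, g) : V = Q. The other colon follows from h
∈ Q and h ∉ V. Components of J of the wrong height have radicals that meet A nontrivially, so they
do not matter for Q. A component of height 2 cannot have V inside its radical, since h lies in it,
so it contains Q. Hence the unmixed part of J is Q. -/

/-- The codes, in base 8, of the exponents of the monomials of degree `d` in `n` variables. -/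
def monomialKeys : ℕ → ℕ → List ℕ
  | 0, d => if d = 0 then [0] else []
  | n + 1, d => Nat.rec [0] (fun d ih => monomialKeys n (d + 1) ++ ih.map (· + 8 ^ n)) d

/-- A form in five variables over `ℤ/3ℤ`, given by its degree and by a number whose ternary digits
are the coefficients. -/
structure Form where
  degree : ℕ
  code : ℕ

namespace Form

section Value

variable {S : Type*} [CommRing S]

/-- The value at `v` of the monomial with the given key. -/
def monomialValue (v : Fin 5 → S) (k : ℕ) : S :=
  v 0 ^ (k % 8) * v 1 ^ (k / 8 % 8) * v 2 ^ (k / 8 / 8 % 8) * v 3 ^ (k / 8 / 8 / 8 % 8) *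
    v 4 ^ (k / 8 / 8 / 8 / 8)

def valueAux (v : Fin 5 → S) : List ℕ → ℕ → S
  | [], _ => 0
  | k :: l, c => ((c % 3 : ℕ) : S) * monomialValue v k + valueAux v l (c / 3)

/-- The value of a form at a point of a ring. -/
def value (v : Fin 5 → S) (p : Form) : S := valueAux v (monomialKeys 5 p.degree) p.code

lemma map_value {S' : Type*} [CommRing S'] (φ : S →+* S') (v : Fin 5 → S) (p : Form) :
    φ (p.value v) = p.value (fun i => φ (v i)) := by
  obtain ⟨d, c⟩ := p
  simp only [value]
  induction monomialKeys 5 d generalizing c with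
  | nil => simp [valueAux]
  | cons k l ih => simp [valueAux, monomialValue, ih]

end Value

/-- The value at the powers `2 ^ (20 * 8 ^ i)`. -/
def packAux : List ℕ → ℕ → ℕ
  | [], _ => 0
  | k :: l, c => c % 3 * 2 ^ (20 * k) + packAux l (c / 3)

def pack (p : Form) : ℕ := packAux (monomialKeys 5 p.degree) p.code

/-- Whether the `2 ^ k` lowest digits of `N` in base `2 ^ 20` are divisible by 3. -/
def digitsDivisible : ℕ → ℕ → Bool
  | 0, N => N % 3 == 0
  | k + 1, N => N == 0 ||
      (digitsDivisible k (N % 2 ^ (20 * 2 ^ k)) && digitsDivisible k (N / 2 ^ (20 * 2 ^ k)))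

/-- Each step cuts the digit string in the middle: digit n comes from the lower half if n < 2 ^ k
and from the upper half otherwise. The bound on N makes a string of length one a single digit. -/
lemma digit_eq_zero_of_digitsDivisible (k : ℕ) : ∀ N, digitsDivisible k N = true →
    N < 2 ^ (20 * 2 ^ k) → ∀ n, N / (2 ^ 20) ^ n % 2 ^ 20 % 3 = 0 := by
  induction k with
  | zero =>
    intro N h hN n
    have h : N % 3 = 0 := by simpa [digitsDivisible] using h
    rcases n with _ | n
    · rw [pow_zero, Nat.div_one, Nat.mod_eq_of_lt (lt_of_lt_of_eq hN (by norm_num)), h]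
    · rw [Nat.div_eq_of_lt]
      · rfl
      · refine lt_of_lt_of_le hN ?_
        rw [← pow_mul]
        exact Nat.pow_le_pow_right (by norm_num) (by simp)
  | succ k ih =>
    intro N h hN n
    rcases (by simpa [digitsDivisible] using h : N = 0 ∨
      (digitsDivisible k (N % 2 ^ (20 * 2 ^ k)) = true ∧
        digitsDivisible k (N / 2 ^ (20 * 2 ^ k)) = true)) with rfl | ⟨h₁, h₂⟩
    · simp
    · rw [← pow_mul]
      have hdm := Nat.div_add_mod N (2 ^ (20 * 2 ^ k))
      by_cases hn : n < 2 ^ k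
      · have := ih _ h₁ (Nat.mod_lt _ (by positivity)) n
        rw [← pow_mul] at this
        obtain ⟨j, hj⟩ := Nat.exists_eq_add_of_lt hn
        have e : 2 ^ (20 * 2 ^ k) = 2 ^ (20 * n) * (2 ^ 20 * 2 ^ (20 * j)) := by
          rw [hj]; ring
        rw [← hdm]
        nth_rw 1 [e]
        rw [mul_assoc, Nat.mul_add_div (by positivity), mul_assoc, Nat.mul_add_mod]
        exact this
      · obtain ⟨j, rfl⟩ := Nat.exists_eq_add_of_le (not_lt.mp hn)
        have := ih _ h₂ ?_ j
        · rw [← pow_mul, Nat.div_div_eq_div_mul, ← pow_add, ← mul_add] at this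
          exact this
        · rw [Nat.div_lt_iff_lt_mul (by positivity), ← pow_add]
          refine lt_of_lt_of_eq hN ?_
          ring

-- The coefficients are natural numbers, so each is at most the value at 1. If that value is below
-- B, no carries occur on substituting B.
open Polynomial in
lemma coeff_eq_digit (B : ℕ) (n : ℕ) : ∀ U : ℕ[X], U.eval 1 < B →
    U.eval B / B ^ n % B = U.coeff n := by
  induction n with
  | zero =>
    intro U hU
    have h1 : U.divX.eval 1 + U.coeff 0 = U.eval 1 := by
      conv_rhs => rw [← U.divX_mul_X_add]
      simp
    have h2 : U.divX.eval B * B + U.coeff 0 = U.eval B := by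
      conv_rhs => rw [← U.divX_mul_X_add]
      simp
    rw [← h2, pow_zero, Nat.div_one, Nat.mul_add_mod', Nat.mod_eq_of_lt (by omega)]
  | succ n ih =>
    intro U hU
    have h1 : U.divX.eval 1 + U.coeff 0 = U.eval 1 := by
      conv_rhs => rw [← U.divX_mul_X_add]
      simp
    have h2 : U.divX.eval B * B + U.coeff 0 = U.eval B := by
      conv_rhs => rw [← U.divX_mul_X_add]
      simp
    have := ih U.divX (by omega)
    rw [Polynomial.coeff_divX] at this
    have h0 : U.coeff 0 < B := by omega
    rw [← this, ← h2, pow_succ', ← Nat.div_div_eq_div_mul, add_comm,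
      Nat.add_mul_div_right _ _ (by omega), Nat.div_eq_of_lt h0, zero_add]

open Polynomial in
noncomputable def polyAux : List ℕ → ℕ → ℕ[X]
  | [], _ => 0
  | k :: l, c => Polynomial.monomial k (c % 3) + polyAux l (c / 3)

open Polynomial in
lemma eval_polyAux (l : List ℕ) (c : ℕ) : (polyAux l c).eval (2 ^ 20) = packAux l c := by
  induction l generalizing c with
  | nil => simp [polyAux, packAux]
  | cons k l ih => rw [polyAux, packAux, Polynomial.eval_add, ih, Polynomial.eval_monomial, ← pow_mul]

open Polynomial in
lemma eval_one_polyAux (l : List ℕ) (c : ℕ) : (polyAux l c).eval 1 ≤ 2 * l.length := by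
  induction l generalizing c with
  | nil => simp [polyAux]
  | cons k l ih =>
    rw [polyAux, Polynomial.eval_add, Polynomial.eval_monomial, List.length_cons]
    have := ih (c / 3)
    have := Nat.mod_lt c (show 0 < 3 by norm_num)
    simp only [one_pow, mul_one]
    omega

section

variable {S : Type*} [CommRing S] (v : Fin 5 → S)

/-- The value at `v` of a polynomial in one variable whose exponents are keys. -/
noncomputable def unpack : Polynomial ℕ →+ S where
  toFun U := U.sum fun n c => (c : S) * monomialValue v n
  map_zero' := Polynomial.sum_zero_index _
  map_add' p q := Polynomial.sum_add_index p q _ (by simp) (by intros; push_cast; ring)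

lemma unpack_monomial (n c : ℕ) : unpack v (Polynomial.monomial n c) = c * monomialValue v n :=
  Polynomial.sum_monomial_index c (fun n c => (c : S) * monomialValue v n) (by simp)

lemma unpack_eq_zero [CharP S 3] (U : Polynomial ℕ) (h : ∀ n, U.coeff n % 3 = 0) :
    unpack v U = 0 := by
  rw [U.as_sum_support, map_sum]
  refine Finset.sum_eq_zero fun n _ => ?_
  rw [unpack_monomial, CharP.cast_eq_mod S 3, h, Nat.cast_zero, zero_mul]

/-- Whether all the exponents are at most 3, so that keys can be added without carry. -/
def SmallKey (k : ℕ) : Prop :=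
  k % 8 ≤ 3 ∧ k / 8 % 8 ≤ 3 ∧ k / 8 / 8 % 8 ≤ 3 ∧ k / 8 / 8 / 8 % 8 ≤ 3

instance (k : ℕ) : Decidable (SmallKey k) := by unfold SmallKey; infer_instance

lemma monomialValue_add {k l : ℕ} (hk : SmallKey k) (hl : SmallKey l) :
    monomialValue v (k + l) = monomialValue v k * monomialValue v l := by
  obtain ⟨h0, h1, h2, h3⟩ := hk
  obtain ⟨g0, g1, g2, g3⟩ := hl
  have hmod {a b : ℕ} (ha : a % 8 ≤ 3) (hb : b % 8 ≤ 3) : (a + b) % 8 = a % 8 + b % 8 := by omega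
  have hdiv {a b : ℕ} (ha : a % 8 ≤ 3) (hb : b % 8 ≤ 3) : (a + b) / 8 = a / 8 + b / 8 := by omega
  simp only [monomialValue, hmod h0 g0, hdiv h0 g0, hmod h1 g1, hdiv h1 g1, hmod h2 g2, hdiv h2 g2,
    hmod h3 g3, hdiv h3 g3, pow_add]
  ring

/-- `unpack` is only additive in general. Multiplying monomials adds their keys, and this adds the
exponents as long as no base-8 carry occurs, which small keys guarantee. -/
lemma unpack_mul (l l' : List ℕ) (hl : ∀ k ∈ l, SmallKey k) (hl' : ∀ k ∈ l', SmallKey k)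
    (c c' : ℕ) : unpack v (polyAux l c * polyAux l' c') = valueAux v l c * valueAux v l' c' := by
  induction l generalizing c with
  | nil => simp [polyAux, valueAux]
  | cons k l ih =>
    rw [polyAux, valueAux, add_mul, map_add, ih (fun k hk => hl k (by simp [hk])), add_mul]
    congr 1
    have hk := hl k (by simp)
    clear ih hl
    induction l' generalizing c' with
    | nil => simp [polyAux, valueAux]
    | cons k' l' ih' =>
      rw [polyAux, valueAux, mul_add, map_add, ih' (fun k hk => hl' k (by simp [hk])),
        Polynomial.monomial_mul_monomial, unpack_monomial, monomialValue_add v hk (hl' k' (by simp))]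
      push_cast
      ring

end

lemma smallKey_of_mem {d : ℕ} (hd : d ≤ 3) : ∀ k ∈ monomialKeys 5 d, SmallKey k := by
  interval_cases d <;> decide +kernel

lemma length_monomialKeys {d : ℕ} (hd : d ≤ 3) : (monomialKeys 5 d).length ≤ 35 := by
  interval_cases d <;> decide +kernel

def sumPack (L : List (Form × Form)) : ℕ := (L.map fun p => p.1.pack * p.2.pack).sum

def sumValue {S : Type*} [CommRing S] (v : Fin 5 → S) (L : List (Form × Form)) : S :=
  (L.map fun p => p.1.value v * p.2.value v).sum

/-- Whether two sums of products of forms agree; only the first `2 ^ k` keys are compared. -/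
def sumsAgree (k : ℕ) (L L' : List (Form × Form)) : Bool :=
  (L ++ L').all (fun p => decide (p.1.degree ≤ 3) && decide (p.2.degree ≤ 3)) &&
    decide (L.length + 2 * L'.length ≤ 200) &&
    decide ((sumPack L + 2 * sumPack L') / 2 ^ (20 * 2 ^ k) = 0) &&
    digitsDivisible k (sumPack L + 2 * sumPack L')

/-- One polynomial over ℕ serves all rings and points. Its value at 2 ^ 20 is the number that is
actually computed, and its value at 1 controls carries. The constant is 4900 = 70²: a form of degree
at most 3 has at most 35 coefficients, each at most 2. -/
lemma exists_poly (L : List (Form × Form))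
    (hL : ∀ p ∈ L, p.1.degree ≤ 3 ∧ p.2.degree ≤ 3) :
    ∃ U : Polynomial ℕ, U.eval (2 ^ 20) = sumPack L ∧ U.eval 1 ≤ 4900 * L.length ∧
      ∀ {S : Type*} [CommRing S] (v : Fin 5 → S), unpack v U = sumValue v L := by
  induction L with
  | nil => exact ⟨0, by simp [sumPack], by simp, by simp [sumValue]⟩
  | cons p L ih =>
    obtain ⟨U, h1, h2, h3⟩ := ih fun p hp => hL p (by simp [hp])
    obtain ⟨hd, hd'⟩ := hL p (by simp)
    refine ⟨polyAux (monomialKeys 5 p.1.degree) p.1.code *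
      polyAux (monomialKeys 5 p.2.degree) p.2.code + U, ?_, ?_, ?_⟩
    · rw [Polynomial.eval_add, Polynomial.eval_mul, eval_polyAux, eval_polyAux, h1]
      simp [sumPack, pack]
    · rw [Polynomial.eval_add, Polynomial.eval_mul, List.length_cons]
      have a := eval_one_polyAux (monomialKeys 5 p.1.degree) p.1.code
      have b := eval_one_polyAux (monomialKeys 5 p.2.degree) p.2.code
      have := length_monomialKeys hd
      have := length_monomialKeys hd'
      have := Nat.mul_le_mul (a.trans (by omega : _ ≤ 70)) (b.trans (by omega : _ ≤ 70))
      omega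
    · intro S _ v
      rw [map_add, unpack_mul v _ _ (smallKey_of_mem hd) (smallKey_of_mem hd'), h3]
      simp [sumValue, value]

/-- Subtraction is avoided by testing L + 2 L' ≡ 0 modulo 3. The length bound 200 is chosen because
4900 · 200 < 2 ^ 20. -/
theorem sumValue_eq_of_sumsAgree {S : Type*} [CommRing S] [CharP S 3] (v : Fin 5 → S) (k : ℕ)
    (L L' : List (Form × Form)) (h : sumsAgree k L L' = true) : sumValue v L = sumValue v L' := by
  simp only [sumsAgree, Bool.and_eq_true, List.all_eq_true, decide_eq_true_eq, List.mem_append] at h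
  obtain ⟨⟨⟨hd, hlen⟩, hN⟩, hdig⟩ := h
  obtain ⟨U, h1, h2, h3⟩ := exists_poly L fun p hp => hd p (.inl hp)
  obtain ⟨U', h1', h2', h3'⟩ := exists_poly L' fun p hp => hd p (.inr hp)
  have key : unpack v (U + U' + U') = 0 := by
    refine unpack_eq_zero v _ fun n => ?_
    have hU : (U + U' + U').eval (2 ^ 20) = sumPack L + 2 * sumPack L' := by
      simp only [Polynomial.eval_add, h1, h1']; ring
    rw [← coeff_eq_digit (2 ^ 20), hU]
    · exact digit_eq_zero_of_digitsDivisible k _ hdig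
        ((Nat.div_eq_zero_iff_lt (by positivity)).mp hN) n
    · simp only [Polynomial.eval_add]; omega
  rw [map_add, map_add, h3, h3'] at key
  have h3 : (3 : S) = 0 := by exact_mod_cast CharP.cast_eq_zero S 3
  linear_combination key - sumValue v L' * h3

end Form

end ThreeCubics

/-! ### The explicit matrices and the identities between them -/

namespace ThreeCubics

open MvPolynomial

namespace Form

/-- The matrix of forms of degree `d` with the given codes. -/
def matrix {m n : Type*} (d : ℕ) (A : Matrix m n ℕ) : Matrix m n Form := fun i j => ⟨d, A i j⟩

/-- The scalar matrix whose diagonal entries are the variable `i`. -/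
def variableMatrix (i m : ℕ) : Matrix (Fin m) (Fin m) Form := fun j k =>
  ⟨1, if j = k then 3 ^ i else 0⟩

def one (m : ℕ) : Matrix (Fin m) (Fin m) Form := fun j k => ⟨0, if j = k then 1 else 0⟩

/-- The summands of the entry `(i, j)` of a product of matrices. -/
def products {m n : Type*} {k : ℕ} (A : Matrix m (Fin k) Form) (B : Matrix (Fin k) n Form)
    (i : m) (j : n) : List (Form × Form) := (List.finRange k).map fun l => (A i l, B l j)

section

variable {S : Type*} [CommRing S]

/-- The value of a matrix of forms at a point of a ring. -/
def values {m n : Type*} (v : Fin 5 → S) (A : Matrix m n Form) : Matrix m n S :=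
  A.map (value v)

lemma sumValue_products {m n : Type*} {k : ℕ} (v : Fin 5 → S) (A : Matrix m (Fin k) Form)
    (B : Matrix (Fin k) n Form) (i : m) (j : n) :
    sumValue v (products A B i j) = (values v A * values v B) i j := by
  rw [Matrix.mul_apply, Fin.sum_univ_def, sumValue, products, List.map_map]
  rfl

lemma sumValue_append (v : Fin 5 → S) (L L' : List (Form × Form)) :
    sumValue v (L ++ L') = sumValue v L + sumValue v L' := by
  simp [sumValue]

lemma value_const (v : Fin 5 → S) (c : ℕ) (hc : c < 3) : value v ⟨0, c⟩ = c := by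
  simp [value, monomialKeys, valueAux, monomialValue, Nat.mod_eq_of_lt hc]

lemma values_one (v : Fin 5 → S) (m : ℕ) : values v (one m) = 1 := by
  ext i j
  by_cases h : i = j
  · subst h; simp [values, one, value_const]
  · simp [values, one, value_const, h]

lemma value_linear (v : Fin 5 → S) (c : ℕ) : value v ⟨1, c⟩ =
    (c % 3 : ℕ) * v 0 + (c / 3 % 3 : ℕ) * v 1 + (c / 3 / 3 % 3 : ℕ) * v 2 +
      (c / 3 / 3 / 3 % 3 : ℕ) * v 3 + (c / 3 / 3 / 3 / 3 % 3 : ℕ) * v 4 := by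
  have h : monomialKeys 5 1 = [1, 8, 64, 512, 4096] := by decide +kernel
  simp [value, h, valueAux, monomialValue]
  ring

lemma values_variableMatrix (v : Fin 5 → S) (i : Fin 5) (m : ℕ) :
    values v (variableMatrix i m) = v i • (1 : Matrix (Fin m) (Fin m) S) := by
  ext j k
  by_cases h : j = k
  · subst h
    simp only [values, variableMatrix, Matrix.map_apply, value_linear]
    fin_cases i <;> simp
  · simp [values, variableMatrix, value_linear, h]

variable [CharP S 3]

lemma values_mul_eq {m n : Type*} {k l : ℕ} (v : Fin 5 → S) (e : ℕ) {A : Matrix m (Fin k) Form}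
    {B : Matrix (Fin k) n Form} {C : Matrix m (Fin l) Form} {D : Matrix (Fin l) n Form}
    (h : ∀ i j, sumsAgree e (products A B i j) (products C D i j) = true) :
    values v A * values v B = values v C * values v D := by
  ext i j
  rw [← sumValue_products, ← sumValue_products, sumValue_eq_of_sumsAgree v e _ _ (h i j)]

lemma values_mul_eq_zero {m n : Type*} {k : ℕ} (v : Fin 5 → S) (e : ℕ) {A : Matrix m (Fin k) Form}
    {B : Matrix (Fin k) n Form} (h : ∀ i j, sumsAgree e (products A B i j) [] = true) :
    values v A * values v B = 0 := by
  ext i j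
  rw [← sumValue_products, sumValue_eq_of_sumsAgree v e _ _ (h i j)]
  rfl

end

end Form

open Form

/-- The coordinates, as a column. -/
def coord : Matrix (Fin 5) (Fin 1) Form := Form.matrix 1
  !![1; 3; 9; 27; 81]

/-- The five cubics that generate the ideal of the quintic. -/
def quinticGens : Matrix (Fin 1) (Fin 5) Form := Form.matrix 3
  !![16939632145245224, 6445691050796778, 111507762610760, 11825758767119, 1865409170792428]

/-- The seven cubics that generate the ideal of the projected Veronese surface. -/
def veroneseGens : Matrix (Fin 1) (Fin 7) Form := Form.matrix 3
  !![18530787931374204, 5559060834756576, 68829382533708, 116875040544, 205912311258543,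
    4331339510186736, 2741559923712]

/-- The linear syzygies of `quinticGens`. -/
def quinticSyz : Matrix (Fin 5) (Fin 5) Form := Form.matrix 1
  !![18, 18, 31, 18, 0; 30, 29, 162, 8, 9; 213, 172, 34, 20, 4; 162, 9, 168, 0, 10;
    123, 109, 56, 98, 62]

/-- The cubics `f`, `g`, `h` and two more, in terms of `quinticGens`. -/
def basisChange : Matrix (Fin 5) (Fin 5) Form := Form.matrix 0
  !![2, 0, 0, 1, 2; 1, 1, 1, 2, 0; 0, 1, 1, 0, 0; 2, 1, 0, 0, 0; 1, 2, 1, 0, 0]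

/-- The inverse of `basisChange`. -/
def basisChangeInv : Matrix (Fin 5) (Fin 5) Form := Form.matrix 0
  !![0, 0, 1, 1, 2; 0, 0, 1, 2, 2; 0, 0, 0, 1, 1; 0, 2, 2, 1, 2; 2, 2, 1, 0, 0]

/-- The Koszul map `v ↦ v ∧ y` on vectors. -/
def koszul₁ : Matrix (Fin 10) (Fin 5) Form := Form.matrix 1
  !![3, 2, 0, 0, 0; 9, 0, 2, 0, 0; 27, 0, 0, 2, 0; 81, 0, 0, 0, 2; 0, 9, 6, 0, 0;
    0, 27, 0, 6, 0; 0, 81, 0, 0, 6; 0, 0, 27, 18, 0; 0, 0, 81, 0, 18; 0, 0, 0, 81, 54]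

/-- The Koszul map on bivectors. -/
def koszul₂ : Matrix (Fin 10) (Fin 10) Form := Form.matrix 1
  !![9, 6, 0, 0, 1, 0, 0, 0, 0, 0; 27, 0, 6, 0, 0, 1, 0, 0, 0, 0;
    81, 0, 0, 6, 0, 0, 1, 0, 0, 0; 0, 27, 18, 0, 0, 0, 0, 1, 0, 0;
    0, 81, 0, 18, 0, 0, 0, 0, 1, 0; 0, 0, 81, 54, 0, 0, 0, 0, 0, 1;
    0, 0, 0, 0, 27, 18, 0, 3, 0, 0; 0, 0, 0, 0, 81, 0, 18, 0, 3, 0;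
    0, 0, 0, 0, 0, 81, 54, 0, 0, 3; 0, 0, 0, 0, 0, 0, 0, 81, 54, 9]

/-- The Koszul map on trivectors; a `4`-vector is regarded as a covector. -/
def koszul₃ : Matrix (Fin 5) (Fin 10) Form := Form.matrix 1
  !![0, 0, 0, 0, 0, 0, 81, 54, 9, 6; 0, 0, 0, 162, 27, 18, 0, 0, 0, 1;
    0, 81, 54, 0, 0, 3, 0, 0, 2, 0; 162, 0, 9, 0, 6, 0, 0, 1, 0, 0;
    27, 18, 0, 3, 0, 0, 2, 0, 0, 0]

/-- The pencil of trivectors that belongs to `f`, `g`, `h`. -/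
def pencil : Matrix (Fin 10) (Fin 2) Form := Form.matrix 0
  !![1, 0; 0, 1; 0, 0; 0, 1; 1, 2; 0, 1; 2, 2; 0, 0; 0, 0; 2, 2]

/-- A projection with the kernel `pencil`. -/
def pencilProj : Matrix (Fin 8) (Fin 10) Form := Form.matrix 0
  !![0, 0, 1, 0, 0, 0, 0, 0, 0, 0; 0, 2, 0, 1, 0, 0, 0, 0, 0, 0; 2, 1, 0, 0, 1, 0, 0, 0, 0, 0;
    0, 2, 0, 0, 0, 1, 0, 0, 0, 0; 1, 1, 0, 0, 0, 0, 1, 0, 0, 0; 0, 0, 0, 0, 0, 0, 0, 1, 0, 0;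
    0, 0, 0, 0, 0, 0, 0, 0, 1, 0; 1, 1, 0, 0, 0, 0, 0, 0, 0, 1]

/-- A section of `pencilProj`. -/
def pencilSection : Matrix (Fin 10) (Fin 8) Form := Form.matrix 0
  !![0, 0, 0, 0, 0, 0, 0, 0; 0, 0, 0, 0, 0, 0, 0, 0; 1, 0, 0, 0, 0, 0, 0, 0;
    0, 1, 0, 0, 0, 0, 0, 0; 0, 0, 1, 0, 0, 0, 0, 0; 0, 0, 0, 1, 0, 0, 0, 0;
    0, 0, 0, 0, 1, 0, 0, 0; 0, 0, 0, 0, 0, 1, 0, 0; 0, 0, 0, 0, 0, 0, 1, 0;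
    0, 0, 0, 0, 0, 0, 0, 1]

/-- The maximal minors `ρ ↦ r₁ ∧ r₂ ∧ ρ` of the two rows `r₁`, `r₂` of the pencil. -/
def pencilMinors : Matrix (Fin 10) (Fin 5) Form := Form.matrix 2
  !![0, 0, 1008309, 1655562, 5137272; 0, 1301442, 0, 1675302, 7145016;
    0, 3311124, 3350514, 0, 1714614; 0, 9743103, 14290023, 3252072, 0;
    1008309, 0, 0, 4430961, 9920250; 1655562, 0, 2484603, 0, 4782987;
    5137272, 0, 4960125, 9565947, 0; 1675302, 4430961, 0, 0, 8859699;
    7145016, 9920250, 0, 12404745, 0; 1714614, 4782987, 8859699, 0, 0]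

/-- The lift of `pencilMinors` along the Koszul map. -/
def liftMat : Matrix (Fin 5) (Fin 10) Form := Form.matrix 2
  !![1714614, 14290023, 1616949, 5137272, 3193026, 890214, 0, 1459, 59809, 118101;
    4782987, 4960125, 4255902, 0, 177147, 177156, 5137272, 3308931, 649707, 354303;
    8859699, 0, 1070010, 4960125, 3368079, 531522, 7145016, 3363663, 538353, 476949;
    0, 8859699, 3223638, 9565947, 1594323, 1244502, 1714614, 40095, 125418, 63426;
    0, 0, 2349, 0, 9, 18, 0, 2193, 165, 9]

/-- A partial inverse of `liftMat`. -/
def liftInv₄ : Matrix (Fin 10) (Fin 5) Form := Form.matrix 0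
  !![0, 2, 0, 0, 0; 0, 1, 0, 0, 1; 0, 0, 0, 0, 0; 1, 0, 1, 1, 1; 0, 0, 0, 0, 0; 0, 0, 0, 0, 0;
    0, 1, 0, 0, 2; 0, 0, 0, 0, 0; 0, 0, 0, 0, 0; 0, 0, 0, 0, 0]

/-- The multiple of `coord` in the identity for `liftInv₄`. -/
def liftCoord₄ : Matrix (Fin 1) (Fin 5) Form := Form.matrix 1
  !![0, 0, 0, 0, 81]

/-- The multiple of the rows of the pencil in the identity for `liftInv₄`. -/
def liftRows₄ : Matrix (Fin 5) (Fin 2) Form := Form.matrix 1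
  !![81, 168; 0, 0; 81, 6; 81, 87; 0, 0]

/-- A partial inverse of `liftMat`. -/
def liftInv₁ : Matrix (Fin 10) (Fin 5) Form := Form.matrix 0
  !![0, 1, 0, 0, 0; 0, 1, 0, 0, 1; 0, 0, 0, 0, 0; 1, 0, 1, 2, 1; 0, 0, 0, 0, 1; 0, 0, 0, 0, 0;
    0, 1, 0, 0, 2; 0, 0, 0, 0, 0; 0, 0, 0, 0, 0; 0, 0, 0, 0, 0]

/-- The multiple of `coord` in the identity for `liftInv₁`. -/
def liftCoord₁ : Matrix (Fin 1) (Fin 5) Form := Form.matrix 1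
  !![0, 0, 0, 0, 0]

/-- The multiple of the rows of the pencil in the identity for `liftInv₁`. -/
def liftRows₁ : Matrix (Fin 5) (Fin 2) Form := Form.matrix 1
  !![165, 168; 0, 0; 168, 162; 81, 87; 0, 0]

/-- A partial inverse of `pencilMinors`. -/
def minorInv₄ : Matrix (Fin 5) (Fin 10) Form := Form.matrix 0
  !![0, 0, 0, 0, 0, 0, 1, 0, 0, 0; 0, 0, 0, 2, 0, 0, 0, 0, 2, 2; 0, 0, 0, 0, 0, 0, 1, 0, 0, 0;
    0, 0, 0, 0, 0, 0, 1, 0, 0, 0; 1, 0, 0, 0, 2, 2, 0, 0, 0, 0]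

/-- The multiple of the rows of the pencil in the identity for `minorInv₄`. -/
def minorRows₄ : Matrix (Fin 2) (Fin 5) Form := Form.matrix 1
  !![81, 0, 81, 81, 0; 168, 0, 6, 87, 0]

/-- A partial inverse of `pencilMinors`. -/
def minorInv₁ : Matrix (Fin 5) (Fin 10) Form := Form.matrix 0
  !![0, 0, 0, 0, 0, 0, 1, 0, 0, 0; 0, 0, 0, 2, 0, 0, 0, 0, 2, 1; 0, 0, 0, 0, 0, 0, 1, 0, 0, 0;
    0, 0, 0, 0, 0, 0, 2, 0, 0, 0; 1, 0, 0, 0, 2, 1, 0, 0, 0, 0]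

/-- The multiple of the rows of the pencil in the identity for `minorInv₁`. -/
def minorRows₁ : Matrix (Fin 2) (Fin 5) Form := Form.matrix 1
  !![165, 0, 168, 81, 0; 168, 0, 162, 87, 0]

/-- The product `basisChangeInv * quinticSyz`. -/
def syzAll : Matrix (Fin 5) (Fin 5) Form := Form.matrix 1
  !![9, 153, 221, 174, 42; 171, 135, 137, 174, 52; 42, 118, 224, 98, 69; 165, 29, 0, 168, 28;
    165, 236, 84, 3, 22]

/-- The cubics `f`, `g`, `h` in the coordinates. -/
def cubics : Matrix (Fin 1) (Fin 3) Form := Form.matrix 3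
  !![41397122311421793, 10167652942102044, 8324760529427703]

/-- The coefficients of `f` and `g` in the products of `quinticGens` and `veroneseGens`. -/
def linkCoeff : Matrix (Fin 2) (Fin 35) Form := Form.matrix 3
  !![48015938268139935, 11205153650255016, 58468856521710, 71076149113989, 429934813174871,
    3149560696546827, 57205114855663, 12899449275454872, 45756908379684, 73610845798608,
    143704498338468, 8420674798263, 1412555839785, 40565306150079, 6903438435372,
    132785673901959, 192965802013911, 5208846906945, 2744280907001, 47354808156471,
    5206520765578, 70312493194950, 180472954359702, 57203152005279, 71159767475169,
    20791960526663, 24947977483053, 57201629466208, 3756232927917222, 53986839192636,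
    45739735860111, 2744746838025, 188299887865, 1412174802096, 41415530;
    9263039016258243, 11893999538623194, 5884777376449287, 9112130072003991, 1652523462328070,
    2494292795825523, 4739548601227926, 15597687192374958, 5635664921720736, 8680107165789555,
    15603814087661907, 834066823031622, 4369812954273702, 3132488825128209, 10429421419556796,
    6181830235218807, 14564765846110848, 555312114481602, 214120118663585, 3713792288619768,
    454788996416703, 7420164610757166, 11271240527261544, 4696240926280977, 9217833232891158,
    1660487069470205, 1876503851151288, 4572119989859082, 1085506018932648, 622779008679801,
    3566112326388420, 247827783316827, 624142977157, 136002322074, 2538396087189]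

/-- The coordinates in terms of the original variables. -/
def coordX : Matrix (Fin 5) (Fin 1) Form := Form.matrix 1
  !![219; 35; 42; 85; 135]

/-- The original variables in terms of the coordinates. -/
def coordXInv : Matrix (Fin 5) (Fin 1) Form := Form.matrix 1
  !![110; 31; 232; 141; 222]

/-- The matrix of `coordX`. -/
def coordMatrix : Matrix (Fin 5) (Fin 5) Form := Form.matrix 0
  !![0, 1, 0, 2, 2; 2, 2, 0, 1, 0; 0, 2, 1, 1, 0; 1, 1, 0, 0, 1; 0, 0, 0, 2, 1]

/-- The matrix of `coordXInv`. -/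
def coordMatrixInv : Matrix (Fin 5) (Fin 5) Form := Form.matrix 0
  !![2, 0, 0, 1, 1; 1, 1, 0, 1, 0; 1, 2, 1, 2, 2; 0, 2, 0, 2, 1; 0, 2, 0, 2, 2]

/-- The first three rows of `syzAll`. -/
def syzRows : Matrix (Fin 3) (Fin 5) Form := fun i => syzAll (Fin.castAdd 2 i)

/-- The last two rows of `syzAll`. -/
def pencilRows : Matrix (Fin 2) (Fin 5) Form := fun i => syzAll (Fin.natAdd 3 i)

/-- The first three columns of `basisChange`. -/
def cubicsChange : Matrix (Fin 5) (Fin 3) Form := fun i j => basisChange i (Fin.castAdd 2 j)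

section Identities

variable {S : Type*} [CommRing S] [CharP S 3] (v : Fin 5 → S)

lemma quinticGens_mul_quinticSyz : values v quinticGens * values v quinticSyz = 0 :=
  values_mul_eq_zero v 15 (by decide +kernel)

lemma quinticSyz_mul_coord : values v quinticSyz * values v coord = 0 :=
  values_mul_eq_zero v 15 (by decide +kernel)

lemma basisChange_mul_inv : values v basisChange * values v basisChangeInv = 1 := by
  rw [values_mul_eq v 15 (C := one 5) (D := one 5) (by decide +kernel), values_one, Matrix.one_mul]

lemma basisChangeInv_mul : values v basisChangeInv * values v basisChange = 1 := by
  rw [values_mul_eq v 15 (C := one 5) (D := one 5) (by decide +kernel), values_one, Matrix.one_mul]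

lemma basisChangeInv_mul_quinticSyz :
    values v basisChangeInv * values v quinticSyz = values v syzAll := by
  rw [values_mul_eq v 15 (C := one 5) (D := syzAll) (by decide +kernel), values_one, Matrix.one_mul]

lemma quinticGens_mul_cubicsChange :
    values v quinticGens * values v cubicsChange = values v cubics := by
  rw [values_mul_eq v 15 (C := one 1) (D := cubics) (by decide +kernel), values_one, Matrix.one_mul]

lemma koszul₁_mul_coord : values v koszul₁ * values v coord = 0 :=
  values_mul_eq_zero v 15 (by decide +kernel)

lemma koszul₂_mul_koszul₁ : values v koszul₂ * values v koszul₁ = 0 :=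
  values_mul_eq_zero v 15 (by decide +kernel)

lemma koszul₃_mul_koszul₂ : values v koszul₃ * values v koszul₂ = 0 :=
  values_mul_eq_zero v 15 (by decide +kernel)

lemma koszul₃_mul_pencil :
    values v koszul₃ * values v pencil = (values v pencilRows).transpose := by
  rw [values_mul_eq v 15 (C := one 5) (D := pencilRows.transpose) (by decide +kernel), values_one,
    Matrix.one_mul]
  rfl

lemma pencilProj_mul_section : values v pencilProj * values v pencilSection = 1 := by
  rw [values_mul_eq v 15 (C := one 8) (D := one 8) (by decide +kernel), values_one, Matrix.one_mul]

lemma pencilMinors_mul_koszul₃ :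
    values v pencilMinors * values v koszul₃ = values v koszul₁ * values v liftMat :=
  values_mul_eq v 15 (by decide +kernel)

/-- The square of the coordinate appears as a product of two scalar matrices, because `sumsAgree`
compares sums of products of forms. -/
lemma lift_identity {i : Fin 5} {A : Matrix (Fin 10) (Fin 5) Form} {B : Matrix (Fin 1) (Fin 5) Form}
    {C : Matrix (Fin 5) (Fin 2) Form}
    (h : ∀ j k, sumsAgree 15 (products (variableMatrix i 5) (variableMatrix i 5) j k)
      (products liftMat A j k ++ products coord B j k ++ products C pencilRows j k) = true) :
    v i ^ 2 • (1 : Matrix (Fin 5) (Fin 5) S) =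
      values v liftMat * values v A + values v coord * values v B +
        values v C * values v pencilRows := by
  have : values v (variableMatrix i 5) * values v (variableMatrix i 5) =
      values v liftMat * values v A + values v coord * values v B +
        values v C * values v pencilRows := by
    ext j k
    rw [← sumValue_products, sumValue_eq_of_sumsAgree v 15 _ _ (h j k), sumValue_append,
      sumValue_append, sumValue_products, sumValue_products, sumValue_products]
    rfl
  rw [values_variableMatrix, Matrix.smul_mul, Matrix.one_mul, smul_smul, ← sq] at this
  exact this

/-- Applied to a vector that is orthogonal to the rows of the pencil, this says that the lifts and y
generate such vectors up to the denominator `v 4 ^ 2`. With the analogue for `v 1` the denominators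
can be removed. -/
lemma lift_identity₄ : v 4 ^ 2 • (1 : Matrix (Fin 5) (Fin 5) S) =
    values v liftMat * values v liftInv₄ + values v coord * values v liftCoord₄ +
      values v liftRows₄ * values v pencilRows :=
  lift_identity v (i := 4) (by decide +kernel)

lemma lift_identity₁ : v 1 ^ 2 • (1 : Matrix (Fin 5) (Fin 5) S) =
    values v liftMat * values v liftInv₁ + values v coord * values v liftCoord₁ +
      values v liftRows₁ * values v pencilRows :=
  lift_identity v (i := 1) (by decide +kernel)

lemma minor_identity {i : Fin 5} {A : Matrix (Fin 5) (Fin 10) Form} {C : Matrix (Fin 2) (Fin 5) Form}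
    (h : ∀ j k, sumsAgree 15 (products (variableMatrix i 5) (variableMatrix i 5) j k)
      (products A pencilMinors j k ++ products pencilRows.transpose C j k) = true) :
    v i ^ 2 • (1 : Matrix (Fin 5) (Fin 5) S) =
      values v A * values v pencilMinors + (values v pencilRows).transpose * values v C := by
  have : values v (variableMatrix i 5) * values v (variableMatrix i 5) =
      values v A * values v pencilMinors + (values v pencilRows).transpose * values v C := by
    ext j k
    rw [← sumValue_products, sumValue_eq_of_sumsAgree v 15 _ _ (h j k), sumValue_append,
      sumValue_products, sumValue_products]
    rfl
  rw [values_variableMatrix, Matrix.smul_mul, Matrix.one_mul, smul_smul, ← sq] at this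
  exact this

lemma minor_identity₄ : v 4 ^ 2 • (1 : Matrix (Fin 5) (Fin 5) S) =
    values v minorInv₄ * values v pencilMinors +
      (values v pencilRows).transpose * values v minorRows₄ :=
  minor_identity v (i := 4) (by decide +kernel)

lemma minor_identity₁ : v 1 ^ 2 • (1 : Matrix (Fin 5) (Fin 5) S) =
    values v minorInv₁ * values v pencilMinors +
      (values v pencilRows).transpose * values v minorRows₁ :=
  minor_identity v (i := 1) (by decide +kernel)

/-- The certificate of the linkage: each product of a generator of one ideal with one of the other
lies in (f, g). -/
lemma quinticGens_mul_veroneseGens (i : Fin 5) (j : Fin 7) :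
    (quinticGens 0 i).value v * (veroneseGens 0 j).value v =
      (cubics 0 0).value v * (linkCoeff 0 (finProdFinEquiv (i, j))).value v +
        (cubics 0 1).value v * (linkCoeff 1 (finProdFinEquiv (i, j))).value v := by
  have h : ∀ (i : Fin 5) (j : Fin 7), sumsAgree 15 [(quinticGens 0 i, veroneseGens 0 j)]
      [(cubics 0 0, linkCoeff 0 (finProdFinEquiv (i, j))),
        (cubics 0 1, linkCoeff 1 (finProdFinEquiv (i, j)))] = true := by decide +kernel
  simpa [sumValue] using sumValue_eq_of_sumsAgree v 15 _ _ (h i j)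

end Identities

end ThreeCubics

/-! ### The linear change of coordinates -/

namespace ThreeCubics

open MvPolynomial Form

instance : CharP R 3 := inferInstance

lemma value_zero {S : Type*} [CommRing S] (v : Fin 5 → S) (c : ℕ) :
    value v ⟨0, c⟩ = (c % 3 : ℕ) := by
  simp [value, monomialKeys, valueAux, monomialValue]

lemma values_matrix_zero {S : Type*} [CommRing S] (v w : Fin 5 → S) {m n : Type*}
    (A : Matrix m n ℕ) : values v (Form.matrix 0 A) = values w (Form.matrix 0 A) := by
  ext i j
  simp [values, Form.matrix, value_zero]

lemma values_coord {S : Type*} [CommRing S] (v : Fin 5 → S) (i : Fin 5) (j : Fin 1) :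
    values v coord i j = v i := by
  simp only [values, coord, Form.matrix, Matrix.map_apply, value_linear]
  fin_cases i <;> fin_cases j <;> simp

lemma coordMatrix_mul_coord {S : Type*} [CommRing S] [CharP S 3] (v : Fin 5 → S) :
    values v coordMatrix * values v coord = values v coordX := by
  rw [values_mul_eq v 15 (C := one 5) (D := coordX) (by decide +kernel), values_one, Matrix.one_mul]

lemma coordMatrixInv_mul_coord {S : Type*} [CommRing S] [CharP S 3] (v : Fin 5 → S) :
    values v coordMatrixInv * values v coord = values v coordXInv := by
  rw [values_mul_eq v 15 (C := one 5) (D := coordXInv) (by decide +kernel), values_one,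
    Matrix.one_mul]

lemma coordMatrix_mul_coordXInv {S : Type*} [CommRing S] [CharP S 3] (v : Fin 5 → S) :
    values v coordMatrix * values v coordXInv = values v coord := by
  rw [values_mul_eq v 15 (C := one 5) (D := coord) (by decide +kernel), values_one, Matrix.one_mul]

lemma coordMatrixInv_mul_coordX {S : Type*} [CommRing S] [CharP S 3] (v : Fin 5 → S) :
    values v coordMatrixInv * values v coordX = values v coord := by
  rw [values_mul_eq v 15 (C := one 5) (D := coord) (by decide +kernel), values_one, Matrix.one_mul]

/-- The linear forms that serve as coordinates. -/
noncomputable def y (i : Fin 5) : R := values X coordX i 0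

lemma column_eq {S : Type*} [CommRing S] (v w : Fin 5 → S) (A : Matrix (Fin 5) (Fin 1) Form)
    (h : ∀ i, v i = values w A i 0) : values v coord = values w A := by
  ext i j
  rw [values_coord, h, Subsingleton.elim j 0]

lemma values_y_coordXInv (i : Fin 5) : values y coordXInv i 0 = X i := by
  rw [← coordMatrixInv_mul_coord, column_eq y X coordX fun _ => rfl,
    show values y coordMatrixInv = values X coordMatrixInv from values_matrix_zero _ _ _,
    coordMatrixInv_mul_coordX, values_coord]

lemma values_coordXInv_coordX (i : Fin 5) :
    values (fun i => values (X : Fin 5 → R) coordXInv i 0) coordX i 0 = X i := by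
  rw [← coordMatrix_mul_coord, column_eq _ X coordXInv fun _ => rfl,
    show values _ coordMatrix = values (X : Fin 5 → R) coordMatrix from values_matrix_zero _ _ _,
    coordMatrix_mul_coordXInv, values_coord]

lemma aeval_value {σ : Type*} {S : Type*} [CommRing S] [Algebra (ZMod 3) S]
    (w : σ → S) (v : Fin 5 → MvPolynomial σ (ZMod 3)) (p : Form) :
    aeval w (p.value v) = p.value fun i => aeval w (v i) :=
  map_value (aeval w : MvPolynomial σ (ZMod 3) →ₐ[ZMod 3] S).toRingHom v p

/-- The linear change of variables that sends `X i` to `y i`. -/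
noncomputable def coordEquiv : R ≃ₐ[ZMod 3] R :=
  AlgEquiv.ofAlgHom (aeval y) (aeval fun i => values X coordXInv i 0)
    (by
      ext i : 1
      rw [AlgHom.comp_apply, aeval_X]
      refine (aeval_value _ _ _).trans ?_
      simp only [aeval_X]
      exact values_y_coordXInv i)
    (by
      ext i : 1
      rw [AlgHom.comp_apply, aeval_X]
      refine (aeval_value _ _ _).trans ?_
      simp only [aeval_X]
      exact values_coordXInv_coordX i)

lemma coordEquiv_X (i : Fin 5) : coordEquiv (X i) = y i := aeval_X _ _

lemma value_isHomogeneous {σ : Type*} (v : Fin 5 → MvPolynomial σ (ZMod 3))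
    (hv : ∀ i, (v i).IsHomogeneous 1) (p : Form) (hp : p.degree ≤ 3) :
    (p.value v).IsHomogeneous p.degree := by
  obtain ⟨d, c⟩ := p
  have hd : ∀ k ∈ monomialKeys 5 d,
      k % 8 + k / 8 % 8 + k / 8 / 8 % 8 + k / 8 / 8 / 8 % 8 + k / 8 / 8 / 8 / 8 = d := by
    change d ≤ 3 at hp
    interval_cases d <;> decide +kernel
  change (valueAux v _ c).IsHomogeneous d
  clear hp
  generalize monomialKeys 5 d = l at hd ⊢
  induction l generalizing c with
  | nil => exact isHomogeneous_zero _ _ _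
  | cons k l ih =>
    refine IsHomogeneous.add ?_ (ih _ fun k hk => hd k (by simp [hk]))
    rw [← hd k (by simp), ← map_natCast (C : ZMod 3 →+* MvPolynomial σ (ZMod 3)), ← zero_add (_ + _)]
    refine (isHomogeneous_C _ _).mul ?_
    simpa [monomialValue] using (((((hv 0).pow _).mul ((hv 1).pow _)).mul ((hv 2).pow _)).mul
      ((hv 3).pow _)).mul ((hv 4).pow (k / 8 / 8 / 8 / 8))

lemma y_isHomogeneous (i : Fin 5) : (y i).IsHomogeneous 1 :=
  value_isHomogeneous X (isHomogeneous_X _) (coordX i 0) (by simp [coordX, Form.matrix])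

lemma monomialKeys_three : monomialKeys 5 3 = [3, 10, 17, 24, 66, 73, 80, 129, 136, 192, 514, 521,
    528, 577, 584, 640, 1025, 1032, 1088, 1536, 4098, 4105, 4112, 4161, 4168, 4224, 4609, 4616,
    4672, 5120, 8193, 8200, 8256, 8704, 12288] := by decide +kernel

lemma value_cubic {S : Type*} [CommRing S] (v : Fin 5 → S) (c : ℕ) :
    value v ⟨3, c⟩ = valueAux v [3, 10, 17, 24, 66, 73, 80, 129, 136, 192, 514, 521,
    528, 577, 584, 640, 1025, 1032, 1088, 1536, 4098, 4105, 4112, 4161, 4168, 4224, 4609, 4616,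
    4672, 5120, 8193, 8200, 8256, 8704, 12288] c := by
  rw [value, monomialKeys_three]

lemma y_eq : y 0 = X 1 + 2 * X 3 + 2 * X 4 ∧ y 1 = 2 * X 0 + 2 * X 1 + X 3 ∧
    y 2 = 2 * X 1 + X 2 + X 3 ∧ y 3 = X 0 + X 1 + X 4 ∧ y 4 = 2 * X 3 + X 4 := by
  simp [y, values, coordX, Form.matrix, value_linear]

lemma f_eq : f = (cubics 0 0).value y := by
  obtain ⟨h0, h1, h2, h3, h4⟩ := y_eq
  simp [f, cubics, Form.matrix, value_cubic, valueAux, monomialValue, h0, h1, h2, h3, h4]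
  grind

lemma g_eq : g = (cubics 0 1).value y := by
  obtain ⟨h0, h1, h2, h3, h4⟩ := y_eq
  simp [g, cubics, Form.matrix, value_cubic, valueAux, monomialValue, h0, h1, h2, h3, h4]
  grind

lemma h_eq : h = (cubics 0 2).value y := by
  obtain ⟨h0, h1, h2, h3, h4⟩ := y_eq
  simp [h, cubics, Form.matrix, value_cubic, valueAux, monomialValue, h0, h1, h2, h3, h4]
  grind

end ThreeCubics

/-! ### Ideals of coordinates, and exactness of the Koszul complex -/

namespace ThreeCubics

open MvPolynomial Form

/-- The ideal generated by some of the coordinates. -/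
noncomputable def coordIdeal (s : Set (Fin 5)) : Ideal R := Ideal.span (y '' s)

/-- The point of the affine space with the given coordinates. -/
noncomputable def evalAt (p : Fin 5 → ZMod 3) : R →ₐ[ZMod 3] ZMod 3 :=
  (aeval p).comp coordEquiv.symm.toAlgHom

lemma coordEquiv_symm_y (i : Fin 5) : coordEquiv.symm (y i) = X i := by
  rw [← coordEquiv_X, AlgEquiv.symm_apply_apply]

lemma evalAt_y (p : Fin 5 → ZMod 3) (i : Fin 5) : evalAt p (y i) = p i := by
  change aeval p (coordEquiv.symm (y i)) = p i
  rw [coordEquiv_symm_y, aeval_X]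

lemma evalAt_value (p : Fin 5 → ZMod 3) (F : Form) : evalAt p (F.value y) = F.value p := by
  refine (map_value (evalAt p).toRingHom y F).trans ?_
  congr 1
  ext i
  exact evalAt_y p i

lemma coordIdeal_le_ker (s : Set (Fin 5)) (p : Fin 5 → ZMod 3) (hp : ∀ i ∈ s, p i = 0) (x : R)
    (hx : x ∈ coordIdeal s) : evalAt p x = 0 := by
  have : coordIdeal s ≤ RingHom.ker (evalAt p) := by
    rw [coordIdeal, Ideal.span_le]
    rintro _ ⟨i, hi, rfl⟩
    exact (evalAt_y p i).trans (hp i hi)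
  exact this hx

-- Setting the variables of `s` to zero changes a polynomial only by an element of the ideal they
-- generate. As a kernel into a domain, this ideal is prime.
open Classical in
lemma span_X_eq_ker (s : Set (Fin 5)) : Ideal.span ((X : Fin 5 → R) '' s) =
    RingHom.ker (aeval (fun i => if i ∈ s then 0 else X i) : R →ₐ[ZMod 3] R) := by
  apply le_antisymm
  · rw [Ideal.span_le]
    rintro _ ⟨i, hi, rfl⟩
    simp [hi, RingHom.mem_ker]
  · intro x hx
    have key : ∀ x : R, x - aeval (fun i => if i ∈ s then 0 else X i) x ∈
        Ideal.span ((X : Fin 5 → R) '' s) := by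
      intro x
      induction x using MvPolynomial.induction_on with
      | C a => simp
      | add p q hp hq =>
        rw [map_add, add_sub_add_comm]
        exact add_mem hp hq
      | mul_X p i hp =>
        rw [map_mul, aeval_X]
        by_cases hi : i ∈ s
        · rw [if_pos hi, mul_zero, sub_zero]
          exact Ideal.mul_mem_left _ _ (Ideal.subset_span ⟨i, hi, rfl⟩)
        · rw [if_neg hi, ← sub_mul]
          exact Ideal.mul_mem_right _ _ hp
    have := key x
    rwa [RingHom.mem_ker.mp hx, sub_zero] at this

lemma coordIdeal_eq_comap (s : Set (Fin 5)) :
    coordIdeal s = (Ideal.span ((X : Fin 5 → R) '' s)).comap coordEquiv.symm := by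
  apply le_antisymm
  · rw [coordIdeal, Ideal.span_le]
    rintro _ ⟨i, hi, rfl⟩
    change coordEquiv.symm (y i) ∈ Ideal.span ((X : Fin 5 → R) '' s)
    rw [coordEquiv_symm_y]
    exact Ideal.subset_span ⟨i, hi, rfl⟩
  · intro x hx
    have : Ideal.map coordEquiv (Ideal.span ((X : Fin 5 → R) '' s)) = coordIdeal s := by
      rw [Ideal.map_span, coordIdeal, ← Set.image_comp]
      simp [coordEquiv_X]
    rw [← this, ← coordEquiv.apply_symm_apply x]
    exact Ideal.mem_map_of_mem coordEquiv hx

instance coordIdeal_isPrime (s : Set (Fin 5)) : (coordIdeal s).IsPrime := by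
  have : (Ideal.span ((X : Fin 5 → R) '' s)).IsPrime := by
    rw [span_X_eq_ker]; exact RingHom.ker_isPrime _
  rw [coordIdeal_eq_comap]
  exact Ideal.IsPrime.comap _

lemma y_notMem_coordIdeal {s : Set (Fin 5)} {i : Fin 5} (hi : i ∉ s) : y i ∉ coordIdeal s := by
  intro h
  have := coordIdeal_le_ker s (Pi.single i 1) (fun j hj => Pi.single_eq_of_ne (by rintro rfl; exact hi hj) 1) _ h
  rw [evalAt_y] at this
  simp at this

/-- Every element of the sequence is a non-zero-divisor modulo the preceding ones. -/
structure RegularCoords {S : Type*} [CommRing S] (v : Fin 5 → S) : Prop where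
  zero : ∀ a b, v 0 * a = v 0 * b → a = b
  one : ∀ a b, v 1 * a = v 0 * b → ∃ c, a = v 0 * c
  two : ∀ a b₀ b₁, v 2 * a = v 0 * b₀ + v 1 * b₁ → ∃ c₀ c₁, a = v 0 * c₀ + v 1 * c₁
  three : ∀ a b₀ b₁ b₂, v 3 * a = v 0 * b₀ + v 1 * b₁ + v 2 * b₂ →
    ∃ c₀ c₁ c₂, a = v 0 * c₀ + v 1 * c₁ + v 2 * c₂
  four : ∀ a b₀ b₁ b₂ b₃, v 4 * a = v 0 * b₀ + v 1 * b₁ + v 2 * b₂ + v 3 * b₃ →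
    ∃ c₀ c₁ c₂ c₃, a = v 0 * c₀ + v 1 * c₁ + v 2 * c₂ + v 3 * c₃

lemma mem_coordIdeal {s : Set (Fin 5)} {i : Fin 5} (hi : i ∉ s) {a : R}
    (h : y i * a ∈ coordIdeal s) : a ∈ coordIdeal s :=
  ((coordIdeal_isPrime s).mem_or_mem h).resolve_left (y_notMem_coordIdeal hi)

lemma mem_coordIdeal_insert {s : Set (Fin 5)} {i : Fin 5} {a : R} :
    a ∈ coordIdeal (insert i s) ↔ ∃ c, ∃ z ∈ coordIdeal s, a = c * y i + z := by
  rw [coordIdeal, Set.image_insert_eq, Ideal.mem_span_insert]; rfl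

lemma mem_coordIdeal_singleton {i : Fin 5} {a : R} : a ∈ coordIdeal {i} ↔ ∃ c, a = y i * c := by
  rw [coordIdeal, Set.image_singleton, Ideal.mem_span_singleton]; rfl

lemma y_ne_zero (i : Fin 5) : y i ≠ 0 := fun h => by
  have := evalAt_y 1 i
  simp [h] at this

/-- Each coordinate lies outside the prime ideal generated by the preceding ones. -/
lemma y_regularCoords : RegularCoords y where
  zero a b h := mul_left_cancel₀ (y_ne_zero 0) h
  one a b h := by
    refine mem_coordIdeal_singleton.mp (mem_coordIdeal (i := 1) (by simp) ?_)
    exact mem_coordIdeal_singleton.mpr ⟨b, h⟩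
  two a b₀ b₁ h := by
    have : a ∈ coordIdeal {1, 0} := mem_coordIdeal (i := 2) (by simp) <| by
      simp only [mem_coordIdeal_insert, mem_coordIdeal_singleton]
      exact ⟨b₁, _, ⟨b₀, rfl⟩, by rw [h]; ring⟩
    simp only [mem_coordIdeal_insert, mem_coordIdeal_singleton] at this
    obtain ⟨c₁, _, ⟨c₀, rfl⟩, rfl⟩ := this
    exact ⟨c₀, c₁, by ring⟩
  three a b₀ b₁ b₂ h := by
    have : a ∈ coordIdeal {2, 1, 0} := mem_coordIdeal (i := 3) (by simp) <| by
      simp only [mem_coordIdeal_insert, mem_coordIdeal_singleton]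
      exact ⟨b₂, _, ⟨b₁, _, ⟨b₀, rfl⟩, rfl⟩, by rw [h]; ring⟩
    simp only [mem_coordIdeal_insert, mem_coordIdeal_singleton] at this
    obtain ⟨c₂, _, ⟨c₁, _, ⟨c₀, rfl⟩, rfl⟩, rfl⟩ := this
    exact ⟨c₀, c₁, c₂, by ring⟩
  four a b₀ b₁ b₂ b₃ h := by
    have : a ∈ coordIdeal {3, 2, 1, 0} := mem_coordIdeal (i := 4) (by simp) <| by
      simp only [mem_coordIdeal_insert, mem_coordIdeal_singleton]
      exact ⟨b₃, _, ⟨b₂, _, ⟨b₁, _, ⟨b₀, rfl⟩, rfl⟩, rfl⟩, by rw [h]; ring⟩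
    simp only [mem_coordIdeal_insert, mem_coordIdeal_singleton] at this
    obtain ⟨c₃, _, ⟨c₂, _, ⟨c₁, _, ⟨c₀, rfl⟩, rfl⟩, rfl⟩, rfl⟩ := this
    exact ⟨c₀, c₁, c₂, c₃, by ring⟩

namespace RegularCoords

variable {S : Type*} [CommRing S] {v : Fin 5 → S} (hv : RegularCoords v)
include hv

/-- Exactness of the Koszul complex on vectors. -/
lemma exists_eq_mul {a : Fin 5 → S} {s : Fin 5 → Prop} (hs : s 1)
    (h : ∀ i, s i → v i * a 0 = v 0 * a i) : ∃ c, a 0 = v 0 * c ∧ ∀ i, s i → a i = v i * c := by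
  obtain ⟨c, hc⟩ := hv.one _ _ (h 1 hs)
  refine ⟨c, hc, fun i hi => hv.zero _ _ ?_⟩
  rw [← h i hi, hc]; ring

/-- Exactness of the Koszul complex on bivectors in three variables. -/
lemma exists_bivector₃ {w₀₁ w₀₂ w₁₂ : S} (h : v 2 * w₀₁ - v 1 * w₀₂ + v 0 * w₁₂ = 0) :
    ∃ a₀ a₁ a₂, w₀₁ = v 1 * a₀ - v 0 * a₁ ∧ w₀₂ = v 2 * a₀ - v 0 * a₂ ∧
      w₁₂ = v 2 * a₁ - v 1 * a₂ := by
  obtain ⟨c₀, c₁, rfl⟩ := hv.two w₀₁ (-w₁₂) w₀₂ (by linear_combination h)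
  obtain ⟨e, he⟩ := hv.one (v 2 * c₁ - w₀₂) (-(v 2 * c₀ + w₁₂)) (by linear_combination h)
  refine ⟨c₁, -c₀, e, by ring, by linear_combination -he, hv.zero _ _ ?_⟩
  linear_combination h - v 1 * he

/-- The additional variable contributes a single new component `a₃`, found from one equation modulo
`v 0`. The other equations hold after multiplication by `v 0`, which can be cancelled. -/
lemma exists_bivector₄ {w₀₁ w₀₂ w₀₃ w₁₂ w₁₃ w₂₃ : S} (h : v 2 * w₀₁ - v 1 * w₀₂ + v 0 * w₁₂ = 0)
    (h' : v 3 * w₀₁ - v 1 * w₀₃ + v 0 * w₁₃ = 0) (h'' : v 3 * w₀₂ - v 2 * w₀₃ + v 0 * w₂₃ = 0) :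
    ∃ a₀ a₁ a₂ a₃, w₀₁ = v 1 * a₀ - v 0 * a₁ ∧ w₀₂ = v 2 * a₀ - v 0 * a₂ ∧
      w₁₂ = v 2 * a₁ - v 1 * a₂ ∧ w₀₃ = v 3 * a₀ - v 0 * a₃ ∧ w₁₃ = v 3 * a₁ - v 1 * a₃ ∧
      w₂₃ = v 3 * a₂ - v 2 * a₃ := by
  obtain ⟨a₀, a₁, a₂, rfl, rfl, rfl⟩ := hv.exists_bivector₃ h
  obtain ⟨c, hc⟩ := hv.one (v 3 * a₀ - w₀₃) (v 3 * a₁ - w₁₃) (by linear_combination h')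
  refine ⟨a₀, a₁, a₂, c, rfl, rfl, rfl, by linear_combination -hc, hv.zero _ _ ?_, hv.zero _ _ ?_⟩
  · linear_combination h' - v 1 * hc
  · linear_combination h'' - v 2 * hc

lemma exists_bivector₅ {w₀₁ w₀₂ w₀₃ w₀₄ w₁₂ w₁₃ w₁₄ w₂₃ w₂₄ w₃₄ : S}
    (h : v 2 * w₀₁ - v 1 * w₀₂ + v 0 * w₁₂ = 0)
    (h' : v 3 * w₀₁ - v 1 * w₀₃ + v 0 * w₁₃ = 0) (h'' : v 3 * w₀₂ - v 2 * w₀₃ + v 0 * w₂₃ = 0)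
    (g : v 4 * w₀₁ - v 1 * w₀₄ + v 0 * w₁₄ = 0) (g' : v 4 * w₀₂ - v 2 * w₀₄ + v 0 * w₂₄ = 0)
    (g'' : v 4 * w₀₃ - v 3 * w₀₄ + v 0 * w₃₄ = 0) :
    ∃ a₀ a₁ a₂ a₃ a₄, w₀₁ = v 1 * a₀ - v 0 * a₁ ∧ w₀₂ = v 2 * a₀ - v 0 * a₂ ∧
      w₁₂ = v 2 * a₁ - v 1 * a₂ ∧ w₀₃ = v 3 * a₀ - v 0 * a₃ ∧ w₁₃ = v 3 * a₁ - v 1 * a₃ ∧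
      w₂₃ = v 3 * a₂ - v 2 * a₃ ∧ w₀₄ = v 4 * a₀ - v 0 * a₄ ∧ w₁₄ = v 4 * a₁ - v 1 * a₄ ∧
      w₂₄ = v 4 * a₂ - v 2 * a₄ ∧ w₃₄ = v 4 * a₃ - v 3 * a₄ := by
  obtain ⟨a₀, a₁, a₂, a₃, rfl, rfl, rfl, rfl, rfl, rfl⟩ := hv.exists_bivector₄ h h' h''
  obtain ⟨c, hc⟩ := hv.one (v 4 * a₀ - w₀₄) (v 4 * a₁ - w₁₄) (by linear_combination g)
  refine ⟨a₀, a₁, a₂, a₃, c, rfl, rfl, rfl, rfl, rfl, rfl, by linear_combination -hc,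
    hv.zero _ _ ?_, hv.zero _ _ ?_, hv.zero _ _ ?_⟩
  · linear_combination g - v 1 * hc
  · linear_combination g' - v 2 * hc
  · linear_combination g'' - v 3 * hc

/-- Exactness of the Koszul complex on trivectors in four variables. -/
lemma exists_trivector₄ {u₀₁₂ u₀₁₃ u₀₂₃ u₁₂₃ : S}
    (h : v 3 * u₀₁₂ - v 2 * u₀₁₃ + v 1 * u₀₂₃ - v 0 * u₁₂₃ = 0) :
    ∃ w₀₁ w₀₂ w₀₃ w₁₂ w₁₃ w₂₃, u₀₁₂ = v 2 * w₀₁ - v 1 * w₀₂ + v 0 * w₁₂ ∧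
      u₀₁₃ = v 3 * w₀₁ - v 1 * w₀₃ + v 0 * w₁₃ ∧ u₀₂₃ = v 3 * w₀₂ - v 2 * w₀₃ + v 0 * w₂₃ ∧
      u₁₂₃ = v 3 * w₁₂ - v 2 * w₁₃ + v 1 * w₂₃ := by
  -- The relation puts u₀₁₂ into the ideal of the first three coordinates. Once the corresponding
  -- boundary is subtracted, what remains is a bivector relation in three variables.
  obtain ⟨c, b, a, rfl⟩ := hv.three u₀₁₂ u₁₂₃ (-u₀₂₃) u₀₁₃ (by linear_combination h)
  obtain ⟨a₀, a₁, a₂, h₁, h₂, h₃⟩ := hv.exists_bivector₃ (w₀₁ := v 3 * a - u₀₁₃)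
    (w₀₂ := -v 3 * b - u₀₂₃) (w₁₂ := v 3 * c - u₁₂₃) (by linear_combination h)
  exact ⟨a, -b, a₀, c, a₁, a₂, by ring, by linear_combination -h₁, by linear_combination -h₂,
    by linear_combination -h₃⟩

/-- Exactness of the Koszul complex on trivectors. -/
lemma exists_trivector₅ {u₀₁₂ u₀₁₃ u₀₁₄ u₀₂₃ u₀₂₄ u₀₃₄ u₁₂₃ u₁₂₄ u₁₃₄ u₂₃₄ : S}
    (h₄ : v 3 * u₀₁₂ - v 2 * u₀₁₃ + v 1 * u₀₂₃ - v 0 * u₁₂₃ = 0)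
    (h₃ : v 4 * u₀₁₂ - v 2 * u₀₁₄ + v 1 * u₀₂₄ - v 0 * u₁₂₄ = 0)
    (h₂ : v 4 * u₀₁₃ - v 3 * u₀₁₄ + v 1 * u₀₃₄ - v 0 * u₁₃₄ = 0)
    (h₁ : v 4 * u₀₂₃ - v 3 * u₀₂₄ + v 2 * u₀₃₄ - v 0 * u₂₃₄ = 0) :
    ∃ w₀₁ w₀₂ w₀₃ w₀₄ w₁₂ w₁₃ w₁₄ w₂₃ w₂₄ w₃₄,
      u₀₁₂ = v 2 * w₀₁ - v 1 * w₀₂ + v 0 * w₁₂ ∧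
      u₀₁₃ = v 3 * w₀₁ - v 1 * w₀₃ + v 0 * w₁₃ ∧ u₀₂₃ = v 3 * w₀₂ - v 2 * w₀₃ + v 0 * w₂₃ ∧
      u₁₂₃ = v 3 * w₁₂ - v 2 * w₁₃ + v 1 * w₂₃ ∧ u₀₁₄ = v 4 * w₀₁ - v 1 * w₀₄ + v 0 * w₁₄ ∧
      u₀₂₄ = v 4 * w₀₂ - v 2 * w₀₄ + v 0 * w₂₄ ∧ u₀₃₄ = v 4 * w₀₃ - v 3 * w₀₄ + v 0 * w₃₄ ∧
      u₁₂₄ = v 4 * w₁₂ - v 2 * w₁₄ + v 1 * w₂₄ ∧ u₁₃₄ = v 4 * w₁₃ - v 3 * w₁₄ + v 1 * w₃₄ ∧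
      u₂₃₄ = v 4 * w₂₃ - v 3 * w₂₄ + v 2 * w₃₄ := by
  obtain ⟨w₀₁, w₀₂, w₀₃, w₁₂, w₁₃, w₂₃, rfl, rfl, rfl, rfl⟩ := hv.exists_trivector₄ h₄
  obtain ⟨a₀, a₁, a₂, a₃, e₁, e₂, e₃, e₄, e₅, e₆⟩ := hv.exists_bivector₄
    (w₀₁ := v 4 * w₀₁ - u₀₁₄) (w₀₂ := v 4 * w₀₂ - u₀₂₄) (w₀₃ := v 4 * w₀₃ - u₀₃₄)
    (w₁₂ := v 4 * w₁₂ - u₁₂₄) (w₁₃ := v 4 * w₁₃ - u₁₃₄) (w₂₃ := v 4 * w₂₃ - u₂₃₄)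
    (by linear_combination h₃) (by linear_combination h₂) (by linear_combination h₁)
  exact ⟨w₀₁, w₀₂, w₀₃, a₀, w₁₂, w₁₃, a₁, w₂₃, a₂, a₃, rfl, rfl, rfl, rfl,
    by linear_combination -e₁, by linear_combination -e₂, by linear_combination -e₄,
    by linear_combination -e₃, by linear_combination -e₅, by linear_combination -e₆⟩

/-- Exactness of the Koszul complex on covectors. -/
lemma exists_covector {r₀ r₁ r₂ r₃ r₄ : S}
    (h : v 0 * r₀ + v 1 * r₁ + v 2 * r₂ + v 3 * r₃ + v 4 * r₄ = 0) :
    ∃ u₀₁₂ u₀₁₃ u₀₁₄ u₀₂₃ u₀₂₄ u₀₃₄ u₁₂₃ u₁₂₄ u₁₃₄ u₂₃₄,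
      r₄ = v 3 * u₀₁₂ - v 2 * u₀₁₃ + v 1 * u₀₂₃ - v 0 * u₁₂₃ ∧
      r₃ = -(v 4 * u₀₁₂ - v 2 * u₀₁₄ + v 1 * u₀₂₄ - v 0 * u₁₂₄) ∧
      r₂ = v 4 * u₀₁₃ - v 3 * u₀₁₄ + v 1 * u₀₃₄ - v 0 * u₁₃₄ ∧
      r₁ = -(v 4 * u₀₂₃ - v 3 * u₀₂₄ + v 2 * u₀₃₄ - v 0 * u₂₃₄) ∧
      r₀ = v 4 * u₁₂₃ - v 3 * u₁₂₄ + v 2 * u₁₃₄ - v 1 * u₂₃₄ := by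
  obtain ⟨d, c, b, a, rfl⟩ := hv.four r₄ (-r₀) (-r₁) (-r₂) (-r₃) (by linear_combination h)
  obtain ⟨x₀₁, x₀₂, x₀₃, x₁₂, x₁₃, x₂₃, h₁, h₂, h₃, h₄⟩ := hv.exists_trivector₄
    (u₀₁₂ := r₃ + v 4 * a) (u₀₁₃ := -(r₂ + v 4 * b)) (u₀₂₃ := r₁ + v 4 * c)
    (u₁₂₃ := -(r₀ + v 4 * d)) (by linear_combination h)
  exact ⟨a, -b, x₀₁, c, x₀₂, x₀₃, -d, x₁₂, x₁₃, x₂₃, by ring, by linear_combination h₁,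
    by linear_combination -h₂, by linear_combination h₃, by linear_combination -h₄⟩

end RegularCoords

end ThreeCubics

/-! ### The Koszul matrices and the generators of both ideals, written out -/

namespace ThreeCubics

open MvPolynomial Form
open scoped Matrix

section

variable {S : Type*} [CommRing S] [CharP S 3] {v : Fin 5 → S}

lemma two_eq_neg_one (S : Type*) [CommRing S] [CharP S 3] : (2 : S) = -1 := by
  have := CharP.cast_eq_zero S 3
  push_cast at this
  linear_combination this

lemma koszul₁_mulVec (a : Fin 5 → S) : values v koszul₁ *ᵥ a =
    ![v 1 * a 0 - v 0 * a 1, v 2 * a 0 - v 0 * a 2, v 3 * a 0 - v 0 * a 3, v 4 * a 0 - v 0 * a 4,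
      v 2 * a 1 - v 1 * a 2, v 3 * a 1 - v 1 * a 3, v 4 * a 1 - v 1 * a 4, v 3 * a 2 - v 2 * a 3,
      v 4 * a 2 - v 2 * a 4, v 4 * a 3 - v 3 * a 4] := by
  ext i
  simp only [Matrix.mulVec, dotProduct, Fin.sum_univ_five, values, koszul₁, Form.matrix,
    Matrix.map_apply, value_linear]
  fin_cases i <;> simp [two_eq_neg_one, sub_eq_add_neg]

lemma koszul₂_mulVec (w : Fin 10 → S) : values v koszul₂ *ᵥ w =
    ![v 2 * w 0 - v 1 * w 1 + v 0 * w 4, v 3 * w 0 - v 1 * w 2 + v 0 * w 5,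
      v 4 * w 0 - v 1 * w 3 + v 0 * w 6, v 3 * w 1 - v 2 * w 2 + v 0 * w 7,
      v 4 * w 1 - v 2 * w 3 + v 0 * w 8, v 4 * w 2 - v 3 * w 3 + v 0 * w 9,
      v 3 * w 4 - v 2 * w 5 + v 1 * w 7, v 4 * w 4 - v 2 * w 6 + v 1 * w 8,
      v 4 * w 5 - v 3 * w 6 + v 1 * w 9, v 4 * w 7 - v 3 * w 8 + v 2 * w 9] := by
  ext i
  simp only [Matrix.mulVec, dotProduct, Fin.sum_univ_succ, Fin.sum_univ_zero, values, koszul₂, Form.matrix,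
    Matrix.map_apply, value_linear]
  fin_cases i <;> simp [two_eq_neg_one, sub_eq_add_neg] <;> ring

lemma koszul₃_mulVec (u : Fin 10 → S) : values v koszul₃ *ᵥ u =
    ![v 4 * u 6 - v 3 * u 7 + v 2 * u 8 - v 1 * u 9,
      -(v 4 * u 3 - v 3 * u 4 + v 2 * u 5 - v 0 * u 9),
      v 4 * u 1 - v 3 * u 2 + v 1 * u 5 - v 0 * u 8,
      -(v 4 * u 0 - v 2 * u 2 + v 1 * u 4 - v 0 * u 7),
      v 3 * u 0 - v 2 * u 1 + v 1 * u 3 - v 0 * u 6] := by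
  ext i
  simp only [Matrix.mulVec, dotProduct, Fin.sum_univ_succ, Fin.sum_univ_zero, values, koszul₃, Form.matrix,
    Matrix.map_apply, value_linear]
  fin_cases i <;> simp [two_eq_neg_one, sub_eq_add_neg] <;> ring

lemma RegularCoords.exists_of_koszul₁ (hv : RegularCoords v) {a : Fin 5 → S}
    (h : values v koszul₁ *ᵥ a = 0) : ∃ c, ∀ i, a i = v i * c := by
  rw [koszul₁_mulVec] at h
  have h₁ := congrFun h 0
  have h₂ := congrFun h 1
  have h₃ := congrFun h 2
  have h₄ := congrFun h 3
  simp at h₁ h₂ h₃ h₄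
  obtain ⟨c, -, hc⟩ := hv.exists_eq_mul (a := a) (s := fun _ => True) trivial (by
    intro i _
    fin_cases i
    · rfl
    · exact sub_eq_zero.mp h₁
    · exact sub_eq_zero.mp h₂
    · exact sub_eq_zero.mp h₃
    · exact sub_eq_zero.mp h₄)
  exact ⟨c, fun i => hc i trivial⟩

lemma RegularCoords.exists_of_koszul₂ (hv : RegularCoords v) {w : Fin 10 → S}
    (h : values v koszul₂ *ᵥ w = 0) : ∃ a, w = values v koszul₁ *ᵥ a := by
  rw [koszul₂_mulVec] at h
  obtain ⟨a₀, a₁, a₂, a₃, a₄, h₀, h₁, h₄, h₂, h₅, h₇, h₃, h₆, h₈, h₉⟩ :=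
    hv.exists_bivector₅ (congrFun h 0) (congrFun h 1) (congrFun h 3) (congrFun h 2) (congrFun h 4)
      (congrFun h 5)
  refine ⟨![a₀, a₁, a₂, a₃, a₄], ?_⟩
  rw [koszul₁_mulVec]
  ext i
  fin_cases i <;> assumption

lemma RegularCoords.exists_of_koszul₃ (hv : RegularCoords v) {u : Fin 10 → S}
    (h : values v koszul₃ *ᵥ u = 0) : ∃ w, u = values v koszul₂ *ᵥ w := by
  rw [koszul₃_mulVec] at h
  obtain ⟨w₀₁, w₀₂, w₀₃, w₀₄, w₁₂, w₁₃, w₁₄, w₂₃, w₂₄, w₃₄, h₀, h₁, h₃, h₆, h₂, h₄, h₅, h₇, h₈,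
    h₉⟩ := hv.exists_trivector₅ (congrFun h 4) (neg_eq_zero.mp (congrFun h 3)) (congrFun h 2)
      (neg_eq_zero.mp (congrFun h 1))
  refine ⟨![w₀₁, w₀₂, w₀₃, w₀₄, w₁₂, w₁₃, w₁₄, w₂₃, w₂₄, w₃₄], ?_⟩
  rw [koszul₂_mulVec]
  ext i
  fin_cases i <;> assumption

lemma RegularCoords.exists_eq_koszul₃ (hv : RegularCoords v) {r : Fin 5 → S}
    (h : ∑ i, v i * r i = 0) : ∃ u, r = values v koszul₃ *ᵥ u := by
  rw [Fin.sum_univ_five] at h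
  obtain ⟨u₀, u₁, u₂, u₃, u₄, u₅, u₆, u₇, u₈, u₉, h₄, h₃, h₂, h₁, h₀⟩ := hv.exists_covector h
  refine ⟨![u₀, u₁, u₂, u₃, u₄, u₅, u₆, u₇, u₈, u₉], ?_⟩
  rw [koszul₃_mulVec]
  ext i
  fin_cases i <;> assumption

lemma quinticGens_value_0 (v : Fin 5 → S) : (quinticGens 0 0).value v =
    v 4 ^ 3 +
      (v 0) * v 4 ^ 2 +
      (v 0 + v 1 - v 2) * v 3 * v 4 +
      (v 0 + v 1) * v 3 ^ 2 +
      (v 0 * v 1 - v 1 ^ 2 - v 1 * v 2) * v 4 +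
      (-v 0 * v 1 + v 0 * v 2 - v 1 * v 2) * v 3 +
      (-v 0 ^ 3 + v 0 ^ 2 * v 1 + v 0 ^ 2 * v 2 + v 0 * v 1 ^ 2 + v 1 ^ 2 * v 2 - v 1 * v 2 ^ 2) := by
  simp [quinticGens, Form.matrix, value_cubic, valueAux, monomialValue, two_eq_neg_one S]
  ring

lemma quinticGens_value_1 (v : Fin 5 → S) : (quinticGens 0 1).value v =
    v 3 * v 4 ^ 2 +
      (v 0 + v 1) * v 4 ^ 2 +
      (-v 1 - v 2) * v 3 * v 4 +
      (-v 0 + v 2) * v 3 ^ 2 +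
      (-v 0 * v 1 - v 1 ^ 2 + v 1 * v 2 - v 2 ^ 2) * v 4 +
      (-v 0 ^ 2 - v 0 * v 2 - v 1 * v 2) * v 3 +
      (v 0 ^ 2 * v 1 + v 0 ^ 2 * v 2 + v 0 * v 1 ^ 2 - v 0 * v 1 * v 2 - v 1 ^ 2 * v 2 - v 1 * v 2 ^ 2) := by
  simp [quinticGens, Form.matrix, value_cubic, valueAux, monomialValue, two_eq_neg_one S]
  ring

lemma quinticGens_value_2 (v : Fin 5 → S) : (quinticGens 0 2).value v =
    v 3 ^ 2 * v 4 +
      (v 0 - v 1 + v 2) * v 3 * v 4 +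
      (v 2) * v 3 ^ 2 +
      (v 0 * v 1 - v 0 * v 2 + v 1 ^ 2 + v 1 * v 2 - v 2 ^ 2) * v 4 +
      (-v 0 ^ 2 - v 0 * v 1 - v 1 * v 2) * v 3 +
      (-v 0 ^ 3 + v 0 ^ 2 * v 1 - v 0 ^ 2 * v 2 - v 0 * v 1 ^ 2 - v 0 * v 1 * v 2 + v 1 ^ 2 * v 2 + v 1 * v 2 ^ 2) := by
  simp [quinticGens, Form.matrix, value_cubic, valueAux, monomialValue, two_eq_neg_one S]
  ring

lemma quinticGens_value_3 (v : Fin 5 → S) : (quinticGens 0 3).value v =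
    v 3 ^ 3 +
      (v 0 + v 1) * v 3 * v 4 +
      (v 1 - v 2) * v 3 ^ 2 +
      (v 0 ^ 2 - v 0 * v 1 - v 0 * v 2 + v 1 ^ 2 - v 1 * v 2 + v 2 ^ 2) * v 4 +
      (v 0 ^ 2 + v 0 * v 1 + v 0 * v 2 + v 1 * v 2) * v 3 +
      (-v 0 ^ 3 + v 0 ^ 2 * v 1 - v 0 ^ 2 * v 2 - v 0 * v 1 ^ 2 - v 0 * v 1 * v 2 + v 1 * v 2 ^ 2) := by
  simp [quinticGens, Form.matrix, value_cubic, valueAux, monomialValue, two_eq_neg_one S]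
  ring

lemma quinticGens_value_4 (v : Fin 5 → S) : (quinticGens 0 4).value v =
    (v 2) * v 4 ^ 2 +
      (v 0 + v 1) * v 3 * v 4 +
      (v 0 + v 2) * v 3 ^ 2 +
      (v 0 ^ 2 - v 0 * v 1 - v 0 * v 2 + v 1 ^ 2 + v 1 * v 2 - v 2 ^ 2) * v 4 +
      (-v 0 ^ 2 + v 0 * v 2 + v 1 * v 2) * v 3 +
      (v 0 ^ 3 - v 0 * v 1 ^ 2 - v 0 * v 1 * v 2 + v 1 ^ 2 * v 2) := by
  simp [quinticGens, Form.matrix, value_cubic, valueAux, monomialValue, two_eq_neg_one S]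
  ring

lemma veroneseGens_value_0 (v : Fin 5 → S) : (veroneseGens 0 0).value v =
    v 4 ^ 3 +
      (v 2) * v 4 ^ 2 +
      (-v 1) * v 3 ^ 2 +
      (-v 0 * v 1 - v 1 * v 2) * v 4 +
      (v 1 * v 2) * v 3 +
      (v 0 * v 1 ^ 2 - v 1 * v 2 ^ 2) := by
  simp [veroneseGens, Form.matrix, value_cubic, valueAux, monomialValue, two_eq_neg_one S]
  ring

lemma veroneseGens_value_1 (v : Fin 5 → S) : (veroneseGens 0 1).value v =
    v 3 * v 4 ^ 2 +
      (-v 1) * v 3 ^ 2 +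
      (-v 0 * v 1 - v 1 * v 2) * v 3 +
      (v 0 * v 1 ^ 2 - v 0 * v 1 * v 2) := by
  simp [veroneseGens, Form.matrix, value_cubic, valueAux, monomialValue, two_eq_neg_one S]
  ring

lemma veroneseGens_value_2 (v : Fin 5 → S) : (veroneseGens 0 2).value v =
    v 3 ^ 2 * v 4 +
      (-v 1) * v 3 ^ 2 +
      (v 0 * v 1 - v 0 * v 2) * v 4 +
      (v 0 * v 1) * v 3 +
      (v 0 * v 1 ^ 2 - v 0 * v 1 * v 2) := by
  simp [veroneseGens, Form.matrix, value_cubic, valueAux, monomialValue, two_eq_neg_one S]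
  ring

lemma veroneseGens_value_3 (v : Fin 5 → S) : (veroneseGens 0 3).value v =
    v 3 ^ 3 +
      (-v 1 + v 2) * v 3 ^ 2 +
      (-v 0 * v 1 + v 0 * v 2) * v 4 +
      (-v 0 * v 2) * v 3 +
      (v 0 * v 1 ^ 2 - v 0 * v 2 ^ 2) := by
  simp [veroneseGens, Form.matrix, value_cubic, valueAux, monomialValue, two_eq_neg_one S]
  ring

lemma veroneseGens_value_4 (v : Fin 5 → S) : (veroneseGens 0 4).value v =
    (v 0) * v 4 ^ 2 +
      (-v 1) * v 3 ^ 2 +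
      (-v 0 * v 1) * v 4 +
      (v 0 * v 1) * v 3 +
      (-v 0 ^ 2 * v 1 + v 0 * v 1 ^ 2) := by
  simp [veroneseGens, Form.matrix, value_cubic, valueAux, monomialValue, two_eq_neg_one S]
  ring

lemma veroneseGens_value_5 (v : Fin 5 → S) : (veroneseGens 0 5).value v =
    (v 1 - v 2) * v 4 ^ 2 +
      (v 1) * v 3 * v 4 +
      (v 1) * v 3 ^ 2 +
      (-v 1 * v 2) * v 3 +
      (-v 1 ^ 2 * v 2 + v 1 * v 2 ^ 2) := by
  simp [veroneseGens, Form.matrix, value_cubic, valueAux, monomialValue, two_eq_neg_one S]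
  ring

lemma veroneseGens_value_6 (v : Fin 5 → S) : (veroneseGens 0 6).value v =
    (v 0) * v 3 * v 4 +
      (v 0 + v 1 - v 2) * v 3 ^ 2 +
      (v 0 * v 1 - v 0 * v 2) * v 4 +
      (-v 0 * v 1) * v 3 +
      (v 0 ^ 2 * v 1 - v 0 ^ 2 * v 2 - v 0 * v 1 ^ 2 + v 0 * v 2 ^ 2) := by
  simp [veroneseGens, Form.matrix, value_cubic, valueAux, monomialValue, two_eq_neg_one S]
  ring

end

end ThreeCubics

/-! ### Reduction to degree at most two in the last two coordinates s, t -/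

namespace ThreeCubics

open Polynomial Form
open scoped Matrix

section NormalForm

variable {A : Type*} [CommRing A]

/-- The coordinates of `A[s][t]`, where `A` contains the first three coordinates. -/
noncomputable def fibreCoords (p : Fin 3 → A) : Fin 5 → A[X][X] :=
  ![C (C (p 0)), C (C (p 1)), C (C (p 2)), C X, X]

/-- The polynomials in `s` and `t` of degree at most two. -/
noncomputable def low : (Fin 6 → A) →ₗ[A] A[X][X] :=
  Fintype.linearCombination A ![1, C X, X, C X ^ 2, C X * X, X ^ 2]

lemma low_apply (c : Fin 6 → A) : low c = C (C (c 5)) * X ^ 2 + C (C (c 4) * X + C (c 2)) * X +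
    C (C (c 3) * X ^ 2 + C (c 1) * X + C (c 0)) := by
  simp [low, Fintype.linearCombination_apply, Fin.sum_univ_succ, Algebra.smul_def,
    IsScalarTower.algebraMap_apply A A[X] A[X][X]]
  ring

lemma low_eq (c : Fin 6 → A) : low c = C (C (c 0)) + C (C (c 1)) * C X + C (C (c 2)) * X +
    C (C (c 3)) * C X ^ 2 + C (C (c 4)) * (C X * X) + C (C (c 5)) * X ^ 2 := by
  rw [low_apply]; simp; ring

/-- If all cubic monomials in `s`, `t` can be reduced modulo `I`, then every polynomial can. -/
lemma exists_low (I : Ideal A[X][X]) (c : Fin 4 → Fin 6 → A) (h₀ : X ^ 3 + low (c 0) ∈ I)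
    (h₁ : C X * X ^ 2 + low (c 1) ∈ I) (h₂ : C X ^ 2 * X + low (c 2) ∈ I)
    (h₃ : C X ^ 3 + low (c 3) ∈ I) (x : A[X][X]) : ∃ e, x - low e ∈ I := by
  -- N is stable under s and t, since s or t times a monomial of degree at most two is again such a
  -- monomial or one of the four reducible cubics. As N contains 1, it is everything.
  set N : Submodule A A[X][X] := LinearMap.range low ⊔ I.restrictScalars A with hN
  have hI : ∀ z ∈ I, z ∈ N := fun z hz => Submodule.mem_sup_right hz
  have hlow : ∀ c, low c ∈ N := fun c => Submodule.mem_sup_left ⟨c, rfl⟩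
  have g : ∀ z c, z + low c ∈ I → z ∈ N := fun z c h => by
    have := sub_mem (hI _ h) (hlow c); simpa using this
  have e : ∀ i : Fin 6, (![1, C X, X, C X ^ 2, C X * X, X ^ 2] : Fin 6 → A[X][X]) i ∈ N := by
    intro i
    have := hlow (Pi.single i 1)
    rwa [low, Fintype.linearCombination_apply_single, one_smul] at this
  have hs : ∀ z ∈ N, C X * z ∈ N := by
    have : N ≤ N.comap (LinearMap.mulLeft A (C X)) := by
      refine sup_le ?_ fun z hz => hI _ (I.mul_mem_left _ hz)
      rw [low, Fintype.range_linearCombination, Submodule.span_le]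
      rintro _ ⟨i, rfl⟩
      change C X * _ ∈ N
      fin_cases i
      · simpa using e 1
      · simpa [sq] using e 3
      · simpa [sq] using e 4
      · simpa [← pow_succ'] using g _ _ h₃
      · have := g _ _ h₂; simpa [sq, mul_assoc] using this
      · exact g _ _ h₁
    exact fun z hz => this hz
  have ht : ∀ z ∈ N, X * z ∈ N := by
    have : N ≤ N.comap (LinearMap.mulLeft A X) := by
      refine sup_le ?_ fun z hz => hI _ (I.mul_mem_left _ hz)
      rw [low, Fintype.range_linearCombination, Submodule.span_le]
      rintro _ ⟨i, rfl⟩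
      change X * _ ∈ N
      fin_cases i
      · simpa using e 2
      · change X * C X ∈ N
        rw [mul_comm]; exact e 4
      · simpa [sq] using e 5
      · change X * C X ^ 2 ∈ N
        rw [mul_comm]; exact g _ _ h₂
      · change X * (C X * X) ∈ N
        rw [show X * (C X * X) = C X * (X : A[X][X]) ^ 2 by ring]; exact g _ _ h₁
      · simpa [← pow_succ'] using g _ _ h₀
    exact fun z hz => this hz
  have key : ∀ x : A[X][X], x ∈ N := by
    intro x
    induction x using Polynomial.induction_on' with
    | add p q hp hq => exact add_mem hp hq
    | monomial n a =>
      rw [← C_mul_X_pow_eq_monomial]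
      induction n with
      | zero =>
        rw [pow_zero, mul_one]
        induction a using Polynomial.induction_on' with
        | add p q hp hq => rw [C_add]; exact add_mem hp hq
        | monomial n a =>
          rw [← C_mul_X_pow_eq_monomial]
          induction n with
          | zero =>
            have := N.smul_mem a (e 0)
            simpa [Algebra.smul_def, IsScalarTower.algebraMap_apply A A[X] A[X][X]] using this
          | succ n ih =>
            have := hs _ ih
            rwa [← C_mul, mul_left_comm, ← pow_succ'] at this
      | succ n ih =>
        have := ht _ ih
        rwa [mul_left_comm, ← pow_succ'] at this
  obtain ⟨_, ⟨e, rfl⟩, z, hz, rfl⟩ := Submodule.mem_sup.mp (key x)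
  exact ⟨e, by simpa using hz⟩

/-- The parts of `quinticGens` of degree at most two in `s` and `t`. -/
def quinticLow (p : Fin 3 → A) : Fin 5 → Fin 6 → A :=
  ![![-p 0 ^ 3 + p 0 ^ 2 * p 1 + p 0 ^ 2 * p 2 + p 0 * p 1 ^ 2 + p 1 ^ 2 * p 2 - p 1 * p 2 ^ 2,
      -p 0 * p 1 + p 0 * p 2 - p 1 * p 2,
      p 0 * p 1 - p 1 ^ 2 - p 1 * p 2,
      p 0 + p 1,
      p 0 + p 1 - p 2,
      p 0],
    ![p 0 ^ 2 * p 1 + p 0 ^ 2 * p 2 + p 0 * p 1 ^ 2 - p 0 * p 1 * p 2 - p 1 ^ 2 * p 2 - p 1 * p 2 ^ 2,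
      -p 0 ^ 2 - p 0 * p 2 - p 1 * p 2,
      -p 0 * p 1 - p 1 ^ 2 + p 1 * p 2 - p 2 ^ 2,
      -p 0 + p 2,
      -p 1 - p 2,
      p 0 + p 1],
    ![-p 0 ^ 3 + p 0 ^ 2 * p 1 - p 0 ^ 2 * p 2 - p 0 * p 1 ^ 2 - p 0 * p 1 * p 2 + p 1 ^ 2 * p 2 + p 1 * p 2 ^ 2,
      -p 0 ^ 2 - p 0 * p 1 - p 1 * p 2,
      p 0 * p 1 - p 0 * p 2 + p 1 ^ 2 + p 1 * p 2 - p 2 ^ 2,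
      p 2,
      p 0 - p 1 + p 2,
      0],
    ![-p 0 ^ 3 + p 0 ^ 2 * p 1 - p 0 ^ 2 * p 2 - p 0 * p 1 ^ 2 - p 0 * p 1 * p 2 + p 1 * p 2 ^ 2,
      p 0 ^ 2 + p 0 * p 1 + p 0 * p 2 + p 1 * p 2,
      p 0 ^ 2 - p 0 * p 1 - p 0 * p 2 + p 1 ^ 2 - p 1 * p 2 + p 2 ^ 2,
      p 1 - p 2,
      p 0 + p 1,
      0],
    ![p 0 ^ 3 - p 0 * p 1 ^ 2 - p 0 * p 1 * p 2 + p 1 ^ 2 * p 2,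
      -p 0 ^ 2 + p 0 * p 2 + p 1 * p 2,
      p 0 ^ 2 - p 0 * p 1 - p 0 * p 2 + p 1 ^ 2 + p 1 * p 2 - p 2 ^ 2,
      p 0 + p 2,
      p 0 + p 1,
      p 2]]

/-- The parts of the first four `veroneseGens` of degree at most two in `s` and `t`. -/
def veroneseLow (p : Fin 3 → A) : Fin 4 → Fin 6 → A :=
  ![![p 0 * p 1 ^ 2 - p 1 * p 2 ^ 2,
      p 1 * p 2,
      -p 0 * p 1 - p 1 * p 2,
      -p 1,
      0,
      p 2],
    ![p 0 * p 1 ^ 2 - p 0 * p 1 * p 2,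
      -p 0 * p 1 - p 1 * p 2,
      0,
      -p 1,
      0,
      0],
    ![p 0 * p 1 ^ 2 - p 0 * p 1 * p 2,
      p 0 * p 1,
      p 0 * p 1 - p 0 * p 2,
      -p 1,
      0,
      0],
    ![p 0 * p 1 ^ 2 - p 0 * p 2 ^ 2,
      -p 0 * p 2,
      -p 0 * p 1 + p 0 * p 2,
      -p 1 + p 2,
      0,
      0]]

variable [CharP A 3] (p : Fin 3 → A)

lemma quinticGens_fibreCoords_0 :
    (quinticGens 0 0).value (fibreCoords p) = X ^ 3 + low (quinticLow p 0) := by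
  rw [quinticGens_value_0, low_eq]
  simp [quinticLow, fibreCoords]
  ring

lemma quinticGens_fibreCoords_1 :
    (quinticGens 0 1).value (fibreCoords p) = C X * X ^ 2 + low (quinticLow p 1) := by
  rw [quinticGens_value_1, low_eq]
  simp [quinticLow, fibreCoords]
  ring

lemma quinticGens_fibreCoords_2 :
    (quinticGens 0 2).value (fibreCoords p) = C X ^ 2 * X + low (quinticLow p 2) := by
  rw [quinticGens_value_2, low_eq]
  simp [quinticLow, fibreCoords]
  ring

lemma quinticGens_fibreCoords_3 :
    (quinticGens 0 3).value (fibreCoords p) = C X ^ 3 + low (quinticLow p 3) := by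
  rw [quinticGens_value_3, low_eq]
  simp [quinticLow, fibreCoords]
  ring

lemma quinticGens_fibreCoords_4 :
    (quinticGens 0 4).value (fibreCoords p) = low (quinticLow p 4) := by
  rw [quinticGens_value_4, low_eq]
  simp [quinticLow, fibreCoords]
  ring

lemma veroneseGens_fibreCoords_0 :
    (veroneseGens 0 0).value (fibreCoords p) = X ^ 3 + low (veroneseLow p 0) := by
  rw [veroneseGens_value_0, low_eq]
  simp [veroneseLow, fibreCoords]
  ring

lemma veroneseGens_fibreCoords_1 :
    (veroneseGens 0 1).value (fibreCoords p) = C X * X ^ 2 + low (veroneseLow p 1) := by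
  rw [veroneseGens_value_1, low_eq]
  simp [veroneseLow, fibreCoords]
  ring

lemma veroneseGens_fibreCoords_2 :
    (veroneseGens 0 2).value (fibreCoords p) = C X ^ 2 * X + low (veroneseLow p 2) := by
  rw [veroneseGens_value_2, low_eq]
  simp [veroneseLow, fibreCoords]
  ring

lemma veroneseGens_fibreCoords_3 :
    (veroneseGens 0 3).value (fibreCoords p) = C X ^ 3 + low (veroneseLow p 3) := by
  rw [veroneseGens_value_3, low_eq]
  simp [veroneseLow, fibreCoords]
  ring

end NormalForm

end ThreeCubics

/-! ### Normal forms of coefficient vectors modulo the syzygies -/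

namespace ThreeCubics

open Polynomial Form
open scoped Matrix

set_option linter.unusedSimpArgs false

section Uniqueness

variable {A : Type*} [CommRing A] [IsDomain A]

lemma eq_zero_of_mul_monic_eq {P x y : A[X]} (hP : P.Monic) (h : x * P = y)
    (hd : y.degree < P.degree) : x = 0 := by
  by_contra hx
  have hy : y ≠ 0 := by rintro rfl; exact hx ((mul_eq_zero.mp h).resolve_right hP.ne_zero)
  exact hP.not_dvd_of_degree_lt hy hd ⟨x, by rw [← h, mul_comm]⟩

/-- Everything but the first product has degree at most two in t, so a = 0. The coefficient of t²
involves only b, because the third and fourth generators contain no t², and it forces b = 0. The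
coefficients of t and 1 bound the degrees of c and d in s against each other. -/
lemma eq_zero_of_low {q : Fin 5 → Fin 6 → A} (h₂ : q 2 5 = 0) (h₃ : q 3 5 = 0)
    {a : A[X][X]} {b c d : A[X]} {e : A} {l : Fin 6 → A}
    (h : a * (X ^ 3 + low (q 0)) + C b * (C X * X ^ 2 + low (q 1)) +
      C c * (C X ^ 2 * X + low (q 2)) + C d * (C X ^ 3 + low (q 3)) + C (C e) * low (q 4) = low l) :
    a = 0 ∧ b = 0 ∧ c = 0 ∧ d = 0 := by
  set α : A[X] := C (l 5 - e * q 4 5) - b * (X + C (q 1 5)) with hα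
  set β : A[X] := C (l 4) * X + C (l 2) - b * (C (q 1 4) * X + C (q 1 2)) -
    c * (X ^ 2 + C (q 2 4) * X + C (q 2 2)) - d * (C (q 3 4) * X + C (q 3 2)) -
    C e * (C (q 4 4) * X + C (q 4 2)) with hβ
  set γ : A[X] := C (l 3) * X ^ 2 + C (l 1) * X + C (l 0) -
    b * (C (q 1 3) * X ^ 2 + C (q 1 1) * X + C (q 1 0)) -
    c * (C (q 2 3) * X ^ 2 + C (q 2 1) * X + C (q 2 0)) -
    d * (X ^ 3 + C (q 3 3) * X ^ 2 + C (q 3 1) * X + C (q 3 0)) -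
    C e * (C (q 4 3) * X ^ 2 + C (q 4 1) * X + C (q 4 0)) with hγ
  have h0 : a * (X ^ 3 + low (q 0)) = C α * X ^ 2 + C β * X + C γ := by
    rw [hα, hβ, hγ]
    simp only [low_apply, h₂, h₃] at h ⊢
    simp only [C_add, C_sub, C_mul, C_pow, C_0] at h ⊢
    linear_combination h
  have hm : (X ^ 3 + low (q 0)).degree = 3 := by
    rw [degree_add_eq_left_of_degree_lt, degree_X_pow]; · rfl
    rw [low_apply, degree_X_pow]
    exact degree_quadratic_lt
  have ha : a = 0 := by
    refine eq_zero_of_mul_monic_eq (monic_X_pow_add ?_) h0 ?_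
    · rw [low_apply]; exact degree_quadratic_lt
    · rw [hm]; exact degree_quadratic_lt
  rw [ha, zero_mul] at h0
  have h2 : α = 0 := by simpa [coeff_X, coeff_C] using (congrArg (coeff · 2) h0).symm
  have h1 : β = 0 := by simpa [coeff_X, coeff_C] using (congrArg (coeff · 1) h0).symm
  have h3 : γ = 0 := by simpa [coeff_X, coeff_C] using (congrArg (coeff · 0) h0).symm
  have hb : b = 0 := by
    refine eq_zero_of_mul_monic_eq (monic_X_add_C (q 1 5)) (sub_eq_zero.mp h2).symm ?_
    rw [degree_X_add_C]
    exact degree_C_le.trans_lt (by norm_num)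
  have hc : c * (X ^ 2 + C (q 2 4) * X + C (q 2 2)) =
      C (l 4 - e * q 4 4) * X + C (l 2 - e * q 4 2) - d * (C (q 3 4) * X + C (q 3 2)) := by
    rw [hβ, hb] at h1
    simp only [C_sub, C_mul]
    linear_combination -h1
  have hd : d * (X ^ 3 + C (q 3 3) * X ^ 2 + C (q 3 1) * X + C (q 3 0)) =
      C (l 3 - e * q 4 3) * X ^ 2 + C (l 1 - e * q 4 1) * X + C (l 0 - e * q 4 0) -
      c * (C (q 2 3) * X ^ 2 + C (q 2 1) * X + C (q 2 0)) := by
    rw [hγ, hb] at h3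
    simp only [C_sub, C_mul]
    linear_combination -h3
  -- The bounds deg c + 1 ≤ deg d and deg d + 1 ≤ deg c are incompatible. Since `natDegree` is 0 at
  -- the zero polynomial, the cases where one of the two vanishes are excluded separately.
  have nc : c ≠ 0 → c.natDegree + 2 ≤ d.natDegree + 1 := by
    intro h
    have m : (X ^ 2 + C (q 2 4) * X + C (q 2 2)).Monic := by monicity!
    have n : (X ^ 2 + C (q 2 4) * X + C (q 2 2)).natDegree = 2 := by compute_degree!
    rw [← n, ← natDegree_mul h m.ne_zero, hc]
    compute_degree
  have nd : d ≠ 0 → d.natDegree + 3 ≤ c.natDegree + 2 := by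
    intro h
    have m : (X ^ 3 + C (q 3 3) * X ^ 2 + C (q 3 1) * X + C (q 3 0)).Monic := by monicity!
    have n : (X ^ 3 + C (q 3 3) * X ^ 2 + C (q 3 1) * X + C (q 3 0)).natDegree = 3 := by
      compute_degree!
    rw [← n, ← natDegree_mul h m.ne_zero, hd]
    compute_degree
  have hc0 : c = 0 := by
    by_contra h
    have h' := nc h
    have := nd (by rintro rfl; simp at h')
    omega
  refine ⟨ha, hb, hc0, ?_⟩
  by_contra h
  have := nd h
  rw [hc0] at this
  simp at this

omit [IsDomain A] in
lemma quadratic_injective {a b c a' b' c' : A}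
    (h : C a * X ^ 2 + C b * X + C c = C a' * X ^ 2 + C b' * X + C c') :
    a = a' ∧ b = b' ∧ c = c' := by
  have h2 := congrArg (coeff · 2) h
  have h1 := congrArg (coeff · 1) h
  have h0 := congrArg (coeff · 0) h
  simp [coeff_X, coeff_C] at h2 h1 h0
  exact ⟨h2, h1, h0⟩

omit [IsDomain A] in
lemma low_injective {c d : Fin 6 → A} (h : low c = low d) : c = d := by
  rw [low_apply, low_apply] at h
  obtain ⟨h₁, h₂, h₃⟩ := quadratic_injective h
  obtain ⟨-, h₄, h₅⟩ := quadratic_injective (a := (0 : A)) (a' := 0) (by simpa using h₂)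
  obtain ⟨h₆, h₇, h₈⟩ := quadratic_injective h₃
  ext i
  fin_cases i
  exacts [h₈, h₇, h₅, h₆, h₄, C_injective h₁]

end Uniqueness

section Syzygies

variable {A : Type*} [CommRing A] [CharP A 3] (p : Fin 3 → A)

/-- The range of the syzygy matrix. -/
noncomputable def syzRange {S : Type*} [CommRing S] (v : Fin 5 → S) : Submodule S (Fin 5 → S) :=
  LinearMap.range (values v quinticSyz).mulVecLin

/-- Combinations of the columns of the syzygy matrix with visible pivots: t on the entries 1, 2, 3,
4 (first, second, third and fifth vector) and s on the entry 4 (fourth vector). Otherwise t does not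
occur. -/
lemma reducedSyz_mem {S : Type*} [CommRing S] [CharP S 3] (v : Fin 5 → S) :
    ![-v 0 - v 1 - v 3, v 0 + v 1 + v 2 + v 4, -v 0 + v 1 + v 2, v 0 + v 1, -v 0 + v 1 + v 2] ∈
      syzRange v ∧
    ![0, -v 1 - v 2 - v 3, -v 1 + v 2 + v 4, -v 0 + v 2, -v 0 + v 2] ∈ syzRange v ∧
    ![0, -v 0 - v 1, v 0 + v 1 - v 2 - v 3, v 2 + v 4, v 0 + v 1 - v 2] ∈ syzRange v ∧
    ![0, -v 2, -v 0 - v 1, -v 0 - v 2, v 0 + v 1 + v 3] ∈ syzRange v ∧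
    ![-v 2, -v 0 - v 1, -v 0 - v 2, 0, -v 0 - v 1 + v 2 + v 4] ∈ syzRange v := by
  have h : ∀ (e : Fin 5 → S) w, w = values v quinticSyz *ᵥ e → w ∈ syzRange v := 
    fun e w h => ⟨e, h.symm⟩
  refine ⟨h ![1, -1, -1, 0, 1] _ ?_, h ![0, -1, 0, 1, -1] _ ?_, h ![-1, 1, 0, 0, 0] _ ?_,
    h ![0, 0, 0, 0, -1] _ ?_, h ![0, 0, 0, 1, 0] _ ?_⟩
  all_goals
    ext i
    simp only [Matrix.mulVec, dotProduct, Fin.sum_univ_five, values, quinticSyz, Form.matrix,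
      Matrix.map_apply, value_linear]
    fin_cases i <;> simp [two_eq_neg_one] <;> grind

end Syzygies

section FibreVectors

variable {A : Type*} [CommRing A]

/-- The vectors whose last four components do not contain `t`. -/
noncomputable def fibreVector (x : A[X][X]) (a : Fin 4 → A[X]) : Fin 5 → A[X][X] :=
  ![x, C (a 0), C (a 1), C (a 2), C (a 3)]

lemma fibreVector_add (x y : A[X][X]) (a b : Fin 4 → A[X]) :
    fibreVector (x + y) (a + b) = fibreVector x a + fibreVector y b := by
  ext1 i
  simp only [Pi.add_apply, Pi.sub_apply, Pi.smul_apply, smul_eq_mul]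
  fin_cases i <;> simp [fibreVector]

lemma fibreVector_smul (x : A[X][X]) (c : A[X]) (a : Fin 4 → A[X]) :
    fibreVector (C c * x) (c • a) = C c • fibreVector x a := by
  ext1 i
  simp only [Pi.add_apply, Pi.sub_apply, Pi.smul_apply, smul_eq_mul]
  fin_cases i <;> simp [fibreVector]

lemma fibreVector_eq_sum (x : A[X][X]) (a : Fin 4 → A[X]) :
    fibreVector x a = fibreVector x 0 + C (a 0) • Pi.single 1 1 + C (a 1) • Pi.single 2 1 +
      C (a 2) • Pi.single 3 1 + C (a 3) • Pi.single 4 1 := by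
  ext1 i
  simp only [Pi.add_apply, Pi.sub_apply, Pi.smul_apply, smul_eq_mul]
  fin_cases i <;> simp [fibreVector]

variable [CharP A 3] (p : Fin 3 → A)

/-- The pivots rewrite t times each of the last four unit vectors without t in the last four
entries. The first entry may stay arbitrary, so the vectors that can be normalized are stable under
multiplication by t. -/
lemma exists_fibreVector (w : Fin 5 → A[X][X]) :
    ∃ x a, w - fibreVector x a ∈ syzRange (fibreCoords p) := by
  obtain ⟨r₀, r₁, r₂, -, r₄⟩ := reducedSyz_mem (fibreCoords p)
  set K := syzRange (fibreCoords p)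
  set W : Set (Fin 5 → A[X][X]) := {w | ∃ x a, w - fibreVector x a ∈ K} with hW
  have add : ∀ w ∈ W, ∀ z ∈ W, w + z ∈ W := by
    rintro w ⟨x, a, h⟩ z ⟨x', a', h'⟩
    refine ⟨x + x', a + a', ?_⟩
    rw [fibreVector_add, add_sub_add_comm]
    exact add_mem h h'
  have smul : ∀ c, ∀ w ∈ W, (C c : A[X][X]) • w ∈ W := by
    rintro c w ⟨x, a, h⟩
    refine ⟨C c * x, c • a, ?_⟩
    rw [fibreVector_smul]
    simpa [smul_sub] using K.smul_mem (C c) h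
  have mk : ∀ x a, fibreVector x a ∈ W := fun x a => ⟨x, a, by simp⟩
  have sub : ∀ r ∈ K, ∀ z x a, z = r + fibreVector x a → z ∈ W := by
    rintro r hr _ x a rfl
    exact ⟨x, a, by simpa using hr⟩
  have mulX : ∀ w ∈ W, (X : A[X][X]) • w ∈ W := by
    rintro w ⟨x, a, h⟩
    have h₁ : (X : A[X][X]) • Pi.single 1 1 ∈ W := by
      refine sub _ r₀ _ (C (C (p 0) + C (p 1) + X))
        ![-C (p 0) - C (p 1) - C (p 2), C (p 0) - C (p 1) - C (p 2), -C (p 0) - C (p 1),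
          C (p 0) - C (p 1) - C (p 2)] ?_
      ext1 i
      simp only [Pi.add_apply, Pi.sub_apply, Pi.smul_apply, smul_eq_mul]
      fin_cases i <;> simp [fibreVector, fibreCoords]
      ring
    have h₂ : (X : A[X][X]) • Pi.single 2 1 ∈ W := by
      refine sub _ r₁ _ 0 ![C (p 1) + C (p 2) + X, C (p 1) - C (p 2), C (p 0) - C (p 2),
        C (p 0) - C (p 2)] ?_
      ext1 i
      simp only [Pi.add_apply, Pi.sub_apply, Pi.smul_apply, smul_eq_mul]
      fin_cases i <;> simp [fibreVector, fibreCoords]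
      ring
    have h₃ : (X : A[X][X]) • Pi.single 3 1 ∈ W := by
      refine sub _ r₂ _ 0 ![C (p 0) + C (p 1), -C (p 0) - C (p 1) + C (p 2) + X, -C (p 2),
        -C (p 0) - C (p 1) + C (p 2)] ?_
      ext1 i
      simp only [Pi.add_apply, Pi.sub_apply, Pi.smul_apply, smul_eq_mul]
      fin_cases i <;> simp [fibreVector, fibreCoords]
    have h₄ : (X : A[X][X]) • Pi.single 4 1 ∈ W := by
      refine sub _ r₄ _ (C (C (p 2))) ![C (p 0) + C (p 1), C (p 0) + C (p 2), 0,
        C (p 0) + C (p 1) - C (p 2)] ?_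
      ext1 i
      simp only [Pi.add_apply, Pi.sub_apply, Pi.smul_apply, smul_eq_mul]
      fin_cases i <;> simp [fibreVector, fibreCoords]
      ring
    have h₀ : (X : A[X][X]) • fibreVector x a ∈ W := by
      rw [fibreVector_eq_sum]
      simp only [smul_add, smul_comm (X : A[X][X]) (C _ : A[X][X])]
      refine add _ (add _ (add _ (add _ ?_ _ (smul _ _ h₁)) _ (smul _ _ h₂)) _ (smul _ _ h₃)) _
        (smul _ _ h₄)
      convert mk (X * x) 0
      ext1 i
      simp only [Pi.add_apply, Pi.sub_apply, Pi.smul_apply, smul_eq_mul]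
      fin_cases i <;> simp [fibreVector]
    convert add _ (sub _ (K.smul_mem X h) _ 0 0 rfl) _ h₀ using 1
    ext1 i; simp only [Pi.add_apply, Pi.sub_apply, Pi.smul_apply, smul_eq_mul]; fin_cases i <;>
      simp [fibreVector] <;> ring
  have key : ∀ i, ∀ z : A[X][X], z • Pi.single i 1 ∈ W := by
    intro i z
    induction z using Polynomial.induction_on' with
    | add p q hp hq => rw [add_smul]; exact add _ hp _ hq
    | monomial n a =>
      rw [← C_mul_X_pow_eq_monomial, mul_smul]
      refine smul _ _ ?_
      induction n with
      | zero =>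
        fin_cases i
        · convert mk 1 0
          ext1 i; fin_cases i <;> simp [fibreVector]
        · convert mk 0 ![1, 0, 0, 0]
          ext1 i; fin_cases i <;> simp [fibreVector]
        · convert mk 0 ![0, 1, 0, 0]
          ext1 i; fin_cases i <;> simp [fibreVector]
        · convert mk 0 ![0, 0, 1, 0]
          ext1 i; fin_cases i <;> simp [fibreVector]
        · convert mk 0 ![0, 0, 0, 1]
          ext1 i; fin_cases i <;> simp [fibreVector]
      | succ n ih => rw [pow_succ', mul_smul]; exact mulX _ ih
  have : w = ∑ i, w i • Pi.single i 1 := by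
    ext1 i; simp [Finset.sum_apply, Pi.single_apply]
  rw [this, Fin.sum_univ_five]
  exact add _ (add _ (add _ (add _ (key _ _) _ (key _ _)) _ (key _ _)) _ (key _ _)) _ (key _ _)

/-- The syzygy with pivot s + p₀ + p₁ in the last entry allows division with remainder there, and
the remainder is the value at -(p₀ + p₁). -/
lemma exists_fibreVector_C (w : Fin 5 → A[X][X]) :
    ∃ x a e, a 3 = C e ∧ w - fibreVector x a ∈ syzRange (fibreCoords p) := by
  obtain ⟨x, a, h⟩ := exists_fibreVector p w
  obtain ⟨-, -, -, r, -⟩ := reducedSyz_mem (fibreCoords p)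
  obtain ⟨q, hq⟩ := X_sub_C_dvd_sub_C_eval (a := -(p 0 + p 1)) (p := a 3)
  refine ⟨x, ![a 0 + q * C (p 2), a 1 + q * (C (p 0) + C (p 1)), a 2 + q * (C (p 0) + C (p 2)),
    C ((a 3).eval (-(p 0 + p 1)))], _, rfl, ?_⟩
  convert add_mem h ((syzRange (fibreCoords p)).smul_mem (C q) r) using 1
  rw [sub_eq_iff_eq_add] at hq
  ext1 i
  simp only [Pi.add_apply, Pi.sub_apply, Pi.smul_apply, smul_eq_mul]
  fin_cases i <;> simp [fibreVector, fibreCoords]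
  · ring
  · ring
  · ring
  · rw [hq]; simp; ring

end FibreVectors

end ThreeCubics

/-! ### Syzygies of the quintic, and torsion-freeness over the first three coordinates -/

namespace ThreeCubics

open Polynomial Form
open scoped Matrix

/-- The ideal generated by `quinticGens`. -/
def quinticIdeal {S : Type*} [CommRing S] (v : Fin 5 → S) : Ideal S :=
  Ideal.span (Set.range fun i => (quinticGens 0 i).value v)

/-- The ideal generated by `veroneseGens`. -/
def projectedVeroneseIdeal {S : Type*} [CommRing S] (v : Fin 5 → S) : Ideal S :=
  Ideal.span (Set.range fun i => (veroneseGens 0 i).value v)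

lemma mem_quinticIdeal {S : Type*} [CommRing S] {v : Fin 5 → S} {x : S} :
    x ∈ quinticIdeal v ↔ ∃ w : Fin 5 → S, ∑ i, w i * (quinticGens 0 i).value v = x :=
  Ideal.mem_span_range_iff_exists_fun

lemma values_quinticGens_mulVec {S : Type*} [CommRing S] (v w : Fin 5 → S) :
    (values v quinticGens *ᵥ w) 0 = ∑ i, w i * (quinticGens 0 i).value v := by
  simp [Matrix.mulVec, dotProduct, values, mul_comm]

lemma sum_eq_zero_of_mem_syzRange {S : Type*} [CommRing S] [CharP S 3] {v w : Fin 5 → S}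
    (hw : w ∈ syzRange v) : ∑ i, w i * (quinticGens 0 i).value v = 0 := by
  obtain ⟨u, rfl⟩ := hw
  rw [← values_quinticGens_mulVec, Matrix.mulVecLin_apply, Matrix.mulVec_mulVec,
    quinticGens_mul_quinticSyz, Matrix.zero_mulVec]
  rfl

section

variable {A : Type*} [CommRing A] [IsDomain A] [CharP A 3] {p : Fin 3 → A}

/-- After normalization `eq_zero_of_low` removes all coefficients but the constant last one. So the
only elements of the ideal of degree at most two in s, t are the A-multiples of the fifth cubic; for
l = 0 this describes the syzygies. -/
lemma exists_of_sum_eq_low {w : Fin 5 → A[X][X]} {l : Fin 6 → A}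
    (h : ∑ i, w i * (quinticGens 0 i).value (fibreCoords p) = low l) :
    ∃ e, w - (Pi.single 4 (C (C e)) : Fin 5 → A[X][X]) ∈ syzRange (fibreCoords p) ∧ l = e • quinticLow p 4 := by
  obtain ⟨x, a, e, he, hw⟩ := exists_fibreVector_C p w
  have h' := sum_eq_zero_of_mem_syzRange hw
  simp only [Pi.sub_apply, sub_mul, Finset.sum_sub_distrib, h, sub_eq_zero] at h'
  simp only [Fin.sum_univ_five, quinticGens_fibreCoords_0, quinticGens_fibreCoords_1,
    quinticGens_fibreCoords_2, quinticGens_fibreCoords_3, quinticGens_fibreCoords_4] at h'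
  obtain ⟨h₀, h₁, h₂, h₃⟩ := eq_zero_of_low (q := quinticLow p) (by simp [quinticLow])
    (by simp [quinticLow]) (a := x) (b := a 0) (c := a 1) (d := a 2) (e := e) (l := l)
    (by rw [h']; simp [fibreVector, he])
  refine ⟨e, ?_, low_injective ?_⟩
  · convert hw using 2
    ext1 i; fin_cases i <;> simp [fibreVector, h₀, h₁, h₂, h₃, he]
  · rw [h', map_smul]
    simp [fibreVector, h₀, h₁, h₂, h₃, he, Algebra.smul_def,
      IsScalarTower.algebraMap_apply A A[X] A[X][X]]

lemma mem_syzRange_fibreCoords (hp : p 2 ≠ 0) {w : Fin 5 → A[X][X]}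
    (h : ∑ i, w i * (quinticGens 0 i).value (fibreCoords p) = 0) :
    w ∈ syzRange (fibreCoords p) := by
  obtain ⟨e, he, h0⟩ := exists_of_sum_eq_low (l := 0) (by rw [h, map_zero])
  -- Entry 5 is the coefficient of t², which for the fifth cubic is `p 2`.
  have : e = 0 := by
    have := (congrFun h0 5).symm
    simpa [quinticLow, hp] using this
  simpa [this] using he

/-- The ring `A[s][t]` modulo the ideal of the quintic is torsion-free over `A`. -/
lemma mem_quinticIdeal_of_mul_mem (hp : Prime (p 2)) (hp' : ¬ p 2 ∣ p 0) {a : A} (ha : a ≠ 0)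
    {x : A[X][X]} (h : C (C a) * x ∈ quinticIdeal (fibreCoords p)) :
    x ∈ quinticIdeal (fibreCoords p) := by
  have hF : ∀ i, (quinticGens 0 i).value (fibreCoords p) ∈ quinticIdeal (fibreCoords p) :=
    fun i => Ideal.subset_span ⟨i, rfl⟩
  have h0 := hF 0
  have h1 := hF 1
  have h2 := hF 2
  have h3 := hF 3
  rw [quinticGens_fibreCoords_0] at h0
  rw [quinticGens_fibreCoords_1] at h1
  rw [quinticGens_fibreCoords_2] at h2
  rw [quinticGens_fibreCoords_3] at h3
  obtain ⟨n, hn⟩ := exists_low (quinticIdeal (fibreCoords p)) (fun i => quinticLow p i.castSucc)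
    h0 h1 h2 h3 x
  suffices low n ∈ quinticIdeal (fibreCoords p) by simpa using add_mem hn this
  have han : low (a • n) ∈ quinticIdeal (fibreCoords p) := by
    have := sub_mem h (Ideal.mul_mem_left _ (C (C a)) hn)
    rw [map_smul, Algebra.smul_def, IsScalarTower.algebraMap_apply A A[X] A[X][X]]
    simpa [mul_sub] using this
  obtain ⟨w, hw⟩ := mem_quinticIdeal.mp han
  obtain ⟨e, -, he⟩ := exists_of_sum_eq_low hw
  have e5 : a * n 5 = e * p 2 := by simpa [quinticLow] using congrFun he 5
  have e3 : a * n 3 = e * (p 0 + p 2) := by simpa [quinticLow] using congrFun he 3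
  -- The fifth cubic has the coefficients `p 2` at t² and `p 0 + p 2` at s². Eliminating e from
  -- these two entries shows that the multiplier e is itself divisible by a.
  have : p 2 ∣ n 5 := by
    have : n 5 * (p 0 + p 2) = n 3 * p 2 := by
      refine mul_left_cancel₀ ha ?_
      linear_combination (p 0 + p 2) * e5 - p 2 * e3
    refine (hp.dvd_or_dvd (Dvd.intro_left _ this.symm)).resolve_right ?_
    rwa [dvd_add_self_right]
  obtain ⟨u, hu⟩ := this
  have hau : e = a * u := by
    refine mul_left_cancel₀ hp.ne_zero ?_
    rw [hu] at e5
    linear_combination -e5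
  have : n = u • quinticLow p 4 := by
    ext i
    refine mul_left_cancel₀ ha ?_
    have := congrFun he i
    simp only [Pi.smul_apply, smul_eq_mul] at this ⊢
    rw [this, hau, mul_assoc]
  rw [this, map_smul, ← quinticGens_fibreCoords_4, Algebra.smul_def]
  exact Ideal.mul_mem_left _ _ (hF 4)

end

/-- The ring isomorphism that regards `R` as a polynomial ring in the last two coordinates. -/
noncomputable def fibreEquiv : R ≃+* (MvPolynomial (Fin 3) (ZMod 3))[X][X] :=
  coordEquiv.symm.toRingEquiv.trans <| RingEquiv.ofRingHom
    (MvPolynomial.eval₂Hom (C.comp (C.comp MvPolynomial.C)) (fibreCoords MvPolynomial.X))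
    (eval₂RingHom (eval₂RingHom
      (MvPolynomial.eval₂Hom MvPolynomial.C ![MvPolynomial.X 0, MvPolynomial.X 1, MvPolynomial.X 2])
      (MvPolynomial.X 3)) (MvPolynomial.X 4))
    (by
      refine Polynomial.ringHom_ext' (Polynomial.ringHom_ext' (MvPolynomial.ringHom_ext ?_ ?_) ?_) ?_
      · intro r; simp
      · intro i; fin_cases i <;> simp [fibreCoords]
      · simp [fibreCoords]
      · simp [fibreCoords])
    (by
      refine MvPolynomial.ringHom_ext ?_ ?_
      · intro r; simp
      · intro i; fin_cases i <;> simp [fibreCoords])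

lemma fibreEquiv_y (i : Fin 5) : fibreEquiv (y i) = fibreCoords MvPolynomial.X i := by
  change MvPolynomial.eval₂Hom _ _ (coordEquiv.symm (y i)) = _
  rw [coordEquiv_symm_y, MvPolynomial.eval₂Hom_X']

lemma fibreEquiv_value (P : Form) : fibreEquiv (P.value y) = P.value (fibreCoords MvPolynomial.X) := by
  refine (map_value (S' := (MvPolynomial (Fin 3) (ZMod 3))[X][X]) fibreEquiv.toRingHom y P).trans ?_
  congr 1
  ext1 i
  exact fibreEquiv_y i

lemma fibreEquiv_symm_value (P : Form) :
    fibreEquiv.symm (P.value (fibreCoords MvPolynomial.X)) = P.value y := by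
  rw [← fibreEquiv_value, RingEquiv.symm_apply_apply]

/-- The exactness of the syzygy matrix. -/
lemma mem_syzRange_y {w : Fin 5 → R} (h : ∑ i, w i * (quinticGens 0 i).value y = 0) :
    w ∈ syzRange y := by
  obtain ⟨u, hu⟩ := mem_syzRange_fibreCoords (p := (MvPolynomial.X : Fin 3 → MvPolynomial (Fin 3) (ZMod 3)))
    (MvPolynomial.X_ne_zero 2) (w := fun i => fibreEquiv (w i)) (by
      simpa [fibreEquiv_value] using congrArg fibreEquiv h)
  refine ⟨fun i => fibreEquiv.symm (u i), ?_⟩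
  ext1 i
  have := congrArg fibreEquiv.symm (congrFun hu i)
  rw [RingEquiv.symm_apply_apply] at this
  rw [← this]
  simp [Matrix.mulVec, dotProduct, values, fibreEquiv_symm_value]

/-- The polynomials in the first three coordinates. -/
noncomputable def baseMap : MvPolynomial (Fin 3) (ZMod 3) →+* R :=
  fibreEquiv.symm.toRingHom.comp (C.comp C)

lemma fibreEquiv_mem {x : R} : fibreEquiv x ∈ quinticIdeal (fibreCoords MvPolynomial.X) ↔
    x ∈ quinticIdeal y := by
  rw [mem_quinticIdeal, mem_quinticIdeal]
  constructor
  · rintro ⟨w, hw⟩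
    refine ⟨fun i => fibreEquiv.symm (w i), fibreEquiv.injective ?_⟩
    simp [← hw, fibreEquiv_value]
  · rintro ⟨w, rfl⟩
    exact ⟨fun i => fibreEquiv (w i), by simp [fibreEquiv_value]⟩

/-- This cancellation is what carries the linkage and the unmixedness: it suffices to test
membership in the quintic ideal up to a nonzero multiplier from the base. -/
lemma mem_quinticIdeal_y_of_mul_mem {a : MvPolynomial (Fin 3) (ZMod 3)} (ha : a ≠ 0) {x : R}
    (h : baseMap a * x ∈ quinticIdeal y) : x ∈ quinticIdeal y := by
  rw [← fibreEquiv_mem] at h ⊢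
  refine mem_quinticIdeal_of_mul_mem MvPolynomial.X_prime ?_ ha (a := a) ?_
  · rw [MvPolynomial.X_dvd_X]
    decide
  · simpa [baseMap] using h

end ThreeCubics

/-! ### The kernel of the syzygy matrix, and further identities for the pencil -/

namespace ThreeCubics

open MvPolynomial Form
open scoped Matrix

lemma values_coord_mulVec {S : Type*} [CommRing S] (v : Fin 5 → S) (c : S) :
    values v coord *ᵥ ![c] = c • v := by
  ext i
  simp [Matrix.mulVec, dotProduct, values_coord, mul_comm]

lemma quinticSyz_mulVec_self {S : Type*} [CommRing S] [CharP S 3] (v : Fin 5 → S) :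
    values v quinticSyz *ᵥ v = 0 := by
  have := values_coord_mulVec v 1
  rw [one_smul] at this
  nth_rw 2 [← this]
  rw [Matrix.mulVec_mulVec, quinticSyz_mul_coord, Matrix.zero_mulVec]

lemma det_quinticSyz_ne_zero :
    ((values y quinticSyz).submatrix Fin.succ Fin.succ).det ≠ 0 := by
  intro h
  have h' := congrArg (evalAt ![1, 0, 0, 0, 0]) h
  rw [map_zero, AlgHom.map_det] at h'
  have : (evalAt ![1, 0, 0, 0, 0]).mapMatrix ((values y quinticSyz).submatrix Fin.succ Fin.succ) =
      !![2, 0, 2, 0; 1, 1, 2, 1; 0, 0, 0, 1; 1, 2, 2, 2] := by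
    ext i j
    simp only [AlgHom.mapMatrix_apply, Matrix.map_apply, Matrix.submatrix_apply, values,
      evalAt_value]
    simp only [quinticSyz, Form.matrix, value_linear]
    fin_cases i <;> fin_cases j <;> simp
  rw [this] at h'
  revert h'
  decide +kernel

/-- The kernel of the syzygy matrix. -/
lemma exists_of_quinticSyz {v : Fin 5 → R} (h : values y quinticSyz *ᵥ v = 0) :
    ∃ c : R, v = c • y := by
  -- This combination has zero first entry, so a nonvanishing 4×4 minor forces it to be zero. Then v
  -- is proportional to y, and the Koszul complex provides the factor.
  have h0 : values y quinticSyz *ᵥ (y 0 • v - v 0 • y) = 0 := by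
    rw [Matrix.mulVec_sub, Matrix.mulVec_smul, Matrix.mulVec_smul, h, quinticSyz_mulVec_self,
      smul_zero, smul_zero, sub_zero]
  have h1 : (values y quinticSyz).submatrix Fin.succ Fin.succ *ᵥ
      (fun j : Fin 4 => y 0 * v j.succ - v 0 * y j.succ) = 0 := by
    ext1 i
    have := congrFun h0 i.succ
    rw [Matrix.mulVec, dotProduct, Fin.sum_univ_succ] at this
    simpa [Matrix.mulVec, dotProduct, mul_comm] using this
  have h2 := Matrix.eq_zero_of_mulVec_eq_zero det_quinticSyz_ne_zero h1
  obtain ⟨c, -, hc⟩ := y_regularCoords.exists_eq_mul (a := v) (s := fun _ => True) trivial (by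
    intro i _
    refine Fin.cases rfl (fun j => ?_) i
    exact (mul_comm _ _).trans (sub_eq_zero.mp (congrFun h2 j)).symm)
  exact ⟨c, by ext1 i; simpa [mul_comm] using hc i trivial⟩

lemma pencilRows_mul_liftMat {S : Type*} [CommRing S] [CharP S 3] (v : Fin 5 → S) :
    values v pencilRows * values v liftMat = 0 :=
  values_mul_eq_zero v 15 (by decide +kernel)

lemma pencilRows_mul_coord {S : Type*} [CommRing S] [CharP S 3] (v : Fin 5 → S) :
    values v pencilRows * values v coord = 0 :=
  values_mul_eq_zero v 15 (by decide +kernel)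

lemma pencilProj_mul_pencil {S : Type*} [CommRing S] [CharP S 3] (v : Fin 5 → S) :
    values v pencilProj * values v pencil = 0 :=
  values_mul_eq_zero v 15 (by decide +kernel)

/-- The first two rows of the identity matrix. -/
def pencilCoord : Matrix (Fin 2) (Fin 10) Form := Form.matrix 0
  !![1, 0, 0, 0, 0, 0, 0, 0, 0, 0; 0, 1, 0, 0, 0, 0, 0, 0, 0, 0]

lemma pencilSection_mul_proj {S : Type*} [CommRing S] [CharP S 3] (v : Fin 5 → S) :
    values v pencilSection * values v pencilProj + values v pencil * values v pencilCoord = 1 := by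
  have : ∀ j k, sumsAgree 15
      (products pencilSection pencilProj j k ++ products pencil pencilCoord j k)
        (products (one 10) (one 10) j k) = true := by decide +kernel
  ext j k
  have := sumValue_eq_of_sumsAgree v 15 _ _ (this j k)
  rw [sumValue_append, sumValue_products, sumValue_products, sumValue_products, values_one,
    Matrix.one_mul] at this
  exact this

lemma liftMat_mul_pencil {S : Type*} [CommRing S] [CharP S 3] (v : Fin 5 → S) :
    values v liftMat * values v pencil = 0 :=
  values_mul_eq_zero v 15 (by decide +kernel)

end ThreeCubics

/-! ### Divisibility by two coordinates, and the rows of the pencil -/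

namespace ThreeCubics

open MvPolynomial Form
open scoped Matrix

section Divisibility

lemma prime_y (i : Fin 5) : Prime (y i) := by
  rw [← Ideal.span_singleton_prime (y_ne_zero i), ← Set.image_singleton (f := y)]
  exact coordIdeal_isPrime {i}

lemma not_y_dvd_y {i j : Fin 5} (h : i ≠ j) : ¬ y i ∣ y j := fun hd =>
  y_notMem_coordIdeal (s := {i}) (i := j) (by simpa using h.symm)
    (mem_coordIdeal_singleton.mpr hd)

lemma exists_of_sq_mul_eq {a b : R} (h : y 1 ^ 2 * a = y 4 ^ 2 * b) :
    ∃ c, a = y 4 ^ 2 * c ∧ b = y 1 ^ 2 * c := by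
  have hd : ¬ y 4 ∣ y 1 ^ 2 := fun hd =>
    not_y_dvd_y (by decide) ((prime_y 4).dvd_of_dvd_pow hd)
  obtain ⟨c, rfl⟩ := (prime_y 4).pow_dvd_of_dvd_mul_left 2 hd (Dvd.intro _ h.symm)
  exact ⟨c, rfl, mul_left_cancel₀ (pow_ne_zero 2 (y_ne_zero 4)) (by rw [← h]; ring)⟩

lemma exists_of_mul_eq {a b : R} (h : y 1 * a = y 4 * b) :
    ∃ c, a = y 4 * c ∧ b = y 1 * c := by
  obtain ⟨c, rfl⟩ := ((prime_y 4).dvd_or_dvd (Dvd.intro _ h.symm)).resolve_left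
    (not_y_dvd_y (by decide))
  exact ⟨c, rfl, mul_left_cancel₀ (y_ne_zero 4) (by rw [← h]; ring)⟩

lemma mem_coordIdeal_pair {a : R} : a ∈ coordIdeal {1, 4} ↔ ∃ b c, a = y 1 * b + y 4 * c := by
  simp only [mem_coordIdeal_insert, mem_coordIdeal_singleton]
  constructor
  · rintro ⟨b, _, ⟨c, rfl⟩, rfl⟩
    exact ⟨b, c, by ring⟩
  · rintro ⟨b, c, rfl⟩
    exact ⟨b, _, ⟨c, rfl⟩, by ring⟩

/-- The ideal generated by the squares of two coordinates is primary. -/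
lemma exists_of_mul_eq_sq {m α A B : R} (hm : m ∉ coordIdeal {1, 4})
    (h : α * m = y 1 ^ 2 * A + y 4 ^ 2 * B) : ∃ a b, α = y 1 ^ 2 * a + y 4 ^ 2 * b := by
  have cancel : ∀ {x b c : R}, x * m = y 1 * b + y 4 * c → ∃ b' c', x = y 1 * b' + y 4 * c' :=
    fun h => mem_coordIdeal_pair.mp
      (((coordIdeal_isPrime {1, 4}).mem_or_mem (mem_coordIdeal_pair.mpr ⟨_, _, h⟩)).resolve_right hm)
  -- First α = y₁ a + y₄ b, then a and b are decomposed in the same way. Only the mixed term y₁ y₄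
  -- (a₂ + b₁) is not yet of the required form. Dividing the relation by y₁ y₄ allows m to be
  -- cancelled once more.
  obtain ⟨a, b, rfl⟩ := cancel (x := α) (b := y 1 * A) (c := y 4 * B) (by rw [h]; ring)
  obtain ⟨c, hc, hc'⟩ := exists_of_mul_eq (a := a * m - y 1 * A) (b := y 4 * B - b * m)
    (by linear_combination h)
  obtain ⟨a₁, a₂, rfl⟩ := cancel (x := a) (b := A) (c := c) (by linear_combination hc)
  obtain ⟨b₁, b₂, rfl⟩ := cancel (x := b) (b := -c) (c := B) (by linear_combination -hc')
  obtain ⟨A', hA⟩ : y 4 ∣ A - a₁ * m := by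
    refine ((prime_y 4).dvd_or_dvd (a := y 1 ^ 2) ⟨y 1 * (a₂ + b₁) * m + y 4 * (b₂ * m - B), ?_⟩).resolve_left
      fun hd => not_y_dvd_y (by decide) ((prime_y 4).dvd_of_dvd_pow hd)
    linear_combination -h
  obtain ⟨B', hB⟩ : y 1 ∣ B - b₂ * m := by
    refine ((prime_y 1).dvd_or_dvd (a := y 4 ^ 2) ⟨y 4 * (a₂ + b₁) * m + y 1 * (a₁ * m - A), ?_⟩).resolve_left
      fun hd => not_y_dvd_y (by decide) ((prime_y 1).dvd_of_dvd_pow hd)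
    linear_combination -h
  obtain ⟨e, e', he⟩ := cancel (x := a₂ + b₁) (b := A') (c := B') (by
    refine mul_left_cancel₀ (mul_ne_zero (y_ne_zero 1) (y_ne_zero 4)) ?_
    linear_combination h + y 1 ^ 2 * hA + y 4 ^ 2 * hB)
  exact ⟨a₁ + y 4 * e, b₂ + y 1 * e', by linear_combination y 1 * y 4 * he⟩

end Divisibility

/-- A minor of the rows of the pencil. -/
noncomputable def pencilMinor : R :=
  values y pencilRows 0 1 * values y pencilRows 1 4 - values y pencilRows 0 4 * values y pencilRows 1 1

/-- The minor is nonzero at the point (0, 0, 1, 1, 0) of the plane y₁ = y₄ = 0. This allows Cramer's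
rule to be inverted modulo the squares of these two coordinates. -/
lemma pencilMinor_notMem : pencilMinor ∉ coordIdeal {1, 4} := by
  intro h
  have := coordIdeal_le_ker {1, 4} ![0, 0, 1, 1, 0] (by simp) _ h
  rw [pencilMinor, map_sub, map_mul, map_mul] at this
  simp only [values, Matrix.map_apply, evalAt_value] at this
  simp only [pencilRows, syzAll, Form.matrix, value_linear] at this
  simp at this
  revert this
  decide

lemma pencilMinor_ne_zero : pencilMinor ≠ 0 := fun h => pencilMinor_notMem (h ▸ zero_mem _)

lemma pencilRows_transpose_mulVec {S : Type*} [CommRing S] (v : Fin 5 → S) (c : Fin 2 → S)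
    (j : Fin 5) : ((values v pencilRows)ᵀ *ᵥ c) j =
      values v pencilRows 0 j * c 0 + values v pencilRows 1 j * c 1 := by
  simp [Matrix.mulVec, dotProduct, Fin.sum_univ_two]

lemma pencilRows_injective {c : Fin 2 → R} (h : (values y pencilRows)ᵀ *ᵥ c = 0) : c = 0 := by
  have h1 := congrFun h 1
  have h4 := congrFun h 4
  rw [pencilRows_transpose_mulVec] at h1 h4
  simp only [Pi.zero_apply] at h1 h4
  ext1 i
  fin_cases i
  · refine mul_left_cancel₀ pencilMinor_ne_zero ?_
    change pencilMinor * c 0 = pencilMinor * 0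
    rw [pencilMinor]
    linear_combination values y pencilRows 1 4 * h1 - values y pencilRows 1 1 * h4
  · refine mul_left_cancel₀ pencilMinor_ne_zero ?_
    change pencilMinor * c 1 = pencilMinor * 0
    rw [pencilMinor]
    linear_combination values y pencilRows 0 1 * h4 - values y pencilRows 0 4 * h1

/-- The kernel of the matrix of minors is spanned by the rows of the pencil. -/
lemma exists_of_pencilMinors {ρ : Fin 5 → R} (h : values y pencilMinors *ᵥ ρ = 0) :
    ∃ c, ρ = (values y pencilRows)ᵀ *ᵥ c := by
  -- Both y₄² ρ and y₁² ρ are combinations of the rows. Independence of the rows makes the two sets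
  -- of coefficients compatible, so the factor y₄² divides out.
  have h4 := congrArg (· *ᵥ ρ) (minor_identity₄ y)
  have h1 := congrArg (· *ᵥ ρ) (minor_identity₁ y)
  simp only [Matrix.add_mulVec, ← Matrix.mulVec_mulVec, h, Matrix.mulVec_zero, zero_add,
    Matrix.smul_mulVec, Matrix.one_mulVec] at h4 h1
  set c4 := values y minorRows₄ *ᵥ ρ
  set c1 := values y minorRows₁ *ᵥ ρ
  have : y 1 ^ 2 • c4 - y 4 ^ 2 • c1 = 0 := by
    apply pencilRows_injective
    rw [Matrix.mulVec_sub, Matrix.mulVec_smul, Matrix.mulVec_smul, ← h4, ← h1, smul_comm, sub_self]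
  have key : ∀ i, ∃ c, c4 i = y 4 ^ 2 * c ∧ c1 i = y 1 ^ 2 * c := fun i =>
    exists_of_sq_mul_eq (sub_eq_zero.mp (congrFun this i))
  choose c hc hc' using key
  refine ⟨c, ?_⟩
  have hc4 : c4 = y 4 ^ 2 • c := by ext1 i; simp [hc]
  rw [hc4, Matrix.mulVec_smul] at h4
  ext1 i
  exact mul_left_cancel₀ (pow_ne_zero 2 (y_ne_zero 4)) (congrFun h4 i)

lemma y_dotProduct_pencilRows (c : Fin 2 → R) :
    ∑ i, y i * ((values y pencilRows)ᵀ *ᵥ c) i = 0 := by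
  have h : ∀ k, ∑ i, values y pencilRows k i * y i = 0 := fun k => by
    have := congrFun (congrFun (pencilRows_mul_coord y) k) 0
    simpa [Matrix.mul_apply, values_coord] using this
  have h0 := h 0
  have h1 := h 1
  rw [Fin.sum_univ_five] at h0 h1
  simp only [pencilRows_transpose_mulVec, Fin.sum_univ_five]
  linear_combination c 0 * h0 + c 1 * h1

lemma coord_transpose_mul_koszul₃ {S : Type*} [CommRing S] [CharP S 3] (v : Fin 5 → S) :
    (values v coord)ᵀ * values v koszul₃ = 0 :=
  values_mul_eq_zero v 15 (A := coordᵀ) (by decide +kernel)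

lemma y_dotProduct_koszul₃ (u : Fin 10 → R) :
    ∑ i, y i * (values y koszul₃ *ᵥ u) i = 0 := by
  have := congrFun (congrArg (· *ᵥ u) (coord_transpose_mul_koszul₃ y)) 0
  simp only [← Matrix.mulVec_mulVec, Matrix.zero_mulVec] at this
  simpa [Matrix.mulVec, dotProduct, values_coord] using this

end ThreeCubics

/-! ### Exactness of the complex that resolves f, g, h -/

namespace ThreeCubics

open MvPolynomial Form
open scoped Matrix

section Complex

/-- The first syzygies of `f`, `g`, `h`. -/
def firstSyz {S : Type*} [CommRing S] (v : Fin 5 → S) : Matrix (Fin 3) (Fin 8) S :=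
  values v syzRows * values v liftMat * values v pencilSection

/-- The second syzygies of `f`, `g`, `h`. -/
def secondSyz {S : Type*} [CommRing S] (v : Fin 5 → S) : Matrix (Fin 8) (Fin 10) S :=
  values v pencilProj * values v koszul₂

variable {S : Type*} [CommRing S] [CharP S 3] (v : Fin 5 → S)

lemma values_syzAll_mulVec (w : Fin 5 → S) : values v syzAll *ᵥ w =
    (Fin.append (values v syzRows *ᵥ w) (values v pencilRows *ᵥ w) : Fin (3 + 2) → S) := by
  ext1 i
  refine Fin.addCases (m := 3) (n := 2) (fun i => ?_) (fun i => ?_) i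
  · rw [Fin.append_left]; rfl
  · rw [Fin.append_right]; rfl

lemma syzAll_mulVec_self : values v syzAll *ᵥ v = 0 := by
  rw [← basisChangeInv_mul_quinticSyz, ← Matrix.mulVec_mulVec, quinticSyz_mulVec_self,
    Matrix.mulVec_zero]

lemma koszul₁_mulVec_coord (c : S) :
    values v koszul₁ *ᵥ c • v = 0 := by
  rw [← values_coord_mulVec, Matrix.mulVec_mulVec, koszul₁_mul_coord, Matrix.zero_mulVec]

lemma syzRows_mulVec_self : values v syzRows *ᵥ v = 0 := by
  ext1 i
  exact congrFun (syzAll_mulVec_self v) (Fin.castAdd 2 i)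

lemma section_mulVec_proj (u : Fin 10 → S) :
    values v pencilSection *ᵥ values v pencilProj *ᵥ u =
      u - values v pencil *ᵥ values v pencilCoord *ᵥ u := by
  rw [eq_sub_iff_add_eq, Matrix.mulVec_mulVec, Matrix.mulVec_mulVec, ← Matrix.add_mulVec,
    pencilSection_mul_proj, Matrix.one_mulVec]

lemma liftMat_mulVec_section_proj (u : Fin 10 → S) :
    values v liftMat *ᵥ values v pencilSection *ᵥ values v pencilProj *ᵥ u =
      values v liftMat *ᵥ u := by
  rw [section_mulVec_proj, Matrix.mulVec_sub, Matrix.mulVec_mulVec _ _ (values v pencil),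
    liftMat_mul_pencil, Matrix.zero_mulVec, sub_zero]

/-- The image of `koszul₂` under `liftMat`. -/
lemma koszul₁_mulVec_liftMat (w : Fin 10 → S) :
    values v koszul₁ *ᵥ values v liftMat *ᵥ values v koszul₂ *ᵥ w = 0 := by
  rw [Matrix.mulVec_mulVec _ _ (values v liftMat), ← pencilMinors_mul_koszul₃,
    Matrix.mulVec_mulVec, Matrix.mul_assoc, koszul₃_mul_koszul₂, Matrix.mul_zero,
    Matrix.zero_mulVec]

lemma values_cubicsChange_mulVec (a : Fin 3 → S) :
    values v cubicsChange *ᵥ a = values v basisChange *ᵥ (Fin.append a 0 : Fin (3 + 2) → S) := by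
  ext1 i
  rw [Matrix.mulVec, Matrix.mulVec, dotProduct, dotProduct, Fin.sum_univ_add (a := 3) (b := 2)]
  simp only [Fin.append_left, Fin.append_right, Pi.zero_apply, mul_zero, Finset.sum_const_zero,
    add_zero]
  rfl

/-- The generators `f`, `g`, `h` form a complex with `firstSyz`. -/
lemma cubics_mulVec_firstSyz (w : Fin 8 → S) : values v cubics *ᵥ firstSyz v *ᵥ w = 0 := by
  rw [firstSyz, ← Matrix.mulVec_mulVec, ← Matrix.mulVec_mulVec]
  set x := values v liftMat *ᵥ values v pencilSection *ᵥ w with hx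
  have h : values v pencilRows *ᵥ x = 0 := by
    rw [hx, Matrix.mulVec_mulVec, pencilRows_mul_liftMat, Matrix.zero_mulVec]
  rw [← quinticGens_mul_cubicsChange, ← Matrix.mulVec_mulVec, values_cubicsChange_mulVec, ← h,
    ← values_syzAll_mulVec, ← basisChangeInv_mul_quinticSyz, ← Matrix.mulVec_mulVec,
    Matrix.mulVec_mulVec _ (values v basisChange), basisChange_mul_inv, Matrix.one_mulVec,
    Matrix.mulVec_mulVec, quinticGens_mul_quinticSyz, Matrix.zero_mulVec]

end Complex

/-- The lift of a Koszul boundary has zero wedge product with y, so it is a multiple of y, and y is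
killed by the syzygy matrix. -/
lemma firstSyz_mulVec_secondSyz (w : Fin 10 → R) : firstSyz y *ᵥ secondSyz y *ᵥ w = 0 := by
  obtain ⟨c, hc⟩ := y_regularCoords.exists_of_koszul₁ (koszul₁_mulVec_liftMat y w)
  have hc : values y liftMat *ᵥ values y koszul₂ *ᵥ w = c • y := by
    ext1 i; simpa [mul_comm] using hc i
  rw [firstSyz, secondSyz, ← Matrix.mulVec_mulVec, ← Matrix.mulVec_mulVec, ← Matrix.mulVec_mulVec,
    liftMat_mulVec_section_proj, hc, Matrix.mulVec_smul, syzRows_mulVec_self, smul_zero]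

/-- If the lift of U gives the zero relation, it is a multiple of y, so r₁ ∧ r₂ ∧ ρ = 0 for the
Koszul image ρ of U. Then ρ is a combination of r₁ and r₂, and U differs from an element of the
pencil by a Koszul cycle, that is, a boundary. -/
lemma exists_of_firstSyz {w : Fin 8 → R} (h : firstSyz y *ᵥ w = 0) :
    ∃ z, w = secondSyz y *ᵥ z := by
  rw [firstSyz, ← Matrix.mulVec_mulVec, ← Matrix.mulVec_mulVec] at h
  set U := values y pencilSection *ᵥ w with hU
  have hs : values y syzAll *ᵥ values y liftMat *ᵥ U = 0 := by
    rw [values_syzAll_mulVec, h, Matrix.mulVec_mulVec, pencilRows_mul_liftMat, Matrix.zero_mulVec]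
    ext1 i
    refine Fin.addCases (fun i => ?_) (fun i => ?_) i
    · rw [Fin.append_left]; rfl
    · rw [Fin.append_right]; rfl
  have hq : values y quinticSyz *ᵥ values y liftMat *ᵥ U = 0 := by
    rw [← Matrix.one_mulVec (values y quinticSyz *ᵥ _), ← basisChange_mul_inv,
      ← Matrix.mulVec_mulVec, Matrix.mulVec_mulVec _ _ (values y quinticSyz),
      basisChangeInv_mul_quinticSyz, hs, Matrix.mulVec_zero]
  obtain ⟨γ, hγ⟩ := exists_of_quinticSyz hq
  have hN : values y pencilMinors *ᵥ values y koszul₃ *ᵥ U = 0 := by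
    rw [Matrix.mulVec_mulVec, pencilMinors_mul_koszul₃, ← Matrix.mulVec_mulVec, hγ,
      koszul₁_mulVec_coord]
  obtain ⟨c, hc⟩ := exists_of_pencilMinors hN
  have hK : values y koszul₃ *ᵥ (U - values y pencil *ᵥ c) = 0 := by
    rw [Matrix.mulVec_sub, hc, Matrix.mulVec_mulVec, koszul₃_mul_pencil, sub_self]
  obtain ⟨z, hz⟩ := y_regularCoords.exists_of_koszul₃ hK
  refine ⟨z, ?_⟩
  rw [secondSyz, ← Matrix.mulVec_mulVec, ← hz, Matrix.mulVec_sub, Matrix.mulVec_mulVec _ _ (values y pencil),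
    pencilProj_mul_pencil, Matrix.zero_mulVec, sub_zero, hU, Matrix.mulVec_mulVec,
    pencilProj_mul_section, Matrix.one_mulVec]

/-- Dividing by the pencil creates no new kernel: a Koszul boundary inside the pencil gives a
vanishing combination of the two rows, and these are independent. -/
lemma exists_of_secondSyz {z : Fin 10 → R} (h : secondSyz y *ᵥ z = 0) :
    ∃ a, z = values y koszul₁ *ᵥ a := by
  rw [secondSyz, ← Matrix.mulVec_mulVec] at h
  have h' := section_mulVec_proj y (values y koszul₂ *ᵥ z)
  rw [h, Matrix.mulVec_zero, eq_comm, sub_eq_zero] at h'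
  have h0 := pencilRows_injective (c := values y pencilCoord *ᵥ values y koszul₂ *ᵥ z) (by
    rw [← koszul₃_mul_pencil, ← Matrix.mulVec_mulVec, ← h', Matrix.mulVec_mulVec,
      koszul₃_mul_koszul₂, Matrix.zero_mulVec])
  rw [h0, Matrix.mulVec_zero] at h'
  exact y_regularCoords.exists_of_koszul₂ h'

lemma lift_mulVec {i : Fin 5} {S : Type*} [CommRing S] {v : Fin 5 → S}
    {A : Matrix (Fin 10) (Fin 5) S} {B : Matrix (Fin 1) (Fin 5) S} {C : Matrix (Fin 5) (Fin 2) S}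
    (h : v i ^ 2 • (1 : Matrix (Fin 5) (Fin 5) S) =
      values v liftMat * A + values v coord * B + C * values v pencilRows) {w : Fin 5 → S}
    (hw : values v pencilRows *ᵥ w = 0) :
    v i ^ 2 • w = values v liftMat *ᵥ A *ᵥ w + (B *ᵥ w) 0 • v := by
  have := congrArg (· *ᵥ w) h
  simp only [Matrix.add_mulVec, ← Matrix.mulVec_mulVec, hw, Matrix.mulVec_zero, add_zero,
    Matrix.smul_mulVec, Matrix.one_mulVec] at this
  rw [this, ← values_coord_mulVec]
  congr 3
  ext1 i
  rw [Subsingleton.elim i 0]; rfl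

/-- The vectors that are orthogonal to the rows of the pencil. -/
lemma exists_of_pencilRows {w : Fin 5 → R} (h : values y pencilRows *ᵥ w = 0) :
    ∃ (u : Fin 10 → R) (c : R), w = values y liftMat *ᵥ u + c • y := by
  have e4 := lift_mulVec (lift_identity₄ y) h
  have e1 := lift_mulVec (lift_identity₁ y) h
  set g4 := values y liftInv₄ *ᵥ w
  set g1 := values y liftInv₁ *ᵥ w
  set k4 := (values y liftCoord₄ *ᵥ w) 0
  set k1 := (values y liftCoord₁ *ᵥ w) 0
  clear_value g4 g1 k4 k1
  set ρ4 := values y koszul₃ *ᵥ g4 with hρ4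
  set ρ1 := values y koszul₃ *ᵥ g1 with hρ1
  -- Wedging with y removes the multiple of y, so y₄² (w ∧ y) and y₁² (w ∧ y) become wedge products
  -- of r₁ ∧ r₂ with covectors. The task is to divide the first of these covectors by y₄², modulo
  -- the rows.
  have f4 : y 4 ^ 2 • (values y koszul₁ *ᵥ w) = values y pencilMinors *ᵥ ρ4 := by
    rw [← Matrix.mulVec_smul, e4, Matrix.mulVec_add, koszul₁_mulVec_coord, add_zero, hρ4,
      Matrix.mulVec_mulVec, Matrix.mulVec_mulVec, pencilMinors_mul_koszul₃]
  have f1 : y 1 ^ 2 • (values y koszul₁ *ᵥ w) = values y pencilMinors *ᵥ ρ1 := by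
    rw [← Matrix.mulVec_smul, e1, Matrix.mulVec_add, koszul₁_mulVec_coord, add_zero, hρ1,
      Matrix.mulVec_mulVec, Matrix.mulVec_mulVec, pencilMinors_mul_koszul₃]
  obtain ⟨c, hc⟩ := exists_of_pencilMinors (ρ := y 1 ^ 2 • ρ4 - y 4 ^ 2 • ρ1) (by
    rw [Matrix.mulVec_sub, Matrix.mulVec_smul, Matrix.mulVec_smul, ← f4, ← f1, smul_comm, sub_self])
  have hc' : ∀ j, y 1 ^ 2 * ρ4 j - y 4 ^ 2 * ρ1 j =
      values y pencilRows 0 j * c 0 + values y pencilRows 1 j * c 1 := fun j => by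
    rw [← pencilRows_transpose_mulVec, ← hc]; rfl
  -- By Cramer's rule on columns 1 and 4, `pencilMinor` times each coefficient lies in (y₁², y₄²).
  -- This ideal is primary and `pencilMinor` is outside its radical, so the coefficients themselves
  -- lie in it.
  obtain ⟨a₀, b₀, h₀⟩ := exists_of_mul_eq_sq (α := c 0) pencilMinor_notMem
    (A := values y pencilRows 1 4 * ρ4 1 - values y pencilRows 1 1 * ρ4 4)
    (B := -(values y pencilRows 1 4 * ρ1 1 - values y pencilRows 1 1 * ρ1 4)) (by
      rw [pencilMinor]
      linear_combination values y pencilRows 1 1 * hc' 4 - values y pencilRows 1 4 * hc' 1)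
  obtain ⟨a₁, b₁, h₁⟩ := exists_of_mul_eq_sq (α := c 1) pencilMinor_notMem
    (A := values y pencilRows 0 1 * ρ4 4 - values y pencilRows 0 4 * ρ4 1)
    (B := -(values y pencilRows 0 1 * ρ1 4 - values y pencilRows 0 4 * ρ1 1)) (by
      rw [pencilMinor]
      linear_combination values y pencilRows 0 4 * hc' 1 - values y pencilRows 0 1 * hc' 4)
  have key : ∀ j, ∃ σ, ρ4 j - ((values y pencilRows)ᵀ *ᵥ ![a₀, a₁]) j = y 4 ^ 2 * σ := fun j => by
    obtain ⟨σ, hσ, -⟩ := exists_of_sq_mul_eq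
      (a := ρ4 j - ((values y pencilRows)ᵀ *ᵥ ![a₀, a₁]) j)
      (b := ρ1 j + (values y pencilRows 0 j * b₀ + values y pencilRows 1 j * b₁)) (by
        rw [pencilRows_transpose_mulVec]
        simp only [Matrix.cons_val_zero, Matrix.cons_val_one]
        linear_combination hc' j + values y pencilRows 0 j * h₀ + values y pencilRows 1 j * h₁)
    exact ⟨σ, hσ⟩
  choose σ hσ using key
  -- The corrected quotient σ is still orthogonal to y, hence is the Koszul image of a trivector u.
  -- This u replaces `g4` divided by y₄².
  obtain ⟨u, hu⟩ := y_regularCoords.exists_eq_koszul₃ (r := σ) (by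
    refine mul_left_cancel₀ (pow_ne_zero 2 (y_ne_zero 4)) ?_
    rw [mul_zero, Finset.mul_sum]
    simp_rw [mul_left_comm _ (y _) (σ _), ← hσ, mul_sub, Finset.sum_sub_distrib]
    rw [y_dotProduct_pencilRows, hρ4, y_dotProduct_koszul₃, sub_zero])
  have hg : values y koszul₃ *ᵥ (g4 - values y pencil *ᵥ ![a₀, a₁] - y 4 ^ 2 • u) = 0 := by
    rw [Matrix.mulVec_sub, Matrix.mulVec_sub, Matrix.mulVec_mulVec, koszul₃_mul_pencil,
      Matrix.mulVec_smul, ← hu, sub_eq_zero]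
    ext1 j
    exact hσ j
  obtain ⟨z, hz⟩ := y_regularCoords.exists_of_koszul₃ hg
  obtain ⟨κ, hκ⟩ := y_regularCoords.exists_of_koszul₁ (koszul₁_mulVec_liftMat y z)
  have hH : values y liftMat *ᵥ g4 = y 4 ^ 2 • (values y liftMat *ᵥ u) + κ • y := by
    have h1 : values y liftMat *ᵥ values y koszul₂ *ᵥ z = κ • y := by
      ext1 j; simpa [mul_comm] using hκ j
    rw [← h1, ← hz, Matrix.mulVec_sub, Matrix.mulVec_sub, Matrix.mulVec_mulVec, liftMat_mul_pencil,
      Matrix.zero_mulVec, Matrix.mulVec_smul]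
    abel
  have hw : ∀ j, y 4 ^ 2 * (w j - (values y liftMat *ᵥ u) j) = (κ + k4) * y j := fun j => by
    have := congrFun e4 j
    rw [hH] at this
    simp only [Pi.smul_apply, Pi.add_apply, smul_eq_mul] at this
    linear_combination this
  -- What remains is y₄² (w - lift of u) equal to a multiple of y. As y₄ does not divide y₀, the
  -- entry 0 shows that y₄² divides the multiplier.
  obtain ⟨c, hc⟩ := (prime_y 4).pow_dvd_of_dvd_mul_right 2 (not_y_dvd_y (j := 0) (by decide))
    (Dvd.intro _ (hw 0))
  refine ⟨u, c, ?_⟩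
  ext1 j
  refine mul_left_cancel₀ (pow_ne_zero 2 (y_ne_zero 4)) ?_
  simp only [Pi.smul_apply, Pi.add_apply, smul_eq_mul]
  linear_combination hw j + y j * hc

/-- A relation among f, g, h is a relation among all five cubics with two zero coefficients. It
comes from some w under the syzygy matrix, and the two zeros say that w is orthogonal to the rows of
the pencil. -/
lemma exists_of_cubics {a : Fin 3 → R} (h : values y cubics *ᵥ a = 0) :
    ∃ w, a = firstSyz y *ᵥ w := by
  rw [← quinticGens_mul_cubicsChange, ← Matrix.mulVec_mulVec, values_cubicsChange_mulVec] at h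
  have h' := congrFun h 0
  rw [values_quinticGens_mulVec] at h'
  obtain ⟨w, hw⟩ := mem_syzRange_y h'
  rw [Matrix.mulVecLin_apply] at hw
  have hw' := congrArg (values y basisChangeInv *ᵥ ·) hw
  simp only [Matrix.mulVec_mulVec, basisChangeInv_mul_quinticSyz, basisChangeInv_mul,
    Matrix.one_mulVec, values_syzAll_mulVec] at hw'
  have ha : values y syzRows *ᵥ w = a := by
    ext1 i
    have := congrFun hw' (Fin.castAdd 2 i)
    rwa [Fin.append_left, Fin.append_left] at this
  have hr : values y pencilRows *ᵥ w = 0 := by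
    ext1 i
    have := congrFun hw' (Fin.natAdd 3 i)
    rwa [Fin.append_right, Fin.append_right] at this
  obtain ⟨u, c, rfl⟩ := exists_of_pencilRows hr
  refine ⟨values y pencilProj *ᵥ u, ?_⟩
  rw [firstSyz, ← Matrix.mulVec_mulVec, ← Matrix.mulVec_mulVec, liftMat_mulVec_section_proj, ← ha,
    Matrix.mulVec_add, Matrix.mulVec_smul, syzRows_mulVec_self, smul_zero, add_zero]

end ThreeCubics

/-! ### The graded resolution and the Betti numbers -/

namespace ThreeCubics

open MvPolynomial Form
open scoped Matrix

section Homogeneity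

/-- All entries are forms of the same degree. -/
def IsHomogeneousMatrix {m n : Type*} (M : Matrix m n R) (d : ℕ) : Prop :=
  ∀ i j, (M i j).IsHomogeneous d

lemma IsHomogeneousMatrix.mul {l m n : Type*} [Fintype m] {M : Matrix l m R} {N : Matrix m n R}
    {d e : ℕ} (hM : IsHomogeneousMatrix M d) (hN : IsHomogeneousMatrix N e) :
    IsHomogeneousMatrix (M * N) (d + e) := fun i j =>
  IsHomogeneous.sum _ _ _ fun k _ => (hM i k).mul (hN k j)

lemma isHomogeneousMatrix_values {m n : Type*} {A : Matrix m n Form} {d : ℕ} (hd : d ≤ 3)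
    (hA : ∀ i j, (A i j).degree = d) : IsHomogeneousMatrix (values y A) d := fun i j => by
  have := value_isHomogeneous y y_isHomogeneous (A i j) (by rw [hA]; exact hd)
  rwa [hA] at this

lemma isHomogeneousMatrix_firstSyz : IsHomogeneousMatrix (firstSyz y) 3 :=
  ((isHomogeneousMatrix_values (d := 1) (by decide) fun _ _ => rfl).mul
    (isHomogeneousMatrix_values (d := 2) (by decide) fun _ _ => rfl)).mul
    (isHomogeneousMatrix_values (d := 0) (by decide) fun _ _ => rfl)

lemma isHomogeneousMatrix_secondSyz : IsHomogeneousMatrix (secondSyz y) 1 := by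
  have := (isHomogeneousMatrix_values (A := pencilProj) (d := 0) (by decide) fun _ _ => rfl).mul
    (isHomogeneousMatrix_values (A := koszul₂) (d := 1) (by decide) fun _ _ => rfl)
  exact this

end Homogeneity

section Resolution

lemma mem_J {x : R} : x ∈ J ↔ ∃ a, values y cubics *ᵥ a = ![x] := by
  rw [J, Submodule.mem_span_triple]
  have : ∀ a : Fin 3 → R, values y cubics *ᵥ a = ![a 0 * f + a 1 * g + a 2 * h] := fun a => by
    ext1 i
    rw [Subsingleton.elim i 0]
    simp [Matrix.mulVec, dotProduct, Fin.sum_univ_three, values, f_eq, g_eq, h_eq, mul_comm]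
  simp only [this]
  constructor
  · rintro ⟨a, b, c, rfl⟩
    exact ⟨![a, b, c], by simp⟩
  · rintro ⟨a, ha⟩
    exact ⟨a 0, a 1, a 2, congrFun ha 0⟩

/-- The ranks of the free modules in the resolution. -/
def resolutionRank : ℕ → ℕ
  | 0 => 1
  | 1 => 3
  | 2 => 8
  | 3 => 10
  | 4 => 5
  | 5 => 1
  | _ + 6 => 0

/-- The degrees of the generators of the free modules in the resolution. -/
def resolutionDegree : ℕ → ℕ
  | 0 => 0
  | 1 => 3
  | 2 => 6
  | 3 => 7
  | 4 => 8
  | 5 => 9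
  | _ + 6 => 0

/-- The differentials of the resolution. -/
noncomputable def resolutionMap :
    (i : ℕ) → Matrix (Fin (resolutionRank i)) (Fin (resolutionRank (i + 1))) R
  | 0 => values y cubics
  | 1 => firstSyz y
  | 2 => secondSyz y
  | 3 => values y koszul₁
  | 4 => values y coord
  | _ + 5 => 0

lemma resolutionMap_isHomogeneous (i : ℕ) (s : Fin (resolutionRank i))
    (t : Fin (resolutionRank (i + 1))) : ∃ m, resolutionDegree i + m = resolutionDegree (i + 1) ∧
      m ≠ 0 ∧ (resolutionMap i s t).IsHomogeneous m := by
  match i with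
  | 0 => exact ⟨3, rfl, by decide, isHomogeneousMatrix_values (d := 3) (A := cubics) le_rfl
      (fun _ _ => rfl) s t⟩
  | 1 => exact ⟨3, rfl, by decide, isHomogeneousMatrix_firstSyz s t⟩
  | 2 => exact ⟨1, rfl, by decide, isHomogeneousMatrix_secondSyz s t⟩
  | 3 => exact ⟨1, rfl, by decide, isHomogeneousMatrix_values (d := 1) (A := koszul₁) (by decide)
      (fun _ _ => rfl) s t⟩
  | 4 => exact ⟨1, rfl, by decide, isHomogeneousMatrix_values (d := 1) (A := coord) (by decide)
      (fun _ _ => rfl) s t⟩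
  | _ + 5 => exact t.elim0

lemma exact_of_mulVec {l m n : ℕ} {M : Matrix (Fin l) (Fin m) R} {N : Matrix (Fin m) (Fin n) R}
    (h : ∀ w, M *ᵥ N *ᵥ w = 0) (h' : ∀ z, M *ᵥ z = 0 → ∃ w, z = N *ᵥ w) :
    Function.Exact N.mulVecLin M.mulVecLin := by
  intro z
  simp only [Matrix.mulVecLin_apply, Set.mem_range]
  constructor
  · intro hz
    obtain ⟨w, rfl⟩ := h' z hz
    exact ⟨w, rfl⟩
  · rintro ⟨w, rfl⟩
    exact h w

lemma coord_injective {a : Fin 1 → R} (h : values y coord *ᵥ a = 0) : a = 0 := by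
  have := congrFun h 0
  simp only [Matrix.mulVec, dotProduct, values_coord, Finset.univ_unique, Finset.sum_singleton,
    Pi.zero_apply, mul_eq_zero, y_ne_zero, false_or] at this
  ext1 i
  rw [Subsingleton.elim i default, this]; rfl

lemma resolutionMap_exact (i : ℕ) :
    Function.Exact (resolutionMap (i + 1)).mulVecLin (resolutionMap i).mulVecLin := by
  match i with
  | 0 => exact exact_of_mulVec (cubics_mulVec_firstSyz y) fun _ => exists_of_cubics
  | 1 => exact exact_of_mulVec firstSyz_mulVec_secondSyz fun _ => exists_of_firstSyz
  | 2 =>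
    refine exact_of_mulVec (M := secondSyz y) (N := values y koszul₁) (fun w => ?_)
      fun _ => exists_of_secondSyz
    rw [secondSyz, ← Matrix.mulVec_mulVec, Matrix.mulVec_mulVec _ (values y koszul₂),
      koszul₂_mul_koszul₁, Matrix.zero_mulVec, Matrix.mulVec_zero]
  | 3 =>
    refine exact_of_mulVec (M := values y koszul₁) (N := values y coord) (fun w => ?_) fun z hz => ?_
    · rw [Matrix.mulVec_mulVec, koszul₁_mul_coord, Matrix.zero_mulVec]
    · obtain ⟨c, hc⟩ := y_regularCoords.exists_of_koszul₁ hz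
      refine ⟨![c], ?_⟩
      rw [values_coord_mulVec]
      ext1 i; simpa [mul_comm] using hc i
  | 4 =>
    refine exact_of_mulVec (M := values y coord) (N := (0 : Matrix (Fin 1) (Fin 0) R)) (fun w => ?_) fun z hz => ?_
    · rw [Matrix.zero_mulVec, Matrix.mulVec_zero]
    · exact ⟨0, by rw [coord_injective hz, Matrix.mulVec_zero]⟩
  | k + 5 =>
    intro z
    have : z = 0 := by ext1 i; exact i.elim0
    subst this
    exact ⟨fun _ => ⟨0, map_zero _⟩, fun _ => map_zero _⟩

lemma smul_mk_one (x : R) : x • Ideal.Quotient.mk J 1 = Ideal.Quotient.mk J x := by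
  change Ideal.Quotient.mk J (x * 1) = _
  rw [mul_one]

/-- The minimal graded free resolution of `R ⧸ J`. -/
noncomputable def resolution : MinimalGradedFreeResolution J where
  rank := resolutionRank
  deg i _ := resolutionDegree i
  gen _ := 1
  d := resolutionMap
  gen_homogeneous _ := isHomogeneous_one _ _
  d_homogeneous i s t _ := by
    obtain ⟨m, h, -, hm⟩ := resolutionMap_isHomogeneous i s t
    exact ⟨m, h, hm⟩
  d_minimal i s t := by
    obtain ⟨m, -, h, hm⟩ := resolutionMap_isHomogeneous i s t
    exact hm.coeff_eq_zero (by simpa using h.symm)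
  augmentation_surjective := by
    intro z
    obtain ⟨x, rfl⟩ := Ideal.Quotient.mk_surjective z
    refine ⟨fun _ => x, ?_⟩
    change ∑ i : Fin 1, x • Ideal.Quotient.mk J 1 = _
    rw [Fin.sum_univ_one]
    exact smul_mk_one x
  exact_zero := by
    intro (z : Fin 1 → R)
    change ∑ i : Fin 1, z i • Ideal.Quotient.mk J 1 = 0 ↔ _
    rw [Fin.sum_univ_one]
    refine (Iff.of_eq (congrArg (· = 0) (smul_mk_one (z (0 : Fin 1))))).trans ?_
    rw [Ideal.Quotient.eq_zero_iff_mem, mem_J]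
    have : z = ![z 0] := by
      ext1 i
      rw [Subsingleton.elim i 0]; rfl
    rw [← this]
    rfl
  exact_succ := resolutionMap_exact

lemma hasGradedBettiNumbers_J : HasGradedBettiNumbers J bettiTable := by
  refine ⟨resolution, fun i j => ?_⟩
  have : resolution.betti i j = if resolutionDegree i = j then resolutionRank i else 0 := by
    change (Finset.univ.filter fun _ : Fin (resolutionRank i) => resolutionDegree i = j).card = _
    split_ifs with h <;> simp [h]
  rw [this]
  match i with
  | 0 | 1 | 2 | 3 | 4 | 5 =>
    simp only [resolutionDegree, resolutionRank]
    split_ifs with h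
    · subst h; rfl
    · unfold bettiTable; grind
  | k + 6 => simp [resolutionRank, bettiTable]

end Resolution

end ThreeCubics

/-! ### Projective dimension by dimension shifting -/

namespace ThreeCubics

open CategoryTheory Form
open scoped Matrix

section ProjectiveDimension

variable {A : Type} [CommRing A] {n : ℕ} {N L : Type} [AddCommGroup N] [Module A N]
  [AddCommGroup L] [Module A L]

lemma hasProjectiveDimensionLT_iff_ker (φ : (Fin n → A) →ₗ[A] N) (hφ : Function.Surjective φ)
    (k : ℕ) : HasProjectiveDimensionLT (ModuleCat.of A N) (k + 2) ↔
      HasProjectiveDimensionLT (ModuleCat.of A (LinearMap.ker φ)) (k + 1) := by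
  have h : Projective (ModuleCat.of A (Fin n → A)) :=
    (IsProjective.iff_projective (R := A) (Fin n → A)).mp inferInstance
  exact (LinearMap.shortExact_shortComplexKer hφ).hasProjectiveDimensionLT_X₃_iff k h

lemma hasProjectiveDimensionLT_iff_range {m : ℕ} (φ : (Fin n → A) →ₗ[A] N)
    (hφ : Function.Surjective φ) (ψ : (Fin m → A) →ₗ[A] (Fin n → A)) (h : Function.Exact ψ φ)
    (k : ℕ) : HasProjectiveDimensionLT (ModuleCat.of A N) (k + 2) ↔
      HasProjectiveDimensionLT (ModuleCat.of A (LinearMap.range ψ)) (k + 1) := by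
  rw [hasProjectiveDimensionLT_iff_ker φ hφ, h.linearMap_ker_eq]

lemma hasProjectiveDimensionLT_range_iff {m : ℕ} (φ : (Fin n → A) →ₗ[A] N)
    (ψ : (Fin m → A) →ₗ[A] (Fin n → A)) (h : Function.Exact ψ φ)
    (k : ℕ) : HasProjectiveDimensionLT (ModuleCat.of A (LinearMap.range φ)) (k + 2) ↔
      HasProjectiveDimensionLT (ModuleCat.of A (LinearMap.range ψ)) (k + 1) := by
  refine hasProjectiveDimensionLT_iff_range φ.rangeRestrict φ.surjective_rangeRestrict ψ ?_ k
  intro x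
  rw [← h x, Subtype.ext_iff]
  rfl

lemma hasProjectiveDimensionLT_iff_koszul₁ (k : ℕ) :
    HasProjectiveDimensionLT (ModuleCat.of R (R ⧸ J)) (k + 5) ↔
      HasProjectiveDimensionLT (ModuleCat.of R
        (LinearMap.range (values y koszul₁).mulVecLin)) (k + 1) := by
  rw [hasProjectiveDimensionLT_iff_range _ resolution.augmentation_surjective _ resolution.exact_zero (k + 3)]
  refine (hasProjectiveDimensionLT_range_iff _ _ (resolutionMap_exact 0) (k + 2)).trans ?_
  refine (hasProjectiveDimensionLT_range_iff _ _ (resolutionMap_exact 1) (k + 1)).trans ?_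
  exact hasProjectiveDimensionLT_range_iff _ _ (resolutionMap_exact 2) k

lemma hasProjectiveDimensionLT_six : HasProjectiveDimensionLT (ModuleCat.of R (R ⧸ J)) 6 := by
  refine (hasProjectiveDimensionLT_iff_koszul₁ 1).mpr ?_
  refine (hasProjectiveDimensionLT_range_iff _ _ (resolutionMap_exact 3) 0).mpr ?_
  rw [zero_add, ← projective_iff_hasProjectiveDimensionLT_one, ← IsProjective.iff_projective]
  have hinj : Function.Injective (values y coord).mulVecLin := by
    rw [← LinearMap.ker_eq_bot, LinearMap.ker_eq_bot']
    exact fun a => coord_injective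
  exact Module.Projective.of_equiv (LinearEquiv.ofInjective _ hinj)

/-- If the image of `koszul₁` were projective, the multiplication by y from R to R⁵ would split, and
1 would be a combination of the coordinates. -/
lemma not_hasProjectiveDimensionLT_five :
    ¬ HasProjectiveDimensionLT (ModuleCat.of R (R ⧸ J)) 5 := by
  intro h
  have h := (hasProjectiveDimensionLT_iff_koszul₁ 0).mp h
  rw [zero_add, ← projective_iff_hasProjectiveDimensionLT_one, ← IsProjective.iff_projective] at h
  set φ := (values y koszul₁).mulVecLin with hφ
  obtain ⟨s, hs⟩ := Module.projective_lifting_property φ.rangeRestrict LinearMap.id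
    φ.surjective_rangeRestrict
  have hs' : ∀ x, φ (s (φ.rangeRestrict x)) = φ x := fun x =>
    congrArg Subtype.val (LinearMap.congr_fun hs (φ.rangeRestrict x))
  -- The splitting s makes x - s(φ x) a multiple c(x) of y. Summing over unit vectors with weights
  -- `y i` gives y = (∑ `y i` c(eᵢ)) y, which fails at the origin after cancelling y.
  have key : ∀ x : Fin 5 → R, ∃ c, x - s (φ.rangeRestrict x) = c • y := fun x => by
    obtain ⟨c, hc⟩ := y_regularCoords.exists_of_koszul₁ (a := x - s (φ.rangeRestrict x)) (by
      rw [← Matrix.mulVecLin_apply, ← hφ, map_sub, hs', sub_self])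
    exact ⟨c, by ext1 i; simpa [mul_comm] using hc i⟩
  choose c hc using key
  have hy : φ.rangeRestrict y = 0 := by
    ext1
    have := koszul₁_mulVec_coord y 1
    rwa [one_smul] at this
  have hsum : y = (∑ i, y i * c (Pi.single i 1)) • y := by
    have h1 : ∑ i, y i • (Pi.single i 1 : Fin 5 → R) = y := by
      ext1 j; simp [Finset.sum_apply, Pi.single_apply]
    calc y = y - s (φ.rangeRestrict y) := by rw [hy, map_zero, sub_zero]
      _ = ∑ i, y i • ((Pi.single i 1 : Fin 5 → R) - s (φ.rangeRestrict (Pi.single i 1))) := by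
        simp only [smul_sub, Finset.sum_sub_distrib, h1, ← map_smul, ← map_sum]
      _ = _ := by simp only [hc, smul_smul, Finset.sum_smul]
  have h1 : (1 : R) = ∑ i, y i * c (Pi.single i 1) := by
    refine mul_right_cancel₀ (y_ne_zero 0) ?_
    rw [one_mul]
    exact congrFun hsum 0
  have := congrArg (evalAt 0) h1
  simp [evalAt_y] at this

lemma projectiveDimension_J : projectiveDimension (ModuleCat.of R (R ⧸ J)) = 5 := by
  refine le_antisymm ?_ ?_
  · exact (projectiveDimension_le_iff _ 5).mpr hasProjectiveDimensionLT_six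
  · exact (projectiveDimension_ge_iff _ 5).mpr not_hasProjectiveDimensionLT_five

end ProjectiveDimension

end ThreeCubics

/-! ### Minimal generators, and the ideal of the projected Veronese surface -/

namespace ThreeCubics

open MvPolynomial Form
open scoped Matrix

section Independence

/-- B inverts the matrix of values of the forms at the m points p, so a form in their span is
determined by its values at these points. -/
lemma linearIndependent_of_eval {m : ℕ} (A : Fin m → Form) (p : Matrix (Fin m) (Fin 5) (ZMod 3))
    (B : Matrix (Fin m) (Fin m) (ZMod 3))
    (h : ∀ k i, ∑ j, B k j * (A i).value (p j) = if k = i then 1 else 0) :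
    LinearIndependent (ZMod 3) fun i => (A i).value y := by
  rw [Fintype.linearIndependent_iff]
  intro c hc k
  have hj : ∀ j, ∑ i, c i * (A i).value (p j) = 0 := fun j => by
    have := congrArg (evalAt (p j)) hc
    simpa [evalAt_value] using this
  have : ∑ j, B k j * ∑ i, c i * (A i).value (p j) = c k := by
    simp_rw [Finset.mul_sum]
    rw [Finset.sum_comm]
    have : ∀ i, ∑ j, B k j * (c i * (A i).value (p j)) = c i * if k = i then 1 else 0 := fun i => by
      rw [← h k i, Finset.mul_sum]
      exact Finset.sum_congr rfl fun j _ => by ring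
    simp [this]
  rw [← this]
  simp [hj]

lemma isMinimallyGenerated_quinticIdeal : IsMinimallyGeneratedByForms (quinticIdeal y) 5 3 :=
  ⟨fun i => (quinticGens 0 i).value y,
    fun i => value_isHomogeneous y y_isHomogeneous (quinticGens 0 i) le_rfl,
    linearIndependent_of_eval _
      !![0, 0, 0, 0, 1; 0, 0, 0, 1, 0; 1, 0, 0, 0, 0; 0, 0, 0, 1, 1; 0, 0, 1, 1, 0]
      !![1, 0, 0, 0, 0; 2, 2, 1, 2, 2; 0, 0, 2, 2, 1; 0, 1, 0, 0, 0; 1, 1, 0, 2, 1]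
      (by decide +kernel), rfl⟩

lemma isMinimallyGenerated_projectedVeroneseIdeal :
    IsMinimallyGeneratedByForms (projectedVeroneseIdeal y) 7 3 :=
  ⟨fun i => (veroneseGens 0 i).value y,
    fun i => value_isHomogeneous y y_isHomogeneous (veroneseGens 0 i) le_rfl,
    linearIndependent_of_eval _
      !![0, 0, 0, 0, 1; 0, 0, 0, 1, 0; 0, 0, 0, 1, 1; 0, 0, 1, 0, 1; 0, 0, 1, 1, 0; 0, 1, 0, 1, 0;
        0, 0, 0, 1, 2]
      !![1, 0, 0, 0, 0, 0, 0; 0, 2, 2, 0, 0, 0, 2; 2, 0, 2, 0, 0, 0, 1; 0, 1, 0, 0, 0, 0, 0;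
        2, 0, 2, 2, 2, 2, 0; 2, 0, 0, 2, 0, 0, 0; 0, 2, 0, 0, 2, 0, 0]
      (by decide +kernel), rfl⟩

end Independence

section Veronese

/-- The linear forms that define the projection of the Veronese surface. -/
noncomputable def projectionForms : Fin 5 → MvPolynomial (Fin 6) (ZMod 3) :=
  ![-X 0 - X 1 - X 2 - X 4, X 0 + X 1 - X 2 + X 3, X 0 + X 1 + X 2 - X 3 + X 4 + X 5,
    X 2 - X 3 - X 4, X 1 + X 2 - X 3 + X 4]

lemma projectionForms_isHomogeneous (i : Fin 5) : (projectionForms i).IsHomogeneous 1 := by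
  have h : ∀ j, (X j : MvPolynomial (Fin 6) (ZMod 3)).IsHomogeneous 1 := isHomogeneous_X _
  fin_cases i
  · exact (((h 0).neg.sub (h 1)).sub (h 2)).sub (h 4)
  · exact (((h 0).add (h 1)).sub (h 2)).add (h 3)
  · exact (((((h 0).add (h 1)).add (h 2)).sub (h 3)).add (h 4)).add (h 5)
  · exact ((h 2).sub (h 3)).sub (h 4)
  · exact (((h 1).add (h 2)).sub (h 3)).add (h 4)

lemma projectionForms_linearIndependent : LinearIndependent (ZMod 3) projectionForms := by
  rw [Fintype.linearIndependent_iff]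
  intro c hc
  have h : ∀ j : Fin 6, aeval (Pi.single j 1 : Fin 6 → ZMod 3) (∑ i, c i • projectionForms i) = 0 :=
    fun j => by rw [hc, map_zero]
  have h0 := h 0
  have h1 := h 1
  have h2 := h 2
  have h3 := h 3
  have h5 := h 5
  simp [Fin.sum_univ_five, projectionForms] at h0 h1 h2 h3 h5
  intro i
  fin_cases i <;> simp <;> grind

/-- The quadratic parametrization of the projected Veronese surface. -/
noncomputable def parametrization : R →ₐ[ZMod 3] MvPolynomial (Fin 3) (ZMod 3) :=
  (aeval (R := ZMod 3) (![X 0 ^ 2, X 0 * X 1, X 0 * X 2, X 1 ^ 2, X 1 * X 2, X 2 ^ 2] :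
    Fin 6 → MvPolynomial (Fin 3) (ZMod 3))).comp (aeval (R := ZMod 3) projectionForms)

/-- The images of the coordinates under the parametrization. -/
noncomputable def parametrizationCoords : Fin 5 → MvPolynomial (Fin 3) (ZMod 3) :=
  ![X 0 ^ 2, X 1 ^ 2, X 2 ^ 2, X 0 * X 1 - X 0 * X 2, X 0 * X 1 - X 1 * X 2]

lemma parametrization_y (i : Fin 5) : parametrization (y i) = parametrizationCoords i := by
  have hX : ∀ i, parametrization (X i) = aeval (![X 0 ^ 2, X 0 * X 1, X 0 * X 2, X 1 ^ 2, X 1 * X 2, X 2 ^ 2] :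
    Fin 6 → MvPolynomial (Fin 3) (ZMod 3)) (projectionForms i) := fun i => by
    rw [parametrization, AlgHom.comp_apply, aeval_X]
  obtain ⟨h0, h1, h2, h3, h4⟩ := y_eq
  fin_cases i
  · simp [h0, hX, projectionForms, parametrizationCoords, two_eq_neg_one]; grind
  · simp [h1, hX, projectionForms, parametrizationCoords, two_eq_neg_one]; grind
  · simp [h2, hX, projectionForms, parametrizationCoords, two_eq_neg_one]; grind
  · simp [h3, hX, projectionForms, parametrizationCoords, two_eq_neg_one]; grind
  · simp [h4, hX, projectionForms, parametrizationCoords, two_eq_neg_one]; grind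

lemma parametrization_value (P : Form) : parametrization (P.value y) = P.value parametrizationCoords := by
  refine (map_value parametrization.toRingHom y P).trans ?_
  congr 1
  ext1 i
  exact parametrization_y i

lemma parametrization_veroneseGens (i : Fin 7) :
    parametrization ((veroneseGens 0 i).value y) = 0 := by
  rw [parametrization_value]
  fin_cases i <;>
  simp only [Fin.zero_eta, Fin.mk_one, Fin.reduceFinMk, veroneseGens_value_0, veroneseGens_value_1,
    veroneseGens_value_2, veroneseGens_value_3, veroneseGens_value_4, veroneseGens_value_5,
    veroneseGens_value_6, parametrizationCoords] <;> simp <;> grind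

lemma baseMap_X (i : Fin 3) : baseMap (X i) = y (Fin.castAdd 2 i) := by
  refine fibreEquiv.symm_apply_eq.mpr ((fibreEquiv_y _).trans ?_).symm
  fin_cases i <;> rfl

lemma parametrization_baseMap (a : MvPolynomial (Fin 3) (ZMod 3)) :
    parametrization (baseMap a) = expand 2 a := by
  have : parametrization.toRingHom.comp baseMap = (expand 2).toRingHom := by
    refine MvPolynomial.ringHom_ext (fun r => ?_) fun i => ?_
    · exact RingHom.congr_fun (RingHom.ext_zmod ((parametrization.toRingHom.comp baseMap).comp C)
        ((expand 2).toRingHom.comp C)) r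
    · change parametrization (baseMap (X i)) = expand 2 (X i)
      fin_cases i <;> simp [baseMap_X, parametrization_y, parametrizationCoords]
  exact RingHom.congr_fun this a

/-- The polynomials that are even in all variables, times the products of pairs of variables, are
independent. -/
lemma expand_independent {a b c d : MvPolynomial (Fin 3) (ZMod 3)}
    (h : expand 2 a + expand 2 b * (X 0 * X 1) + expand 2 c * (X 0 * X 2) +
      expand 2 d * (X 1 * X 2) = 0) : a = 0 ∧ b = 0 ∧ c = 0 ∧ d = 0 := by
  -- Changing the sign of one variable fixes every expanded polynomial and changes the sign of two
  -- of the three products. Signed sums of the four resulting equations isolate four times one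
  -- summand, and 4 = 1 here.
  have flip : ∀ (i : Fin 3) (p : MvPolynomial (Fin 3) (ZMod 3)),
      aeval (fun j => if j = i then -X j else X j : Fin 3 → MvPolynomial (Fin 3) (ZMod 3))
        (expand 2 p) = expand 2 p := fun i p => by
    rw [expand, ← AlgHom.comp_apply]
    congr 1
    ext1 j
    by_cases hj : j = i <;> simp [hj]
  have h0 := congrArg (aeval (fun j => if j = 0 then -X j else X j :
    Fin 3 → MvPolynomial (Fin 3) (ZMod 3))) h
  have h1 := congrArg (aeval (fun j => if j = 1 then -X j else X j :
    Fin 3 → MvPolynomial (Fin 3) (ZMod 3))) h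
  have h2 := congrArg (aeval (fun j => if j = 2 then -X j else X j :
    Fin 3 → MvPolynomial (Fin 3) (ZMod 3))) h
  simp only [map_add, map_mul, flip, aeval_X, map_zero] at h0 h1 h2
  simp at h0 h1 h2
  have inj : ∀ {p : MvPolynomial (Fin 3) (ZMod 3)} {m : MvPolynomial (Fin 3) (ZMod 3)},
      m ≠ 0 → expand 2 p * m = 0 → p = 0 := fun hm h =>
    expand_injective two_pos (((mul_eq_zero.mp h).resolve_right hm).trans (map_zero _).symm)
  have hX : ∀ i, (X i : MvPolynomial (Fin 3) (ZMod 3)) ≠ 0 := X_ne_zero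
  have h3 : (3 : MvPolynomial (Fin 3) (ZMod 3)) = 0 := by
    exact_mod_cast CharP.cast_eq_zero (MvPolynomial (Fin 3) (ZMod 3)) 3
  refine ⟨inj one_ne_zero ?_, inj (mul_ne_zero (hX 0) (hX 1)) ?_,
    inj (mul_ne_zero (hX 0) (hX 2)) ?_, inj (mul_ne_zero (hX 1) (hX 2)) ?_⟩
  · linear_combination h + h0 + h1 + h2 - expand 2 a * h3
  · linear_combination h - h0 - h1 + h2 - expand 2 b * (X 0 * X 1) * h3
  · linear_combination h - h0 + h1 - h2 - expand 2 c * (X 0 * X 2) * h3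
  · linear_combination h + h0 - h1 - h2 - expand 2 d * (X 1 * X 2) * h3

lemma exists_sub_mem_projectedVeroneseIdeal (x : R) :
    ∃ n : Fin 6 → MvPolynomial (Fin 3) (ZMod 3),
      x - (baseMap (n 0) + baseMap (n 1) * y 3 + baseMap (n 2) * y 4 + baseMap (n 3) * y 3 ^ 2 +
        baseMap (n 4) * (y 3 * y 4) + baseMap (n 5) * y 4 ^ 2) ∈ projectedVeroneseIdeal y := by
  have hG : ∀ i, (veroneseGens 0 i).value (fibreCoords X) ∈ projectedVeroneseIdeal
      (fibreCoords (X : Fin 3 → MvPolynomial (Fin 3) (ZMod 3))) :=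
    fun i => Ideal.subset_span ⟨i, rfl⟩
  have h0 := hG 0
  have h1 := hG 1
  have h2 := hG 2
  have h3 := hG 3
  rw [veroneseGens_fibreCoords_0] at h0
  rw [veroneseGens_fibreCoords_1] at h1
  rw [veroneseGens_fibreCoords_2] at h2
  rw [veroneseGens_fibreCoords_3] at h3
  obtain ⟨n, hn⟩ := exists_low _ (veroneseLow X) h0 h1 h2 h3
    (fibreEquiv x)
  refine ⟨n, ?_⟩
  obtain ⟨w, hw⟩ := Ideal.mem_span_range_iff_exists_fun.mp hn
  refine Ideal.mem_span_range_iff_exists_fun.mpr ⟨fun i => fibreEquiv.symm (w i), ?_⟩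
  have h := congrArg fibreEquiv.symm (sub_eq_iff_eq_add.mp hw.symm)
  have hs : fibreEquiv.symm (Polynomial.C Polynomial.X) = y 3 :=
    fibreEquiv.symm_apply_eq.mpr (fibreEquiv_y 3).symm
  have ht : fibreEquiv.symm Polynomial.X = y 4 := fibreEquiv.symm_apply_eq.mpr (fibreEquiv_y 4).symm
  have hb : ∀ a, fibreEquiv.symm (Polynomial.C (Polynomial.C a)) = baseMap a := fun _ => rfl
  rw [low_eq] at h
  refine (sub_eq_iff_eq_add.mpr ?_).symm
  simpa only [map_sum, map_mul, map_add, map_pow, fibreEquiv_symm_value, hs, ht, hb,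
    RingEquiv.symm_apply_apply] using h

/-- The ideal of the projected Veronese surface. -/
lemma ker_parametrization : RingHom.ker parametrization = projectedVeroneseIdeal y := by
  have hle : projectedVeroneseIdeal y ≤ RingHom.ker parametrization := by
    rw [projectedVeroneseIdeal, Ideal.span_le]
    rintro _ ⟨i, rfl⟩
    exact parametrization_veroneseGens i
  refine le_antisymm (fun x hx => ?_) hle
  obtain ⟨n, hn⟩ := exists_sub_mem_projectedVeroneseIdeal x
  suffices h : baseMap (n 0) + baseMap (n 1) * y 3 + baseMap (n 2) * y 4 + baseMap (n 3) * y 3 ^ 2 +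
      baseMap (n 4) * (y 3 * y 4) + baseMap (n 5) * y 4 ^ 2 ∈ projectedVeroneseIdeal y by
    simpa using add_mem hn h
  have h0 : parametrization (baseMap (n 0) + baseMap (n 1) * y 3 + baseMap (n 2) * y 4 +
      baseMap (n 3) * y 3 ^ 2 + baseMap (n 4) * (y 3 * y 4) + baseMap (n 5) * y 4 ^ 2) = 0 := by
    have := sub_mem hx (hle hn)
    simpa using this
  simp only [map_add, map_mul, map_pow, parametrization_baseMap, parametrization_y] at h0
  simp only [parametrizationCoords] at h0
  -- The equation is sorted by the parity of the exponents; squares of the parameters are absorbed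
  -- as base coordinates.
  obtain ⟨e0, e1, e2, e3⟩ := expand_independent
    (a := n 0 + n 3 * (X 0 * X 1 + X 0 * X 2) + n 4 * (X 0 * X 1) + n 5 * (X 0 * X 1 + X 1 * X 2))
    (b := n 1 + n 2 + X 2 * n 4) (c := -n 1 - X 1 * n 4 + X 1 * n 5)
    (d := -n 2 + X 0 * n 3 - X 0 * n 4) (by
      simp only [map_add, map_sub, map_neg, map_mul, expand_X]
      simp at h0
      grind)
  replace e0 := congrArg baseMap e0
  replace e1 := congrArg baseMap e1
  replace e2 := congrArg baseMap e2
  replace e3 := congrArg baseMap e3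
  have b0 : baseMap (X 0) = y 0 := baseMap_X 0
  have b1 : baseMap (X 1) = y 1 := baseMap_X 1
  have b2 : baseMap (X 2) = y 2 := baseMap_X 2
  simp only [map_add, map_sub, map_neg, map_mul, map_zero, b0, b1, b2] at e0 e1 e2 e3
  clear h0
  generalize baseMap (n 0) = n₀ at *
  generalize baseMap (n 1) = n₁ at *
  generalize baseMap (n 2) = n₂ at *
  generalize baseMap (n 3) = n₃ at *
  generalize baseMap (n 4) = n₄ at *
  generalize baseMap (n 5) = n₅ at *
  -- Eliminating n₁ and n₂ leaves y₀ (n₃ - n₄) + y₁ (n₅ - n₄) + y₂ n₄ = 0. The three Koszul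
  -- relations that solve it correspond to the last three generators.
  obtain ⟨c₀, c₁, h₄⟩ := y_regularCoords.two n₄ (-(n₃ - n₄)) (-(n₅ - n₄))
    (by linear_combination e1 + e2 + e3)
  obtain ⟨e, he⟩ := y_regularCoords.one (n₅ - n₄ + y 2 * c₁) (-(n₃ - n₄ + y 2 * c₀))
    (by linear_combination e1 + e2 + e3 - y 2 * h₄)
  have he' : -(n₃ - n₄ + y 2 * c₀) = y 1 * e := y_regularCoords.zero _ _ (by
    linear_combination y 1 * he - (e1 + e2 + e3 - y 2 * h₄))
  refine Ideal.mem_span_range_iff_exists_fun.mpr ⟨![0, 0, 0, 0, c₀ + e, c₁, c₀], ?_⟩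
  simp only [Fin.sum_univ_succ, Fin.sum_univ_zero]
  simp
  rw [veroneseGens_value_4, veroneseGens_value_5, veroneseGens_value_6]
  have i₅ : n₅ = n₄ + y 0 * e - y 2 * c₁ := by linear_combination he
  have i₃ : n₃ = n₄ - y 1 * e - y 2 * c₀ := by linear_combination -he'
  have i₁ : n₁ = y 1 * (n₅ - n₄) := by linear_combination -e2
  have i₂ : n₂ = y 0 * (n₃ - n₄) := by linear_combination -e3
  have i₀ : n₀ = -(n₃ * (y 0 * y 1 + y 0 * y 2) + n₄ * (y 0 * y 1) +
    n₅ * (y 0 * y 1 + y 1 * y 2)) := by linear_combination e0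
  rw [i₀, i₁, i₂, i₅, i₃, h₄]
  grind

lemma isProjectedVeroneseIdeal : IsProjectedVeroneseIdeal (projectedVeroneseIdeal y) :=
  ⟨projectionForms, projectionForms_isHomogeneous, projectionForms_linearIndependent,
    ker_parametrization.symm⟩

end Veronese

end ThreeCubics

/-! ### The product of the two ideals, and the regular sequence f, g -/

namespace ThreeCubics

open MvPolynomial Form
open scoped Matrix

section Linkage

lemma cubic_mem_quinticIdeal (i : Fin 3) : (cubics 0 i).value y ∈ quinticIdeal y := by
  have h := congrFun (congrFun (quinticGens_mul_cubicsChange y) 0) i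
  rw [Matrix.mul_apply] at h
  refine mem_quinticIdeal.mpr ⟨fun j => values y cubicsChange j i, ?_⟩
  refine Eq.trans ?_ h
  exact Finset.sum_congr rfl fun j _ => mul_comm _ _

lemma J_le_quinticIdeal : J ≤ quinticIdeal y := by
  rw [J, Ideal.span_le]
  rintro _ (rfl | rfl | rfl)
  · rw [f_eq]; exact cubic_mem_quinticIdeal 0
  · rw [g_eq]; exact cubic_mem_quinticIdeal 1
  · rw [h_eq]; exact cubic_mem_quinticIdeal 2

lemma f_mem_projectedVeroneseIdeal : f ∈ projectedVeroneseIdeal y := by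
  rw [← ker_parametrization, RingHom.mem_ker, f_eq, parametrization_value]
  simp [cubics, Form.matrix, value_cubic, valueAux, monomialValue, parametrizationCoords]
  grind

lemma g_mem_projectedVeroneseIdeal : g ∈ projectedVeroneseIdeal y := by
  rw [← ker_parametrization, RingHom.mem_ker, g_eq, parametrization_value]
  simp [cubics, Form.matrix, value_cubic, valueAux, monomialValue, parametrizationCoords]
  grind

lemma h_not_mem_projectedVeroneseIdeal : h ∉ projectedVeroneseIdeal y := by
  rw [← ker_parametrization, RingHom.mem_ker, h_eq, parametrization_value]
  intro h0
  -- At the parameters (1, 1, 1), that is, at the point (1, 1, 1, 0, 0) of the surface, h is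
  -- nonzero.
  have h1 := congrArg (aeval (fun _ => 1 : Fin 3 → ZMod 3)) h0
  rw [aeval_value, map_zero] at h1
  simp only [parametrizationCoords] at h1
  have : (fun i => aeval (fun _ => 1 : Fin 3 → ZMod 3) ((![X 0 ^ 2, X 1 ^ 2, X 2 ^ 2,
      X 0 * X 1 - X 0 * X 2, X 0 * X 1 - X 1 * X 2] : Fin 5 → MvPolynomial (Fin 3) (ZMod 3)) i)) =
      ![1, 1, 1, 0, 0] := by
    ext1 i; fin_cases i <;> simp
  rw [this] at h1
  revert h1
  decide +kernel

instance : (projectedVeroneseIdeal y).IsPrime := by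
  rw [← ker_parametrization]; exact RingHom.ker_isPrime parametrization

lemma quinticIdeal_mul_projectedVeroneseIdeal_le :
    quinticIdeal y * projectedVeroneseIdeal y ≤ Ideal.span {f, g} := by
  rw [quinticIdeal, projectedVeroneseIdeal, Ideal.span_mul_span', Ideal.span_le]
  rintro _ ⟨_, ⟨i, rfl⟩, _, ⟨j, rfl⟩, rfl⟩
  change (quinticGens 0 i).value y * (veroneseGens 0 j).value y ∈ Ideal.span {f, g}
  rw [quinticGens_mul_veroneseGens, ← f_eq, ← g_eq]
  exact add_mem (Ideal.mul_mem_right _ _ (Ideal.subset_span (by simp)))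
    (Ideal.mul_mem_right _ _ (Ideal.subset_span (by simp)))

lemma prime_f : Prime f := by
  rw [← irreducible_iff_prime, ← MulEquiv.irreducible_iff (finSuccEquiv (ZMod 3) 4)]
  have hf : finSuccEquiv (ZMod 3) 4 f = Polynomial.X ^ 3 + (
      Polynomial.C (-X 1 - X 2 + X 3) * Polynomial.X ^ 2 +
      Polynomial.C (X 0 * X 1 + X 1 ^ 2 - X 0 * X 3 - X 2 * X 3) * Polynomial.X +
      Polynomial.C (X 0 * X 1 ^ 2 - X 0 * X 1 * X 2 - X 1 ^ 2 * X 2 - X 0 * X 2 ^ 2 -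
        X 1 * X 2 ^ 2 - X 2 ^ 3 - X 0 ^ 2 * X 3 - X 0 * X 1 * X 3 + X 0 * X 2 * X 3 +
        X 1 * X 2 * X 3 - X 2 ^ 2 * X 3 + X 1 * X 3 ^ 2 + X 2 * X 3 ^ 2 + X 3 ^ 3)) := by
    have h1 : finSuccEquiv (ZMod 3) 4 (X 1) = Polynomial.C (X 0) := finSuccEquiv_X_succ (j := 0)
    have h2 : finSuccEquiv (ZMod 3) 4 (X 2) = Polynomial.C (X 1) := finSuccEquiv_X_succ (j := 1)
    have h3 : finSuccEquiv (ZMod 3) 4 (X 3) = Polynomial.C (X 2) := finSuccEquiv_X_succ (j := 2)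
    have h4 : finSuccEquiv (ZMod 3) 4 (X 4) = Polynomial.C (X 3) := finSuccEquiv_X_succ (j := 3)
    simp only [f, map_add, map_sub, map_mul, map_pow, map_neg, h1, h2, h3, h4, finSuccEquiv_X_zero]
    ring
  rw [hf]
  -- f is monic in the variable `X 0`. Specializing `X 1`, …, `X 4` to 1, 0, 1, 0 gives the cubic T³
  -- - T² - 2, which has no root modulo 3.
  refine Polynomial.Monic.irreducible_of_irreducible_map
    (aeval (R := ZMod 3) (![1, 0, 1, 0] : Fin 4 → ZMod 3)).toRingHom _ ?_ ?_
  · exact Polynomial.monic_X_pow_add Polynomial.degree_quadratic_lt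
  · have : Polynomial.map (aeval (R := ZMod 3) (![1, 0, 1, 0] : Fin 4 → ZMod 3)).toRingHom (Polynomial.X ^ 3 + (
      Polynomial.C (-X 1 - X 2 + X 3) * Polynomial.X ^ 2 +
      Polynomial.C (X 0 * X 1 + X 1 ^ 2 - X 0 * X 3 - X 2 * X 3) * Polynomial.X +
      Polynomial.C (X 0 * X 1 ^ 2 - X 0 * X 1 * X 2 - X 1 ^ 2 * X 2 - X 0 * X 2 ^ 2 -
        X 1 * X 2 ^ 2 - X 2 ^ 3 - X 0 ^ 2 * X 3 - X 0 * X 1 * X 3 + X 0 * X 2 * X 3 +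
        X 1 * X 2 * X 3 - X 2 ^ 2 * X 3 + X 1 * X 3 ^ 2 + X 2 * X 3 ^ 2 + X 3 ^ 3))) =
      Polynomial.C 1 * Polynomial.X ^ 3 + Polynomial.C (-1) * Polynomial.X ^ 2 +
        Polynomial.C 0 * Polynomial.X + Polynomial.C (-2) := by
      have h2 : Polynomial.C (2 : ZMod 3) = 2 := rfl
      simp [h2]
      ring
    rw [this]
    refine Polynomial.irreducible_of_degree_le_three_of_not_isRoot ?_ ?_
    · rw [Polynomial.natDegree_cubic (by decide)]; decide
    · intro x
      simp only [Polynomial.IsRoot, Polynomial.eval_add, Polynomial.eval_mul, Polynomial.eval_C,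
        Polynomial.eval_pow, Polynomial.eval_X]
      revert x; decide

lemma not_f_dvd_g : ¬ f ∣ g := by
  rintro ⟨q, hq⟩
  have := congrArg (aeval (![0, 1, 0, 0, 0] : Fin 5 → ZMod 3)) hq
  simp [f, g] at this

lemma f_mul_mem {x : R} (hx : g * x ∈ Ideal.span {f}) : x ∈ Ideal.span {f} := by
  rw [Ideal.mem_span_singleton] at *
  exact (prime_f.dvd_or_dvd hx).resolve_left not_f_dvd_g

lemma span_f_g_le_ker : Ideal.span {f, g} ≤ RingHom.ker (evalAt 0) := by
  rw [Ideal.span_le]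
  rintro _ (rfl | rfl)
  · change evalAt 0 f = 0
    rw [f_eq, evalAt_value]; decide +kernel
  · change evalAt 0 g = 0
    rw [g_eq, evalAt_value]; decide +kernel

lemma isRegular_f_g : RingTheory.Sequence.IsRegular R [f, g] := by
  refine ⟨⟨fun i hi => ?_⟩, fun h => ?_⟩
  · refine (isSMulRegular_quotient_iff_mem_of_smul_mem _ _).mpr ?_
    intro x hx
    have : i = 0 ∨ i = 1 := by simp at hi; omega
    rcases this with rfl | rfl
    · simpa [prime_f.ne_zero] using hx
    · simpa using f_mul_mem (by simpa using hx)
  · have h1 : (1 : R) ∈ Ideal.span {f, g} := by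
      have : (1 : R) ∈ (⊤ : Submodule R R) := trivial
      rw [h] at this
      simpa [Ideal.span_insert] using this
    simpa using span_f_g_le_ker h1

end Linkage

end ThreeCubics

/-! ### Integrality over the base, linkage, height and the unmixed part -/

namespace ThreeCubics

section

open Polynomial

/-- If all cubic monomials in `s`, `t` can be reduced modulo `I`, then the quotient by `I` is
integral. -/
lemma exists_monic_eval₂_C_mem {A : Type*} [CommRing A] (I : Ideal A[X][X]) (c : Fin 4 → Fin 6 → A)
    (h₀ : X ^ 3 + low (c 0) ∈ I) (h₁ : C X * X ^ 2 + low (c 1) ∈ I)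
    (h₂ : C X ^ 2 * X + low (c 2) ∈ I) (h₃ : C X ^ 3 + low (c 3) ∈ I) (x : A[X][X]) :
    ∃ p : A[X], p.Monic ∧ p.eval₂ (C.comp C) x ∈ I := by
  have : Module.Finite A (A[X][X] ⧸ I) := by
    refine Module.Finite.of_surjective
      ((Ideal.Quotient.mkₐ A I).toLinearMap.comp low) fun z => ?_
    obtain ⟨x, rfl⟩ := Ideal.Quotient.mk_surjective z
    obtain ⟨e, he⟩ := exists_low I c h₀ h₁ h₂ h₃ x
    exact ⟨e, (Ideal.Quotient.eq.mpr he).symm⟩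
  have hint : IsIntegral A (Ideal.Quotient.mk I x) := Algebra.IsIntegral.isIntegral _
  obtain ⟨p, hp, hpx⟩ := hint
  refine ⟨p, hp, Ideal.Quotient.eq_zero_iff_mem.mp ?_⟩
  rw [← hpx, Polynomial.hom_eval₂]
  rfl

end

open MvPolynomial Form
open scoped Matrix

section Finite

lemma exists_monic_eval₂_mem {N : Ideal R} (c : Fin 4 → Fin 6 → MvPolynomial (Fin 3) (ZMod 3))
    (h₀ : fibreEquiv.symm (.X ^ 3 + low (c 0)) ∈ N)
    (h₁ : fibreEquiv.symm (.C .X * .X ^ 2 + low (c 1)) ∈ N)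
    (h₂ : fibreEquiv.symm (.C .X ^ 2 * .X + low (c 2)) ∈ N)
    (h₃ : fibreEquiv.symm (.C .X ^ 3 + low (c 3)) ∈ N) (x : R) :
    ∃ p : Polynomial (MvPolynomial (Fin 3) (ZMod 3)), p.Monic ∧ p.eval₂ baseMap x ∈ N := by
  obtain ⟨p, hp, hpx⟩ := exists_monic_eval₂_C_mem (N.comap fibreEquiv.symm) c h₀ h₁ h₂ h₃
    (fibreEquiv x)
  refine ⟨p, hp, ?_⟩
  have := Polynomial.hom_eval₂ p (Polynomial.C.comp Polynomial.C) fibreEquiv.symm.toRingHom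
    (fibreEquiv x)
  have hx : fibreEquiv.symm.toRingHom (fibreEquiv x) = x := fibreEquiv.symm_apply_apply x
  rw [hx] at this
  exact this ▸ hpx

lemma exists_monic_eval₂_mem_quinticIdeal (x : R) :
    ∃ p : Polynomial (MvPolynomial (Fin 3) (ZMod 3)), p.Monic ∧
      p.eval₂ baseMap x ∈ quinticIdeal y := by
  have h : ∀ i, fibreEquiv.symm ((quinticGens 0 i).value (fibreCoords X)) ∈ quinticIdeal y :=
    fun i => by rw [fibreEquiv_symm_value]; exact Ideal.subset_span ⟨i, rfl⟩
  have h0 := h 0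
  have h1 := h 1
  have h2 := h 2
  have h3 := h 3
  rw [quinticGens_fibreCoords_0] at h0
  rw [quinticGens_fibreCoords_1] at h1
  rw [quinticGens_fibreCoords_2] at h2
  rw [quinticGens_fibreCoords_3] at h3
  exact exists_monic_eval₂_mem (fun i => quinticLow X i.castSucc) h0 h1 h2 h3 x

lemma exists_monic_eval₂_mem_projectedVeroneseIdeal (x : R) :
    ∃ p : Polynomial (MvPolynomial (Fin 3) (ZMod 3)), p.Monic ∧
      p.eval₂ baseMap x ∈ projectedVeroneseIdeal y := by
  have h : ∀ i, fibreEquiv.symm ((veroneseGens 0 i).value (fibreCoords X)) ∈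
      projectedVeroneseIdeal y :=
    fun i => by rw [fibreEquiv_symm_value]; exact Ideal.subset_span ⟨i, rfl⟩
  have h0 := h 0
  have h1 := h 1
  have h2 := h 2
  have h3 := h 3
  rw [veroneseGens_fibreCoords_0] at h0
  rw [veroneseGens_fibreCoords_1] at h1
  rw [veroneseGens_fibreCoords_2] at h2
  rw [veroneseGens_fibreCoords_3] at h3
  exact exists_monic_eval₂_mem (veroneseLow X) h0 h1 h2 h3 x

/-- Incomparability for integral extensions: R modulo N is integral over the base, so a strictly
larger ideal Q over the prime P contracts to a strictly larger ideal of the base. -/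
lemma exists_baseMap_mem_of_lt {N P Q : Ideal R} [P.IsPrime]
    (hN : ∀ x, ∃ p : Polynomial (MvPolynomial (Fin 3) (ZMod 3)), p.Monic ∧ p.eval₂ baseMap x ∈ N)
    (hNP : N ≤ P) (hPQ : P < Q) : ∃ a ≠ 0, baseMap a ∈ Q := by
  obtain ⟨hle, r, hrQ, hrP⟩ := SetLike.lt_iff_le_and_exists.mp hPQ
  obtain ⟨p, hp, hpr⟩ := hN r
  have := Ideal.comap_lt_comap_of_root_mem_sdiff hle ⟨hrQ, hrP⟩
    (Polynomial.map_monic_ne_zero hp) (hNP hpr)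
  obtain ⟨-, a, haQ, haP⟩ := SetLike.lt_iff_le_and_exists.mp this
  exact ⟨a, fun ha => haP (by rw [ha]; exact zero_mem _), haQ⟩

end Finite

section Linkage

lemma h_mem_J : h ∈ J := Ideal.subset_span (by simp)

lemma span_f_g_le_J : Ideal.span {f, g} ≤ J :=
  Ideal.span_mono (by grind)

lemma span_f_g_le_projectedVeroneseIdeal : Ideal.span {f, g} ≤ projectedVeroneseIdeal y := by
  rw [Ideal.span_le]
  rintro _ (rfl | rfl)
  · exact f_mem_projectedVeroneseIdeal
  · exact g_mem_projectedVeroneseIdeal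

/-- No prime that contains both ideals is in general position over the base. -/
lemma exists_baseMap_mem_sup : ∃ a ≠ 0, baseMap a ∈ projectedVeroneseIdeal y ⊔ quinticIdeal y :=
  exists_baseMap_mem_of_lt exists_monic_eval₂_mem_projectedVeroneseIdeal le_rfl
    (lt_of_le_of_ne le_sup_left fun h => h_not_mem_projectedVeroneseIdeal
      (h ▸ Ideal.mem_sup_right (J_le_quinticIdeal h_mem_J)))

/-- If x multiplies the Veronese ideal into (f, g), then x times a nonzero base element of the sum
of both ideals lies in the quintic ideal, and the base element cancels. If x multiplies the quintic
ideal into (f, g), then xh lies in the Veronese ideal, which is prime and does not contain h. -/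
lemma areLinkedVia : AreLinkedVia f g (quinticIdeal y) (projectedVeroneseIdeal y) := by
  have hmul : ∀ x ∈ quinticIdeal y, ∀ z ∈ projectedVeroneseIdeal y, x * z ∈ Ideal.span {f, g} :=
    fun x hx z hz => quinticIdeal_mul_projectedVeroneseIdeal_le (Ideal.mul_mem_mul hx hz)
  refine ⟨isRegular_f_g, le_antisymm (fun x hx => ?_) fun x hx => ?_,
    le_antisymm (fun x hx => ?_) fun x hx => ?_⟩
  · exact Submodule.mem_colon.mpr fun z hz => hmul x hx z hz
  · obtain ⟨a, ha, hab⟩ := exists_baseMap_mem_sup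
    obtain ⟨u, hu, w, hw, huw⟩ := Submodule.mem_sup.mp hab
    refine mem_quinticIdeal_y_of_mul_mem ha ?_
    rw [← huw, add_mul, mul_comm u]
    exact add_mem (J_le_quinticIdeal (span_f_g_le_J (Submodule.mem_colon.mp hx u hu)))
      (Ideal.mul_mem_right _ _ hw)
  · exact Submodule.mem_colon.mpr fun z hz => by
      rw [smul_eq_mul, mul_comm]; exact hmul z hz x hx
  · have := span_f_g_le_projectedVeroneseIdeal
      (Submodule.mem_colon.mp hx h (J_le_quinticIdeal h_mem_J))
    exact (Ideal.IsPrime.mem_or_mem inferInstance this).resolve_right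
      h_not_mem_projectedVeroneseIdeal

end Linkage

section Height

/-- The chain 0 < (f) < P consists of primes, and the second inclusion is strict because f does not
divide g. -/
lemma two_le_height_of_isPrime {P : Ideal R} [P.IsPrime] (hP : Ideal.span {f, g} ≤ P) :
    2 ≤ P.height := by
  have hf : f ∈ P := hP (Ideal.subset_span (by simp))
  have hg : g ∈ P := hP (Ideal.subset_span (by simp))
  have : (Ideal.span {f}).IsPrime := (Ideal.span_singleton_prime prime_f.ne_zero).mpr prime_f
  have h1 : (⊥ : Ideal R) < Ideal.span {f} :=
    bot_lt_iff_ne_bot.mpr (by simpa using prime_f.ne_zero)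
  have h2 : Ideal.span {f} < P := by
    refine lt_of_le_of_ne (by simpa [Ideal.span_le] using hf) fun h => ?_
    rw [← h, Ideal.mem_span_singleton] at hg
    exact not_f_dvd_g hg
  have h3 := Ideal.height_add_one_le_of_lt_of_isPrime h1
  have h4 := Ideal.height_add_one_le_of_lt_of_isPrime h2
  calc (2 : ℕ∞) = 0 + 1 + 1 := by norm_num
    _ ≤ (⊥ : Ideal R).height + 1 + 1 := by gcongr; exact zero_le
    _ ≤ (Ideal.span {f}).height + 1 := by gcongr
    _ ≤ P.height := h4

lemma height_eq_two_of_mem_minimalPrimes {P : Ideal R} (hP : P ∈ (Ideal.span {f, g}).minimalPrimes) :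
    P.height = 2 := by
  have := hP.isPrime
  refine le_antisymm ?_ (two_le_height_of_isPrime hP.1.2)
  refine (Ideal.height_le_card_of_mem_minimalPrimes_span (Set.toFinite _) hP).trans ?_
  exact_mod_cast (Set.ncard_insert_le f {g}).trans (by simp)

lemma quinticIdeal_le_or_projectedVeroneseIdeal_le {P : Ideal R} [hp : P.IsPrime]
    (hP : Ideal.span {f, g} ≤ P) : quinticIdeal y ≤ P ∨ projectedVeroneseIdeal y ≤ P :=
  hp.mul_le.mp (quinticIdeal_mul_projectedVeroneseIdeal_le.trans hP)

lemma height_projectedVeroneseIdeal : 2 ≤ (projectedVeroneseIdeal y).height :=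
  two_le_height_of_isPrime span_f_g_le_projectedVeroneseIdeal

/-- A prime over `f`, `g` that is in general position over the base is minimal. -/
lemma mem_minimalPrimes_of_disjoint {P : Ideal R} [P.IsPrime] (hP : Ideal.span {f, g} ≤ P)
    (hd : ∀ a ≠ 0, baseMap a ∉ P) : P ∈ (Ideal.span {f, g}).minimalPrimes := by
  obtain ⟨P₁, hP₁, hle⟩ := Ideal.exists_minimalPrimes_le hP
  have := hP₁.isPrime
  rcases hle.eq_or_lt with rfl | hlt
  · exact hP₁
  obtain ⟨a, ha, haP⟩ : ∃ a ≠ 0, baseMap a ∈ P := by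
    -- The minimal prime contains one of the two linked ideals, and both have integral quotients
    -- over the base. So a strictly larger prime would meet the base.
    rcases quinticIdeal_le_or_projectedVeroneseIdeal_le hP₁.1.2 with h | h
    · exact exists_baseMap_mem_of_lt exists_monic_eval₂_mem_quinticIdeal h hlt
    · exact exists_baseMap_mem_of_lt exists_monic_eval₂_mem_projectedVeroneseIdeal h hlt
  exact absurd haP (hd a ha)

lemma quinticIdeal_le_ker : quinticIdeal y ≤ RingHom.ker (evalAt 0) := by
  rw [quinticIdeal, Ideal.span_le]
  rintro _ ⟨i, rfl⟩
  change evalAt 0 ((quinticGens 0 i).value y) = 0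
  rw [evalAt_value]
  revert i
  decide +kernel

lemma height_J : J.height = 2 := by
  refine le_antisymm ?_ ?_
  -- Torsion-freeness keeps the quintic ideal disjoint from the nonzero base elements, so some prime
  -- above it has the same property. Such a prime is minimal over (f, g), hence of height 2.
  · obtain ⟨P, hP, hle, hd⟩ := Ideal.exists_le_prime_disjoint (quinticIdeal y)
      ((nonZeroDivisors (MvPolynomial (Fin 3) (ZMod 3))).map baseMap) (by
        rw [Set.disjoint_left]
        rintro _ hx ⟨a, ha, rfl⟩
        have := mem_quinticIdeal_y_of_mul_mem (nonZeroDivisors.ne_zero ha) (x := 1)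
          (by simpa using hx)
        simpa using quinticIdeal_le_ker this)
    have hJP := J_le_quinticIdeal.trans hle
    have := height_eq_two_of_mem_minimalPrimes (mem_minimalPrimes_of_disjoint (span_f_g_le_J.trans hJP)
      fun a ha haP => Set.disjoint_left.mp hd haP ⟨a, mem_nonZeroDivisors_of_ne_zero ha, rfl⟩)
    exact this ▸ Ideal.height_mono hJP
  · rw [Ideal.height_eq_inf_minimalPrimes]
    refine le_iInf₂ fun P hP => ?_
    have := hP.isPrime
    exact two_le_height_of_isPrime (span_f_g_le_J.trans hP.1.2)

lemma height_radical {S : Type*} [CommRing S] (Q : Ideal S) : Q.radical.height = Q.height := by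
  rw [Ideal.height_eq_inf_minimalPrimes, Ideal.radical_minimalPrimes,
    ← Ideal.height_eq_inf_minimalPrimes]

/-- One primary decomposition suffices for the first inclusion: each component of the wrong height
absorbs x after multiplication by a nonzero base element, and the product of these multipliers
cancels modulo the quintic ideal. The other inclusion needs every component of height 2 in every
decomposition. -/
lemma unmixedPart_J : unmixedPart J = quinticIdeal y := by
  refine le_antisymm (fun x hx => ?_) (le_sInf ?_)
  · obtain ⟨(t : Finset (Ideal R)), ht⟩ := Submodule.IsLasker.exists_isMinimalPrimaryDecomposition
      (Submodule.isLasker R R) J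
    have hmem : ∀ Q ∈ t, ∃ a ≠ 0, baseMap a * x ∈ Q := fun Q hQ => by
      by_cases hh : Q.height = J.height
      · exact ⟨1, one_ne_zero, by
          simpa using Ideal.mem_sInf.mp hx (show Q ∈ _ from ⟨t, ht, hQ, hh⟩)⟩
      have hprim : Q.IsPrimary := ht.primary hQ
      have := Ideal.isPrime_radical hprim
      have hJQ : J ≤ Q := ht.inf_eq ▸ Finset.inf_le (f := id) hQ
      -- Otherwise the radical would be a minimal prime of (f, g), of height 2 like J.
      have : ∃ a ≠ 0, baseMap a ∈ Q.radical := by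
        by_contra! hd
        have := height_eq_two_of_mem_minimalPrimes (mem_minimalPrimes_of_disjoint
          ((span_f_g_le_J.trans hJQ).trans Ideal.le_radical) hd)
        rw [height_radical] at this
        exact hh (this.trans height_J.symm)
      obtain ⟨a, ha, k, hk⟩ := this
      exact ⟨a ^ k, pow_ne_zero k ha, Ideal.mul_mem_right _ _ (by simpa using hk)⟩
    choose! a ha hax using hmem
    refine mem_quinticIdeal_y_of_mul_mem (a := ∏ Q ∈ t, a Q) (Finset.prod_ne_zero_iff.mpr ha)
      (J_le_quinticIdeal ?_)
    rw [← ht.inf_eq, Submodule.mem_finsetInf]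
    intro Q hQ
    rw [← Finset.mul_prod_erase t a hQ, map_mul, mul_right_comm]
    exact Ideal.mul_mem_right _ _ (hax Q hQ)
  · rintro Q ⟨t, ht, hQ, hh⟩
    have hprim : Q.IsPrimary := ht.primary hQ
    have hP := Ideal.isPrime_radical hprim
    have hJQ : J ≤ Q := ht.inf_eq ▸ Finset.inf_le (f := id) hQ
    -- The inclusion would be strict because of h, and would raise the height of the component to at
    -- least 3.
    have hnot : ¬ projectedVeroneseIdeal y ≤ Q.radical := fun hle => by
      have hlt : projectedVeroneseIdeal y < Q.radical := lt_of_le_of_ne hle fun he =>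
        h_not_mem_projectedVeroneseIdeal (he ▸ Ideal.le_radical (hJQ h_mem_J))
      have h3 := Ideal.height_add_one_le_of_lt_of_isPrime hlt
      rw [height_radical, hh, height_J] at h3
      have := (add_le_add_left height_projectedVeroneseIdeal 1).trans h3
      revert this; norm_num
    obtain ⟨z, hz, hzQ⟩ := SetLike.not_le_iff_exists.mp hnot
    intro x hx
    have : x * z ∈ Q := hJQ (span_f_g_le_J (quinticIdeal_mul_projectedVeroneseIdeal_le
      (Ideal.mul_mem_mul hx hz)))
    exact ((Ideal.isPrimary_iff.mp hprim).2 this).resolve_right hzQ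

end Height

end ThreeCubics

open ThreeCubics in
theorem mainTheorem3 :
    (f.IsHomogeneous 3 ∧ g.IsHomogeneous 3 ∧ h.IsHomogeneous 3) ∧
    HasGradedBettiNumbers J bettiTable ∧
    CategoryTheory.projectiveDimension (ModuleCat.of R (R ⧸ J)) = 5 ∧
    ∃ (I I' : Ideal R) (p₁ p₂ : R),
      IsProjectedVeroneseIdeal I' ∧ IsMinimallyGeneratedByForms I' 7 3 ∧
      p₁.IsHomogeneous 3 ∧ p₂.IsHomogeneous 3 ∧ AreLinkedVia p₁ p₂ I I' ∧
      IsMinimallyGeneratedByForms I 5 3 ∧ unmixedPart J = I := by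
  have hf : f.IsHomogeneous 3 := f_eq ▸ value_isHomogeneous y y_isHomogeneous (cubics 0 0) le_rfl
  have hg : g.IsHomogeneous 3 := g_eq ▸ value_isHomogeneous y y_isHomogeneous (cubics 0 1) le_rfl
  have hh : h.IsHomogeneous 3 := h_eq ▸ value_isHomogeneous y y_isHomogeneous (cubics 0 2) le_rfl
  exact ⟨⟨hf, hg, hh⟩, hasGradedBettiNumbers_J, projectiveDimension_J,
    quinticIdeal y, projectedVeroneseIdeal y, f, g, isProjectedVeroneseIdeal,
    isMinimallyGenerated_projectedVeroneseIdeal, hf, hg, areLinkedVia,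
    isMinimallyGenerated_quinticIdeal, unmixedPart_J⟩
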